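/- Let $d\ge 1$ and let $u\in H^1(\mathbb{R}^d)$ be real-valued with $u\neq 0$ almost everywhere. Put $N=N_u=\lceil \int_{\mathbb{R}^d} u^2/2\rceil$. For $\Phi=(\phi_1,\dots,\phi_N)$ let $L(\Phi)=\sum_{k=1}^{N}\int_{\mathbb{R}^d}\|\nabla\phi_k\|^2$ (understood as $+\infty$ if some $\phi_k$ is not weakly differentiable), and let $\mathcal{M}_u^+$ be the set of all $\Phi\in H^1(\mathbb{R}^d;\mathbb{R}^N)$ such that $\langle\phi_i,\phi_j\rangle_{L^2}=0$ for $i\ne j$, $\|\phi_i\|_{L^2}=1$ for $1\le i\le N-1$, $2\sum_{i=1}^N\phi_i^2=u^2$ a.e., and $\phi_N\ge 0$ a.e. For $\Theta=(\theta_1,\dots,\theta_{N-1})\in L^1_{loc}(\mathbb{R}^d;\mathbb{R}^{N-1})$ put $$u_k=\frac{|u|}{\sqrt2}\prod_{i=1}^{k-1}\cos\theta_i\quad(1\le k\le N),\qquad \varphi_k^{\Theta,u}=u_k\sin\theta_k\quad(1\le k\le N-1),\qquad \varphi_N^{\Theta,u}=u_N,$$ and $\tilde L(\Theta)=L(\varphi_1^{\Theta,u},\dots,\varphi_N^{\Theta,u})$.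 Let $\mathcal{S}_u^+$ be the set of all $\Theta\in H^1_{loc}(\mathbb{R}^d;\mathbb{R}^{N-1})$ with $u_k\nabla\theta_k\in L^2(\mathbb{R}^d;\mathbb{R}^d)$ and $|\theta_k|\le\pi/2$ a.e. for $1\le k\le N-1$. For $\delta>0$ let $\mathcal{A}_u^\delta$ be the set of all $\Theta\in L^1_{loc}(\mathbb{R}^d;\mathbb{R}^{N-1})$ with $|\langle\varphi_i^{\Theta,u},\varphi_j^{\Theta,u}\rangle_{L^2}|\le\delta$ for $1\le i<j\le N$ and $\big|\|\varphi_i^{\Theta,u}\|_{L^2}-1\big|\le\delta$ for $1\le i\le N-1$. Then the minimum $T^+(u)=\min_{\Phi\in\mathcal{M}_u^+}L(\Phi)$ exists and is finite, and $$T^+(u)=\lim_{\delta\downarrow0}\ \inf_{\Theta\in\mathcal{S}_u^+\cap\mathcal{A}_u^\delta}\tilde L(\Theta),$$ where the infimum of the empty set is $+\infty$. -/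

import Mathlib

open MeasureTheory Filter Topology
open scoped ENNReal ContDiff

namespace AngleField

/-- The space `ℝ^d` with its Euclidean norm and Lebesgue measure. -/
abbrev Space (d : ℕ) := EuclideanSpace ℝ (Fin d)

/-- `g` is the weak (distributional) gradient of `f` on `ℝ^d`: both are locally integrable, and
`∫ f ∂_v ψ = - ∫ ψ ⟪g, v⟫` for every test function `ψ ∈ C_c^∞(ℝ^d)` and every direction `v`. -/
def HasWeakGradient {d : ℕ} (f : Space d → ℝ) (g : Space d → Space d) : Prop :=
  LocallyIntegrable f ∧ LocallyIntegrable g ∧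
    ∀ ψ : Space d → ℝ, ContDiff ℝ ∞ ψ → HasCompactSupport ψ → ∀ v : Space d,
      ∫ x, f x * fderiv ℝ ψ x v = - ∫ x, ψ x * inner ℝ (g x) v

/-- The Sobolev space `H¹(ℝ^d)`: `f` and its weak gradient are square integrable. -/
def MemH1 {d : ℕ} (f : Space d → ℝ) : Prop :=
  MemLp f 2 ∧ ∃ g, HasWeakGradient f g ∧ MemLp g 2

/-- `f ∈ L²_loc(ℝ^d)`: square integrable on every compact set. -/
def MemL2Loc {d : ℕ} {F : Type*} [NormedAddCommGroup F] (f : Space d → F) : Prop :=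
  ∀ K : Set (Space d), IsCompact K → MemLp f 2 (volume.restrict K)

/-- The Dirichlet energy `∫ ‖∇f‖²` as an element of `[0, ∞]`. A weak gradient is unique up to null
sets, so the infimum runs over a single value (see `dirichletEnergy_eq`); it is `∞` if `f` is not
weakly differentiable. -/
noncomputable def dirichletEnergy {d : ℕ} (f : Space d → ℝ) : ℝ≥0∞ :=
  ⨅ (g : Space d → Space d) (_ : HasWeakGradient f g), ∫⁻ x, ‖g x‖ₑ ^ 2

/-- Weak gradients are unique up to null sets. -/
theorem HasWeakGradient.ae_eq {d : ℕ} {f : Space d → ℝ} {g h : Space d → Space d}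
    (hg : HasWeakGradient f g) (hh : HasWeakGradient f h) : g =ᵐ[volume] h := by
  have key : ∀ i : Fin d, ∀ᵐ x, g x i = h x i := by
    intro i
    let v : Space d := EuclideanSpace.single i 1
    have loc : ∀ k : Space d → Space d, LocallyIntegrable k →
        LocallyIntegrable (fun x => k x i) := by
      intro k hk x
      obtain ⟨s, hs, hi⟩ := hk x
      exact ⟨s, hs, (EuclideanSpace.proj (𝕜 := ℝ) i).integrable_comp hi⟩
    have hw := ae_eq_of_integral_contDiff_smul_eq (loc g hg.2.1) (loc h hh.2.1) (by
      intro ψ hψ hc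
      have e := (hg.2.2 ψ hψ hc v).symm.trans (hh.2.2 ψ hψ hc v)
      simpa [v, EuclideanSpace.inner_single_right] using e)
    exact hw
  filter_upwards [ae_all_iff.2 key] with x hx
  ext i
  exact hx i

theorem dirichletEnergy_eq {d : ℕ} {f : Space d → ℝ} {g : Space d → Space d}
    (hg : HasWeakGradient f g) : dirichletEnergy f = ∫⁻ x, ‖g x‖ₑ ^ 2 := by
  apply le_antisymm
  · exact iInf₂_le g hg
  · refine le_iInf₂ fun h hh => le_of_eq (lintegral_congr_ae ?_)
    filter_upwards [hg.ae_eq hh] with x hx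
    rw [hx]

/-- The inner product of `L²(ℝ^d)`. -/
noncomputable def l2Inner {d : ℕ} (f g : Space d → ℝ) : ℝ := ∫ x, f x * g x

/-- The number of orbitals `N_u = ⌈∫ u²/2⌉`. -/
noncomputable def numOrbitals {d : ℕ} (u : Space d → ℝ) : ℕ := ⌈∫ x, u x ^ 2 / 2⌉₊

/-- The kinetic energy `L(φ₁, …, φ_N) = ∑ₖ ∫ ‖∇φₖ‖²`. -/
noncomputable def kineticEnergy {d N : ℕ} (Φ : Fin N → Space d → ℝ) : ℝ≥0∞ :=
  ∑ k, dirichletEnergy (Φ k)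

/-- The set `M_u` of almost-orthonormal orbitals `(φ₁, …, φ_{N_u})`; the index `k : Fin N_u` stands
for the orbital number `k + 1`, so that `k + 1 < N_u` singles out all orbitals but the last. -/
def orbitalSet {d : ℕ} (u : Space d → ℝ) : Set (Fin (numOrbitals u) → Space d → ℝ) :=
  {Φ | (∀ k, MemH1 (Φ k)) ∧
    (∀ i j, i ≠ j → l2Inner (Φ i) (Φ j) = 0) ∧
    (∀ k : Fin (numOrbitals u), (k : ℕ) + 1 < numOrbitals u → lpNorm (Φ k) 2 volume = 1) ∧
    ∀ᵐ x, 2 * ∑ k, Φ k x ^ 2 = u x ^ 2}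

/-- The set `M_u⁺`: the last orbital is moreover nonnegative. -/
def orbitalSetPlus {d : ℕ} (u : Space d → ℝ) : Set (Fin (numOrbitals u) → Space d → ℝ) :=
  {Φ | Φ ∈ orbitalSet u ∧
    ∀ k : Fin (numOrbitals u), (k : ℕ) + 1 = numOrbitals u → ∀ᵐ x, 0 ≤ Φ k x}

/-- `T⁺(u)`, the infimum of the kinetic energy over `M_u⁺`. -/
noncomputable def TPlus {d : ℕ} (u : Space d → ℝ) : ℝ≥0∞ :=
  ⨅ Φ ∈ orbitalSetPlus u, kineticEnergy Φ

/-- `(|u| / √2) ∏_{i < k} cos θᵢ`, where angle fields and `k` are numbered from `0`. -/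
noncomputable def amplitude {d M : ℕ} (u : Space d → ℝ) (Θ : Fin M → Space d → ℝ) (k : ℕ)
    (x : Space d) : ℝ :=
  |u x| / √2 * ∏ i ∈ Finset.univ.filter (fun i : Fin M => (i : ℕ) < k), Real.cos (Θ i x)

/-- The orbitals `φₖ^{Θ,u}` built from `N - 1` angle fields: `amplitude k * sin θₖ` for all `k` but
the last, and the full product of cosines times `|u| / √2` for the last. -/
noncomputable def angleOrbital {d N : ℕ} (u : Space d → ℝ) (Θ : Fin (N - 1) → Space d → ℝ)
    (k : Fin N) (x : Space d) : ℝ :=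
  if h : (k : ℕ) < N - 1 then amplitude u Θ k x * Real.sin (Θ ⟨k, h⟩ x) else amplitude u Θ k x

/-- The angle-field energy `L̃(Θ) = L(Φ^{Θ,u})`. -/
noncomputable def angleEnergy {d : ℕ} (u : Space d → ℝ)
    (Θ : Fin (numOrbitals u - 1) → Space d → ℝ) : ℝ≥0∞ :=
  kineticEnergy (angleOrbital (N := numOrbitals u) u Θ)

/-- The set `S_u` of angle fields `θₖ ∈ H¹_loc(ℝ^d)` with `uₖ ∇θₖ ∈ L²(ℝ^d)`. -/
def angleSet {d : ℕ} (u : Space d → ℝ) : Set (Fin (numOrbitals u - 1) → Space d → ℝ) :=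
  {Θ | ∀ k, MemL2Loc (Θ k) ∧ ∃ g, HasWeakGradient (Θ k) g ∧ MemL2Loc g ∧
    MemLp (fun x => amplitude u Θ k x • g x) 2}

/-- The set `S_u⁺`: moreover `|θₖ| ≤ π/2`. -/
def angleSetPlus {d : ℕ} (u : Space d → ℝ) : Set (Fin (numOrbitals u - 1) → Space d → ℝ) :=
  {Θ | Θ ∈ angleSet u ∧ ∀ k, ∀ᵐ x, |Θ k x| ≤ Real.pi / 2}

/-- The set `A_u^δ` of locally integrable angle fields with `δ`-almost orthonormal orbitals. -/
def almostOrthonormal {d : ℕ} (u : Space d → ℝ) (δ : ℝ) :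
    Set (Fin (numOrbitals u - 1) → Space d → ℝ) :=
  {Θ | (∀ k, LocallyIntegrable (Θ k)) ∧
    (∀ i j : Fin (numOrbitals u), i < j →
      |l2Inner (angleOrbital u Θ i) (angleOrbital u Θ j)| ≤ δ) ∧
    ∀ k : Fin (numOrbitals u), (k : ℕ) + 1 < numOrbitals u →
      |lpNorm (angleOrbital u Θ k) 2 volume - 1| ≤ δ}

end AngleField

/-! Write `p = (φ₁, …, φ_N)` for the vector of orbitals, so that `|p| = |u| / √2`. Sobolev
regularity is handled throughout by difference quotients in `L²`: for a fixed step they are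
continuous in `L²`, and their limit as the step tends to `0` is the Dirichlet energy. A pointwise
Lipschitz estimate therefore becomes an energy estimate without a chain rule.

Lower bound and minimizer. Orbitals are dominated by `|u|`, so a family sequence of bounded energy
cannot lose mass at infinity and converges strongly in `L²` along a subsequence
(`exists_limit_family`). All constraints survive, even if orthonormality holds only asymptotically,
and the energy is lower semicontinuous (`exists_mem_orbitalSetPlus_of_seq`). Minimizing sequences
give the minimizer, and almost orthonormal angle fields with `δ → 0` give `TPlus_le_of_angle`.

Nonemptiness (`orbitalSetPlus_nonempty`). The mass of `u² / 2` to the left of a moving hyperplane is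
a Lipschitz coordinate `F` that flattens this measure to Lebesgue measure on `[0, m]`, with `m > N -
1`. There is room for `N - 1` disjoint intervals of length `ℓ > 1`; copies of one odd profile,
composed with `F`, serve as angles. Disjointness and oddness give orthogonality.

Upper bound (`iInf_angleEnergy_le`). Spherical angles of `p` are singular where the trailing
coordinates vanish. Keep the length `|p|`, but replace the direction `P` by that of `τ(|p|) P + e`,
where `e` is the last basis vector. Since the last orbital is nonnegative, the last coordinate is
now at least `1` and the angles are Lipschitz in `p`. The cutoff `τ` is `0` near the origin and
`κ⁻¹` elsewhere, rising so slowly (logarithmically) that the tilted map is `(1 + κ)`-Lipschitz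
(`norm_tiltMap_sub_le`). Hence the energy grows by at most `(1 + κ)²`, and the tilted orbitals tend
to the given ones as `κ → 0`. -/

namespace AngleField

/-! ### Translations and weak derivatives in `L²`. -/

/-- The Hilbert space `L²(ℝ^d)`. -/
noncomputable abbrev L2 (d : ℕ) := Lp ℝ 2 (volume : Measure (Space d))

instance {d : ℕ} : TopologicalSpace.SeparableSpace (L2 d) :=
  have : Fact ((2 : ℝ≥0∞) ≠ ⊤) := ⟨by simp⟩
  inferInstance

/-- Translation `f ↦ f (· + h)` on `L²(ℝ^d)`. -/
noncomputable def shift {d : ℕ} (h : Space d) : L2 d →ₗᵢ[ℝ] L2 d :=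
  Lp.compMeasurePreservingₗᵢ ℝ (fun x => x + h) (measurePreserving_add_right volume h)

theorem coeFn_shift {d : ℕ} (h : Space d) (f : L2 d) :
    shift h f =ᵐ[volume] fun x => f (x + h) :=
  Lp.coeFn_compMeasurePreserving f (measurePreserving_add_right volume h)

theorem continuous_shift {d : ℕ} (f : L2 d) : Continuous fun h : Space d => shift h f := by
  have hc : Continuous fun h : Space d => (⟨fun x => x + h, by fun_prop⟩ : C(Space d, Space d)) :=
    ContinuousMap.continuous_of_continuous_uncurry _ (by
      show Continuous fun p : Space d × Space d => p.2 + p.1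
      fun_prop)
  exact Continuous.compMeasurePreservingLp (continuous_const (y := f)) hc
    (fun h => measurePreserving_add_right volume h) (by simp)

theorem shift_zero {d : ℕ} (f : L2 d) : shift 0 f = f := by
  apply Lp.ext
  filter_upwards [coeFn_shift 0 f] with x hx
  simpa using hx

/-- Test functions are dense. This reduces norm estimates for translates to scalar functions of the
step, to which the mean value inequality applies. -/
theorem norm_le_of_inner_test_le {d : ℕ} (w : L2 d) {K : ℝ} (hK : 0 ≤ K)
    (h : ∀ ψ : L2 d, (∃ g : Space d → ℝ, ψ =ᵐ[volume] g ∧ HasCompactSupport g ∧ ContDiff ℝ ∞ g) →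
      inner ℝ w ψ ≤ K * ‖ψ‖) : ‖w‖ ≤ K := by
  have hall : ∀ y : L2 d, inner ℝ w y ≤ K * ‖y‖ := by
    have hcl : IsClosed {y : L2 d | inner ℝ w y ≤ K * ‖y‖} :=
      isClosed_le (by fun_prop) (by fun_prop)
    intro y
    have := (Lp.dense_hasCompactSupport_contDiff (F := ℝ) (μ := (volume : Measure (Space d)))
      (p := 2) (by simp)).closure_eq
    exact closure_minimal (fun ψ hψ => h ψ hψ) hcl (this ▸ Set.mem_univ y)
  have h1 := hall w
  rw [real_inner_self_eq_norm_mul_norm] at h1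
  rcases eq_or_lt_of_le (norm_nonneg w) with h0 | h0
  · rwa [← h0]
  · exact le_of_mul_le_mul_right h1 h0

/-- The pairing is the convolution of `f` with the reflection of `ψ`, evaluated at `s • v`, so the
derivative falls on the smooth factor. -/
theorem hasDerivAt_inner_shift {d : ℕ} (v : Space d) (f : L2 d) {ψ : Space d → ℝ}
    (hψ : ContDiff ℝ ∞ ψ) (hc : HasCompactSupport ψ) (s : ℝ) :
    HasDerivAt (fun s : ℝ => ∫ x, f (x + s • v) * ψ x)
      (-∫ x, f x * fderiv ℝ ψ (x - s • v) v) s := by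
  have hf : LocallyIntegrable (f : Space d → ℝ) :=
    (Lp.memLp f).locallyIntegrable (by norm_num)
  set χ : Space d → ℝ := fun x => ψ (-x) with hχ
  have hχc : HasCompactSupport χ := hc.comp_homeomorph (Homeomorph.neg _)
  have hχd : ContDiff ℝ ∞ χ := hψ.comp contDiff_neg
  have hd := hχc.hasFDerivAt_convolution_right (ContinuousLinearMap.mul ℝ ℝ) hf
    (hχd.of_le (by simp)) (s • v)
  have hline : HasDerivAt (fun s : ℝ => s • v) v s := by
    simpa using (hasDerivAt_id s).smul_const v
  have h2 := hd.comp_hasDerivAt s hline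
  rw [convolution_precompR_apply _ hf (hχc.fderiv ℝ)
    (hχd.continuous_fderiv (by simp))] at h2
  refine (h2.congr_deriv ?_).congr_of_eventuallyEq (Eventually.of_forall fun r => ?_)
  · rw [convolution_def, ← integral_neg]
    refine integral_congr_ae (Eventually.of_forall fun x => ?_)
    simp only [ContinuousLinearMap.mul_apply', hχ]
    have hψx : DifferentiableAt ℝ ψ (-(s • v - x)) := hψ.differentiable (by simp) _
    have hn : HasFDerivAt (fun y : Space d => -y) (-ContinuousLinearMap.id ℝ (Space d))
      (s • v - x) := (hasFDerivAt_id _).neg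
    have e : fderiv ℝ (fun x => ψ (-x)) (s • v - x)
        = (fderiv ℝ ψ (-(s • v - x))).comp (-ContinuousLinearMap.id ℝ (Space d)) :=
      (hψx.hasFDerivAt.comp (s • v - x) hn).fderiv
    rw [e]
    simp
  · simp only [Function.comp, convolution_def, ContinuousLinearMap.mul_apply', hχ]
    rw [← integral_sub_right_eq_self _ (r • v)]
    simp

/-- `g` is the weak derivative of `f` in direction `v`, both in `L²`. -/
def IsWeakDeriv {d : ℕ} (v : Space d) (f g : L2 d) : Prop :=
  ∀ ψ : Space d → ℝ, ContDiff ℝ ∞ ψ → HasCompactSupport ψ →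
    ∫ x, f x * fderiv ℝ ψ x v = - ∫ x, ψ x * g x

theorem inner_eq_of_ae_eq {d : ℕ} (f ψ : L2 d) {F g : Space d → ℝ} (hF : f =ᵐ[volume] F)
    (hg : ψ =ᵐ[volume] g) :
    inner ℝ f ψ = ∫ x, F x * g x := by
  rw [L2.inner_def]
  refine integral_congr_ae ?_
  filter_upwards [hF, hg] with x h1 h2
  simp [h1, h2, mul_comm]

theorem IsWeakDeriv.hasDerivAt {d : ℕ} {v : Space d} {f g : L2 d} (h : IsWeakDeriv v f g)
    (ψ : L2 d) (hψ : ∃ g : Space d → ℝ, ψ =ᵐ[volume] g ∧ HasCompactSupport g ∧ ContDiff ℝ ∞ g)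
    (s : ℝ) :
    HasDerivAt (fun s : ℝ => inner ℝ (shift (s • v) f) ψ) (inner ℝ (shift (s • v) g) ψ) s := by
  obtain ⟨p, hp, hc, hd⟩ := hψ
  have h1 := hasDerivAt_inner_shift v f hd hc s
  have hf : ∀ s : ℝ, inner ℝ (shift (s • v) f) ψ = ∫ x, f (x + s • v) * p x := fun s =>
    inner_eq_of_ae_eq _ _ (coeFn_shift _ f) hp
  have hg : inner ℝ (shift (s • v) g) ψ = ∫ x, g (x + s • v) * p x :=
    inner_eq_of_ae_eq _ _ (coeFn_shift _ g) hp
  simp only [hf, hg]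
  refine h1.congr_deriv ?_
  have hp' : ContDiff ℝ ∞ fun x => p (x - s • v) := hd.comp (by fun_prop)
  have hc' : HasCompactSupport fun x => p (x - s • v) :=
    hc.comp_homeomorph (Homeomorph.subRight (s • v))
  have := h _ hp' hc'
  simp only [fderiv_comp_sub] at this
  rw [this, neg_neg, ← integral_add_right_eq_self _ (s • v)]
  simp [mul_comm]

/-- Mean value inequality for the pairing with a test function, minus its linear part `s * ⟪w, ψ⟫`.
The choice `w = 0` gives the Lipschitz bound for translations, and `w = g` the strong convergence of
difference quotients. -/
theorem IsWeakDeriv.norm_shift_sub_sub_le {d : ℕ} {v : Space d} {f g : L2 d}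
    (h : IsWeakDeriv v f g) (w : L2 d) {c s : ℝ}
    (hw : ∀ r : ℝ, |r| ≤ |s| → ‖shift (r • v) g - w‖ ≤ c) :
    ‖shift (s • v) f - f - s • w‖ ≤ c * |s| := by
  refine norm_le_of_inner_test_le _
    (mul_nonneg ((norm_nonneg _).trans (hw 0 (by simp))) (abs_nonneg s)) fun ψ hψ => ?_
  have hder : ∀ r : ℝ, HasDerivAt (fun s : ℝ => inner ℝ (shift (s • v) f) ψ - s * inner ℝ w ψ)
      (inner ℝ (shift (r • v) g - w) ψ) r := fun r => by
    have := (h.hasDerivAt ψ hψ r).sub ((hasDerivAt_id r).mul_const (inner ℝ w ψ))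
    rw [inner_sub_left]
    exact this.congr_deriv (by simp)
  have hmv := (convex_Icc (-|s|) |s|).norm_image_sub_le_of_norm_hasDerivWithin_le
    (C := c * ‖ψ‖) (fun r _ => (hder r).hasDerivWithinAt) (fun r hr => by
      refine (norm_inner_le_norm _ _).trans ?_
      gcongr
      exact hw r (abs_le.2 hr)) (x := 0) (y := s) (by simp) (abs_le.1 le_rfl)
  have : inner ℝ (shift (s • v) f - f - s • w) ψ
      = inner ℝ (shift (s • v) f) ψ - s * inner ℝ w ψ
        - (inner ℝ (shift ((0 : ℝ) • v) f) ψ - 0 * inner ℝ w ψ) := by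
    simp [inner_sub_left, inner_smul_left, shift_zero]
    ring
  rw [this]
  refine (le_abs_self _).trans (hmv.trans (le_of_eq ?_))
  simp
  ring

theorem IsWeakDeriv.norm_shift_sub_le {d : ℕ} {v : Space d} {f g : L2 d}
    (h : IsWeakDeriv v f g) (s : ℝ) : ‖shift (s • v) f - f‖ ≤ ‖g‖ * |s| := by
  simpa using h.norm_shift_sub_sub_le 0 (c := ‖g‖) (s := s) (by simp)

theorem IsWeakDeriv.tendsto {d : ℕ} {v : Space d} {f g : L2 d} (h : IsWeakDeriv v f g) :
    Tendsto (fun s : ℝ => s⁻¹ • (shift (s • v) f - f)) (𝓝[≠] 0) (𝓝 g) := by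
  rw [Metric.tendsto_nhdsWithin_nhds]
  intro ε hε
  have hc : Continuous fun r : ℝ => shift (r • v) g := (continuous_shift g).comp (by fun_prop)
  obtain ⟨δ, hδ, H⟩ := Metric.continuous_iff.1 hc 0 (ε / 2) (by positivity)
  refine ⟨δ, hδ, fun {s} hs hsd => ?_⟩
  have hs' : s ≠ 0 := hs
  have := h.norm_shift_sub_sub_le g (c := ε / 2) (s := s) fun r hr => by
    have := H r (by rw [Real.dist_eq, sub_zero] at *; exact hr.trans_lt hsd)
    rw [dist_eq_norm, zero_smul, shift_zero] at this
    exact this.le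
  have e : s⁻¹ • (shift (s • v) f - f) - g = s⁻¹ • (shift (s • v) f - f - s • g) := by
    rw [smul_sub _ _ (s • g), smul_smul, inv_mul_cancel₀ hs', one_smul]
  rw [dist_eq_norm, e, norm_smul, norm_inv, Real.norm_eq_abs]
  have hp : 0 < |s| := abs_pos.2 hs'
  calc |s|⁻¹ * _ ≤ |s|⁻¹ * (ε / 2 * |s|) := by gcongr
    _ = ε / 2 := by field_simp
    _ < ε := by linarith

/-- Banach–Alaoglu, sequential because the space is separable, transported to the space itself by
Riesz representation. -/
theorem exists_subseq_tendsto_inner {H : Type*} [NormedAddCommGroup H] [InnerProductSpace ℝ H]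
    [CompleteSpace H] [TopologicalSpace.SeparableSpace H] (x : ℕ → H) {C : ℝ}
    (hx : ∀ n, ‖x n‖ ≤ C) :
    ∃ (y : H) (φ : ℕ → ℕ), StrictMono φ ∧
      ∀ z, Tendsto (fun n => inner ℝ (x (φ n)) z) atTop (𝓝 (inner ℝ y z)) := by
  have hK := WeakDual.isSeqCompact_closedBall ℝ H 0 C
  let ξ : ℕ → WeakDual ℝ H := fun n => StrongDual.toWeakDual (InnerProductSpace.toDual ℝ H (x n))
  obtain ⟨a, ha, φ, hφ, hlim⟩ := hK (x := ξ) (fun n => by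
    simp [ξ, hx n])
  refine ⟨(InnerProductSpace.toDual ℝ H).symm (WeakDual.toStrongDual a), φ, hφ, fun z => ?_⟩
  have := ((WeakDual.eval_continuous z).tendsto a).comp hlim
  rw [InnerProductSpace.toDual_symm_apply]
  exact this

/-- A weak limit of difference quotients is the weak derivative, since moving the quotient onto a
test function gives the same limit. -/
theorem exists_isWeakDeriv {d : ℕ} (v : Space d) (f : L2 d) {C : ℝ} {s : ℕ → ℝ}
    (hs : Tendsto s atTop (𝓝 0)) (hs0 : ∀ n, s n ≠ 0)
    (hb : ∀ n, ‖shift (s n • v) f - f‖ ≤ C * |s n|) : ∃ g, IsWeakDeriv v f g := by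
  obtain ⟨g, φ, hφ, hlim⟩ := exists_subseq_tendsto_inner
    (fun n => (s n)⁻¹ • (shift (s n • v) f - f)) (C := C) (fun n => by
      rw [norm_smul, norm_inv, Real.norm_eq_abs, inv_mul_le_iff₀ (abs_pos.2 (hs0 n)), mul_comm]
      exact hb n)
  refine ⟨g, fun ψ hψ hc => ?_⟩
  have hm : MemLp ψ 2 (volume : Measure (Space d)) :=
    hψ.continuous.memLp_of_hasCompactSupport hc
  have h1 := hlim (hm.toLp ψ)
  have hd := hasDerivAt_inner_shift v f hψ hc 0
  rw [hasDerivAt_iff_tendsto_slope_zero] at hd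
  have hs' : Tendsto (fun n => s (φ n)) atTop (𝓝[≠] 0) :=
    tendsto_nhdsWithin_iff.2 ⟨hs.comp hφ.tendsto_atTop, Eventually.of_forall fun n => hs0 _⟩
  have h2 := hd.comp hs'
  have h3 := tendsto_nhds_unique h1 (h2.congr fun n => by
    simp only [Function.comp, zero_add, inner_smul_left, inner_sub_left]
    rw [inner_eq_of_ae_eq _ _ (coeFn_shift _ f) hm.coeFn_toLp,
      inner_eq_of_ae_eq _ _ (EventuallyEq.refl _ _) hm.coeFn_toLp]
    simp)
  rw [inner_eq_of_ae_eq _ _ (EventuallyEq.refl _ _) hm.coeFn_toLp] at h3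
  simp only [zero_smul, sub_zero] at h3
  simp only [mul_comm (ψ _)]
  linarith

/-! ### Difference quotients and the Dirichlet energy. -/

/-- The squared `L²` norms of the difference quotients of `f` with step `h`, summed over the
coordinate directions. -/
noncomputable def diffEnergy {d : ℕ} (h : ℝ) (f : Space d → ℝ) : ℝ≥0∞ :=
  ∑ i : Fin d, ∫⁻ x, ‖h⁻¹ * (f (x + h • EuclideanSpace.single i 1) - f x)‖ₑ ^ 2

theorem lintegral_enorm_sq_eq {d : ℕ} {F : Type*} [NormedAddCommGroup F] (f : Space d → F) :
    ∫⁻ x, ‖f x‖ₑ ^ 2 = eLpNorm f 2 volume ^ 2 := by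
  rw [eLpNorm_eq_lintegral_rpow_enorm_toReal (by simp) (by simp)]
  rw [← ENNReal.rpow_natCast, ← ENNReal.rpow_mul]
  simp

theorem memLp_two_iff_lintegral {d : ℕ} {F : Type*} [NormedAddCommGroup F] {f : Space d → F}
    (hf : AEStronglyMeasurable f) : MemLp f 2 ↔ ∫⁻ x, ‖f x‖ₑ ^ 2 ≠ ⊤ := by
  rw [lintegral_enorm_sq_eq]
  simp [MemLp, hf, lt_top_iff_ne_top]

theorem enorm_sq_eq_of_ae_eq {d : ℕ} (w : L2 d) {F : Space d → ℝ} (hF : w =ᵐ[volume] F) :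
    ‖w‖ₑ ^ 2 = ∫⁻ x, ‖F x‖ₑ ^ 2 := by
  rw [Lp.enorm_def, lintegral_enorm_sq_eq, eLpNorm_congr_ae hF]

theorem enorm_sq_eq_sum {d : ℕ} (x : Space d) : ‖x‖ₑ ^ 2 = ∑ i, ‖x i‖ₑ ^ 2 := by
  simp only [← ofReal_norm]
  rw [← ENNReal.ofReal_pow (norm_nonneg _), EuclideanSpace.norm_sq_eq,
    ENNReal.ofReal_sum_of_nonneg fun i _ => by positivity]
  simp only [ENNReal.ofReal_pow (norm_nonneg _)]

theorem diffQuot_toLp_ae_eq {d : ℕ} {f : Space d → ℝ} (hf : MemLp f 2 volume) (h : ℝ) (v : Space d) :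
    (h⁻¹ • (shift (h • v) (hf.toLp f) - hf.toLp f) : L2 d) =ᵐ[volume]
      fun x => h⁻¹ * (f (x + h • v) - f x) := by
  have h2 : ∀ᵐ x, hf.toLp f (x + h • v) = f (x + h • v) :=
    (measurePreserving_add_right volume (h • v)).quasiMeasurePreserving.ae hf.coeFn_toLp
  filter_upwards [Lp.coeFn_smul h⁻¹ (shift (h • v) (hf.toLp f) - hf.toLp f),
    Lp.coeFn_sub (shift (h • v) (hf.toLp f)) (hf.toLp f), coeFn_shift (h • v) (hf.toLp f),
    hf.coeFn_toLp, h2] with x h1 h2 h3 h4 h5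
  rw [h1, Pi.smul_apply, h2, Pi.sub_apply, h3, h5, h4, smul_eq_mul]

theorem diffEnergy_eq_sum_enorm {d : ℕ} {f : Space d → ℝ} (hf : MemLp f 2 volume) (h : ℝ) :
    diffEnergy h f = ∑ i : Fin d,
      ‖(h⁻¹ • (shift (h • EuclideanSpace.single i (1 : ℝ)) (hf.toLp f) - hf.toLp f) : L2 d)‖ₑ ^ 2 :=
  Finset.sum_congr rfl fun _ _ => (enorm_sq_eq_of_ae_eq _ (diffQuot_toLp_ae_eq hf h _)).symm

theorem memLp_coord {d : ℕ} {g : Space d → Space d} (hg : MemLp g 2) (i : Fin d) :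
    MemLp (fun x => g x i) 2 :=
  (EuclideanSpace.proj (𝕜 := ℝ) i).comp_memLp' hg

theorem HasWeakGradient.isWeakDeriv {d : ℕ} {f : Space d → ℝ} {g : Space d → Space d}
    (h : HasWeakGradient f g) (hf : MemLp f 2) (hg : MemLp g 2) (i : Fin d) :
    IsWeakDeriv (EuclideanSpace.single i (1 : ℝ)) (hf.toLp f) ((memLp_coord hg i).toLp _) := by
  intro ψ hψ hc
  have := h.2.2 ψ hψ hc (EuclideanSpace.single i 1)
  simp only [EuclideanSpace.inner_single_right] at this
  calc _ = ∫ x, f x * fderiv ℝ ψ x (EuclideanSpace.single i 1) := by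
        refine integral_congr_ae ?_
        filter_upwards [hf.coeFn_toLp] with x hx
        rw [hx]
    _ = _ := this
    _ = _ := by
        congr 1
        refine integral_congr_ae ?_
        filter_upwards [(memLp_coord hg i).coeFn_toLp] with x hx
        rw [hx]
        simp

theorem diffEnergy_le_dirichletEnergy {d : ℕ} {f : Space d → ℝ} (hf : MemLp f 2) {h : ℝ}
    (hh : h ≠ 0) : diffEnergy h f ≤ dirichletEnergy f := by
  refine le_iInf₂ fun g hg => ?_
  by_cases ht : ∫⁻ x, ‖g x‖ₑ ^ 2 = ⊤
  · simp [ht]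
  have hg2 : MemLp g 2 := (memLp_two_iff_lintegral hg.2.1.aestronglyMeasurable).2 ht
  simp only [enorm_sq_eq_sum]
  rw [lintegral_finsetSum' _ fun i _ => (memLp_coord hg2 i).1.enorm.pow_const 2,
    diffEnergy_eq_sum_enorm hf]
  refine Finset.sum_le_sum fun i _ => ?_
  rw [← enorm_sq_eq_of_ae_eq _ (memLp_coord hg2 i).coeFn_toLp]
  gcongr
  rw [enorm_le_iff_norm_le, norm_smul, norm_inv, Real.norm_eq_abs,
    inv_mul_le_iff₀ (abs_pos.2 hh), mul_comm]
  exact (hg.isWeakDeriv hf hg2 i).norm_shift_sub_le h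

theorem HasWeakGradient.tendsto_diffEnergy {d : ℕ} {f : Space d → ℝ} {g : Space d → Space d}
    (h : HasWeakGradient f g) (hf : MemLp f 2) (hg : MemLp g 2) :
    Tendsto (fun s => diffEnergy s f) (𝓝[≠] 0) (𝓝 (dirichletEnergy f)) := by
  rw [dirichletEnergy_eq h]
  simp only [enorm_sq_eq_sum, diffEnergy_eq_sum_enorm hf]
  rw [lintegral_finsetSum' _ fun i _ => (memLp_coord hg i).1.enorm.pow_const 2]
  refine tendsto_finsetSum _ fun i _ => ?_
  rw [← enorm_sq_eq_of_ae_eq _ (memLp_coord hg i).coeFn_toLp]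
  exact ENNReal.Tendsto.pow ((continuous_enorm.tendsto _).comp (h.isWeakDeriv hf hg i).tendsto)

theorem hasWeakGradient_of_isWeakDeriv {d : ℕ} {f : Space d → ℝ} (hf : MemLp f 2)
    (G : Fin d → L2 d)
    (hG : ∀ i, IsWeakDeriv (EuclideanSpace.single i (1 : ℝ)) (hf.toLp f) (G i)) :
    MemLp (fun x => WithLp.toLp 2 fun i => G i x : Space d → Space d) 2 ∧
      HasWeakGradient f (fun x => WithLp.toLp 2 fun i => G i x) := by
  have hm : MemLp (fun x => WithLp.toLp 2 fun i => G i x : Space d → Space d) 2 := by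
    have : MemLp (fun x => ∑ i, G i x • EuclideanSpace.single i (1 : ℝ) : Space d → Space d) 2 :=
      memLp_finsetSum _ fun i _ => 
        (ContinuousLinearMap.toSpanSingleton ℝ (EuclideanSpace.single i (1 : ℝ))).comp_memLp'
          (Lp.memLp (G i))
    convert! this using 2 with x
    ext j
    simp [Finset.sum_apply, Pi.single_apply]
  refine ⟨hm, hf.locallyIntegrable (by norm_num), hm.locallyIntegrable (by norm_num),
    fun ψ hψ hc v => ?_⟩
  have hψ2 : MemLp ψ 2 (volume : Measure (Space d)) :=
    hψ.continuous.memLp_of_hasCompactSupport hc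
  have hd2 : ∀ w, MemLp (fun x => fderiv ℝ ψ x w) 2 (volume : Measure (Space d)) := fun w =>
    ((hψ.continuous_fderiv (by simp)).clm_apply continuous_const).memLp_of_hasCompactSupport
      (hc.fderiv_apply ℝ w)
  have key : ∀ i, ∫ x, f x * fderiv ℝ ψ x (EuclideanSpace.single i 1) = -∫ x, ψ x * G i x := by
    intro i
    rw [← hG i ψ hψ hc]
    refine integral_congr_ae ?_
    filter_upwards [hf.coeFn_toLp] with x hx
    rw [hx]
  have hv : ∀ x, f x * fderiv ℝ ψ x v
      = ∑ i, v i * (f x * fderiv ℝ ψ x (EuclideanSpace.single i 1)) := fun x => by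
    conv_lhs => rw [← (EuclideanSpace.basisFun (Fin d) ℝ).sum_repr v]
    simp only [map_sum, map_smul, EuclideanSpace.basisFun_repr, EuclideanSpace.basisFun_apply,
      smul_eq_mul, Finset.mul_sum]
    exact Finset.sum_congr rfl fun i _ => by ring
  have hw : ∀ x, ψ x * inner ℝ (WithLp.toLp 2 fun i => G i x : Space d) v
      = ∑ i, v i * (ψ x * G i x) := fun x => by
    simp only [PiLp.inner_apply, RCLike.inner_apply, conj_trivial, Finset.mul_sum]
    exact Finset.sum_congr rfl fun i _ => by ring
  simp only [hv, hw]
  rw [integral_finsetSum _ fun i _ => ((hd2 _).integrable_mul hf |>.congr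
      (Eventually.of_forall fun x => mul_comm _ _)).const_mul (v i),
    integral_finsetSum _ fun i _ => ((Lp.memLp (G i)).integrable_mul hψ2 |>.congr
      (Eventually.of_forall fun x => mul_comm _ _)).const_mul (v i), ← Finset.sum_neg_distrib]
  refine Finset.sum_congr rfl fun i _ => ?_
  rw [integral_const_mul, integral_const_mul, key i]
  ring

/-- Memberships in `H¹` below are obtained from this criterion, so that only pointwise estimates of
differences are ever needed. -/
theorem memH1_of_diffEnergy_le {d : ℕ} {f : Space d → ℝ} (hf : MemLp f 2) {C : ℝ≥0∞}
    (hC : C ≠ ⊤) (h : ∀ s : ℝ, s ≠ 0 → diffEnergy s f ≤ C) : MemH1 f := by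
  have hex : ∀ i, ∃ g, IsWeakDeriv (EuclideanSpace.single i (1 : ℝ)) (hf.toLp f) g := by
    intro i
    have hpos : ∀ n : ℕ, (1 / ((n : ℝ) + 1)) ≠ 0 := fun n => by positivity
    refine exists_isWeakDeriv _ _ (C := √C.toReal)
      (tendsto_one_div_add_atTop_nhds_zero_nat (𝕜 := ℝ)) hpos fun n => ?_
    have h1 := h _ (hpos n)
    rw [diffEnergy_eq_sum_enorm hf] at h1
    have h2 := (Finset.single_le_sum (fun _ _ => zero_le) (Finset.mem_univ i)).trans h1
    rw [← ENNReal.toReal_le_toReal (by simp) hC, ENNReal.toReal_pow, toReal_enorm] at h2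
    have h3 := Real.le_sqrt_of_sq_le h2
    rwa [norm_smul, norm_inv, Real.norm_eq_abs, inv_mul_le_iff₀ (abs_pos.2 (hpos n)), mul_comm]
      at h3
  choose G hG using hex
  obtain ⟨hm, hw⟩ := hasWeakGradient_of_isWeakDeriv hf G hG
  exact ⟨hf, _, hw, hm⟩

theorem MemH1.dirichletEnergy_ne_top {d : ℕ} {f : Space d → ℝ} (hf : MemH1 f) :
    dirichletEnergy f ≠ ⊤ := by
  obtain ⟨-, g, hw, hg⟩ := hf
  rw [dirichletEnergy_eq hw]
  exact (memLp_two_iff_lintegral hg.1).1 hg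

theorem sum_diffEnergy_le {d N : ℕ} {Φ : Fin N → Space d → ℝ} (hΦ : ∀ k, MemLp (Φ k) 2) {h : ℝ}
    (hh : h ≠ 0) : ∑ k, diffEnergy h (Φ k) ≤ kineticEnergy Φ :=
  Finset.sum_le_sum fun k _ => diffEnergy_le_dirichletEnergy (hΦ k) hh

/-- A family with bounded difference quotients lies in `H¹`, with the same energy bound. -/
theorem kineticEnergy_le_of_sum_diffEnergy_le {d N : ℕ} {Φ : Fin N → Space d → ℝ}
    (hΦ : ∀ k, MemLp (Φ k) 2) {C : ℝ≥0∞} (hC : C ≠ ⊤)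
    (h : ∀ s : ℝ, s ≠ 0 → ∑ k, diffEnergy s (Φ k) ≤ C) :
    (∀ k, MemH1 (Φ k)) ∧ kineticEnergy Φ ≤ C := by
  have h1 : ∀ k, MemH1 (Φ k) := fun k => memH1_of_diffEnergy_le (hΦ k) hC fun s hs =>
    (Finset.single_le_sum (f := fun k => diffEnergy s (Φ k)) (fun _ _ => zero_le)
      (Finset.mem_univ k)).trans (h s hs)
  refine ⟨h1, le_of_tendsto (x := 𝓝[≠] (0 : ℝ)) (tendsto_finsetSum _ fun k _ => ?_)
    (eventually_mem_nhdsWithin.mono h)⟩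
  obtain ⟨-, g, hw, hg⟩ := h1 k
  exact hw.tendsto_diffEnergy (hΦ k) hg

/-- An infimum over no weak gradient is `⊤`, so finite energy provides a weak gradient, and with it
local integrability. -/
theorem aestronglyMeasurable_of_kineticEnergy_ne_top {d N : ℕ} {Φ : Fin N → Space d → ℝ}
    (h : kineticEnergy Φ ≠ ⊤) (k : Fin N) : AEStronglyMeasurable (Φ k) := by
  have : dirichletEnergy (Φ k) ≠ ⊤ :=
    ne_top_of_le_ne_top h
      (Finset.single_le_sum (f := fun k => dirichletEnergy (Φ k)) (fun _ _ => zero_le)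
        (Finset.mem_univ k))
  by_contra hn
  refine this (iInf₂_eq_top.2 fun g hg => absurd hg.1.aestronglyMeasurable hn)

/-- If the weighted difference quotients of `f` are bounded in `L²`, the weighted gradient is in
`L²`. -/
theorem HasWeakGradient.memLp_smul {d : ℕ} {f : Space d → ℝ} {g : Space d → Space d}
    (h : HasWeakGradient f g) (hf : MemLp f 2) (hg : MemLp g 2) {w : Space d → ℝ}
    (hw : AEStronglyMeasurable w) {C : ℝ≥0∞} (hC : C ≠ ⊤)
    (hb : ∀ (s : ℝ) (i : Fin d), s ≠ 0 →
      ∫⁻ x, ‖w x * (s⁻¹ * (f (x + s • EuclideanSpace.single i 1) - f x))‖ₑ ^ 2 ≤ C) :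
    MemLp (fun x => w x • g x) 2 := by
  have hm : AEStronglyMeasurable (fun x => w x • g x) := hw.smul hg.1
  rw [memLp_two_iff_lintegral hm]
  simp only [enorm_sq_eq_sum]
  have hmi : ∀ i, AEStronglyMeasurable fun x => (w x • g x) i := fun i =>
    ((EuclideanSpace.proj (𝕜 := ℝ) i).continuous.comp_aestronglyMeasurable hm)
  rw [lintegral_finsetSum' _ fun i _ => (hmi i).enorm.pow_const 2]
  refine (ENNReal.sum_lt_top.2 fun i _ => lt_of_le_of_lt ?_ hC.lt_top).ne
  have hpos : ∀ n : ℕ, (1 / ((n : ℝ) + 1)) ≠ 0 := fun n => by positivity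
  have hs : Tendsto (fun n : ℕ => 1 / ((n : ℝ) + 1)) atTop (𝓝[≠] 0) :=
    tendsto_nhdsWithin_iff.2 ⟨tendsto_one_div_add_atTop_nhds_zero_nat,
      Eventually.of_forall hpos⟩
  have hlim := (h.isWeakDeriv hf hg i).tendsto.comp hs
  -- The weight may be unbounded, so `L²` convergence of the quotients does not survive
  -- multiplication by it; almost everywhere convergence along a subsequence does, and Fatou's lemma
  -- carries the bound over.
  obtain ⟨φ, -, hae⟩ := (tendstoInMeasure_of_tendsto_Lp hlim).exists_seq_tendsto_ae
  have hae2 := ae_all_iff.2 fun n : ℕ =>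
    diffQuot_toLp_ae_eq hf (1 / ((n : ℝ) + 1)) (EuclideanSpace.single i 1)
  have hqm : ∀ s : ℝ, AEStronglyMeasurable
      fun x => w x * (s⁻¹ * (f (x + s • EuclideanSpace.single i 1) - f x)) := fun s =>
    hw.mul (((hf.1.comp_measurePreserving (measurePreserving_add_right volume _)).sub
      hf.1).const_mul _)
  calc ∫⁻ x, ‖(w x • g x) i‖ₑ ^ 2
      ≤ ∫⁻ x, liminf (fun n : ℕ => ‖w x * ((1 / ((φ n : ℝ) + 1))⁻¹ *
        (f (x + (1 / ((φ n : ℝ) + 1)) • EuclideanSpace.single i 1) - f x))‖ₑ ^ 2) atTop := by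
        refine lintegral_mono_ae ?_
        filter_upwards [hae, hae2, (memLp_coord hg i).coeFn_toLp] with x h1 h2 h3
        rw [h3] at h1
        have h4 := (h1.congr fun n => h2 (φ n)).const_mul (w x)
        refine le_of_eq (Tendsto.liminf_eq ?_).symm
        exact ENNReal.Tendsto.pow ((continuous_enorm.tendsto _).comp h4)
    _ ≤ liminf (fun n : ℕ => ∫⁻ x, ‖w x * ((1 / ((φ n : ℝ) + 1))⁻¹ *
        (f (x + (1 / ((φ n : ℝ) + 1)) • EuclideanSpace.single i 1) - f x))‖ₑ ^ 2) atTop :=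
        lintegral_liminf_le' fun n => (hqm _).enorm.pow_const 2
    _ ≤ liminf (fun _ : ℕ => C) atTop :=
        liminf_le_liminf (Eventually.of_forall fun n => hb _ i (hpos (φ n)))
    _ = C := by simp

/-- Valid for every direction of translation, not only the coordinate ones: this is the uniform
equicontinuity required for compactness. -/
theorem lintegral_shift_sub_le {d : ℕ} {f : Space d → ℝ} (hf : MemLp f 2 volume) (v : Space d) :
    ‖shift v (hf.toLp f) - hf.toLp f‖ₑ ^ 2 ≤ ‖v‖ₑ ^ 2 * dirichletEnergy f := by
  -- The factor `‖v‖ₑ ^ 2` can enter an infimum over a possibly empty set only if it is nonzero,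
  -- because `0 * ⊤ = 0`.
  rcases eq_or_ne v 0 with rfl | hv
  · simp [shift_zero]
  unfold dirichletEnergy
  rw [ENNReal.mul_iInf_of_ne (by simpa using hv) (by simp)]
  refine le_iInf fun g => ?_
  rw [ENNReal.mul_iInf_of_ne (by simpa using hv) (by simp)]
  refine le_iInf fun hg => ?_
  by_cases ht : ∫⁻ x, ‖g x‖ₑ ^ 2 = ⊤
  · rw [ht, ENNReal.mul_top (by simpa using hv)]
    exact le_top
  have hg2 : MemLp g 2 volume := (memLp_two_iff_lintegral hg.2.1.aestronglyMeasurable).2 ht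
  have hv2 : MemLp (fun x => inner ℝ (g x) v) 2 volume := by
    simpa [real_inner_comm, Function.comp_def] using (innerSL ℝ v).comp_memLp' hg2
  have hw : IsWeakDeriv v (hf.toLp f) (hv2.toLp _) := by
    intro ψ hψ hc
    have := hg.2.2 ψ hψ hc v
    calc _ = ∫ x, f x * fderiv ℝ ψ x v := by
          refine integral_congr_ae ?_
          filter_upwards [hf.coeFn_toLp] with x hx
          rw [hx]
      _ = _ := this
      _ = _ := by
          congr 1
          refine integral_congr_ae ?_
          filter_upwards [hv2.coeFn_toLp] with x hx
          rw [hx]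
  have h1 := hw.norm_shift_sub_le 1
  simp only [one_smul, abs_one, mul_one] at h1
  calc _ ≤ ‖hv2.toLp _‖ₑ ^ 2 := by
        gcongr
        exact enorm_le_iff_norm_le.2 h1
    _ = ∫⁻ x, ‖inner ℝ (g x) v‖ₑ ^ 2 := enorm_sq_eq_of_ae_eq _ hv2.coeFn_toLp
    _ ≤ ∫⁻ x, ‖v‖ₑ ^ 2 * ‖g x‖ₑ ^ 2 := by
        refine lintegral_mono fun x => ?_
        rw [← mul_pow]
        gcongr
        rw [← enorm_norm v, ← enorm_norm (g x), ← enorm_mul, enorm_le_iff_norm_le]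
        simpa [mul_comm] using norm_inner_le_norm (𝕜 := ℝ) (g x) v
    _ = _ := lintegral_const_mul' _ _ (by simp)

/-! ### Strong compactness of dominated sequences. -/

/-- The average of `f` over the ball of radius `ε` around `x`. -/
noncomputable def ballAverage {d : ℕ} (ε : ℝ) (f : Space d → ℝ) (x : Space d) : ℝ :=
  ∫ y, f (x + y) ∂(ProbabilityTheory.cond volume (Metric.ball 0 ε))

theorem isProbabilityMeasure_cond_ball {d : ℕ} {ε : ℝ} (hε : 0 < ε) :
    IsProbabilityMeasure (ProbabilityTheory.cond (volume : Measure (Space d))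
      (Metric.ball 0 ε)) :=
  ProbabilityTheory.cond_isProbabilityMeasure_of_finite (Metric.measure_ball_pos _ _ hε).ne'
    measure_ball_lt_top.ne

theorem integrable_shift_cond_ball {d : ℕ} {ε : ℝ} (hε : 0 < ε) (f : L2 d) (x : Space d) :
    Integrable (fun y => f (x + y)) (ProbabilityTheory.cond volume (Metric.ball 0 ε)) := by
  have h1 : MemLp (fun y => f (x + y)) 2 volume :=
    (Lp.memLp f).comp_measurePreserving (measurePreserving_add_left volume x)
  have : IsFiniteMeasure ((volume : Measure (Space d)).restrict (Metric.ball 0 ε)) :=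
    ⟨by simpa using measure_ball_lt_top⟩
  have h2 := ((h1.restrict (Metric.ball 0 ε)).integrable (by norm_num))
  exact h2.smul_measure (by simpa using (Metric.measure_ball_pos _ _ hε).ne')

theorem stronglyMeasurable_ballAverage {d : ℕ} (ε : ℝ) (f : L2 d) :
    StronglyMeasurable (ballAverage ε f) := by
  have : StronglyMeasurable fun p : Space d × Space d => f (p.1 + p.2) :=
    (Lp.stronglyMeasurable f).comp_measurable (by fun_prop)
  exact this.integral_prod_right

theorem sq_lintegral_le {α : Type*} [MeasurableSpace α] (ν : Measure α) [IsProbabilityMeasure ν]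
    {f : α → ℝ} (hf : AEStronglyMeasurable f ν) :
    (∫⁻ y, ‖f y‖ₑ ∂ν) ^ 2 ≤ ∫⁻ y, ‖f y‖ₑ ^ 2 ∂ν := by
  have := eLpNorm_le_eLpNorm_of_exponent_le (p := 1) (q := 2) (by norm_num) hf
  rw [eLpNorm_one_eq_lintegral_enorm] at this
  calc _ ≤ eLpNorm f 2 ν ^ 2 := by gcongr
    _ = _ := by
      rw [eLpNorm_eq_lintegral_rpow_enorm_toReal (by simp) (by simp), ← ENNReal.rpow_natCast,
        ← ENNReal.rpow_mul]
      simp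

/-- Jensen's inequality for the average, then Tonelli: the error is an average of squared
translation errors. -/
theorem lintegral_ballAverage_sub_le {d : ℕ} {ε : ℝ} (hε : 0 < ε) (f : L2 d) {η : ℝ≥0∞}
    (h : ∀ y : Space d, ‖y‖ < ε → ‖shift y f - f‖ₑ ≤ η) :
    ∫⁻ x, ‖ballAverage ε f x - f x‖ₑ ^ 2 ≤ η ^ 2 := by
  have := isProbabilityMeasure_cond_ball (d := d) hε
  set ν := ProbabilityTheory.cond (volume : Measure (Space d)) (Metric.ball 0 ε)
  have hm : StronglyMeasurable fun p : Space d × Space d => f (p.1 + p.2) - f p.1 :=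
    ((Lp.stronglyMeasurable f).comp_measurable (by fun_prop)).sub
      ((Lp.stronglyMeasurable f).comp_measurable (by fun_prop))
  calc ∫⁻ x, ‖ballAverage ε f x - f x‖ₑ ^ 2
      ≤ ∫⁻ x, (∫⁻ y, ‖f (x + y) - f x‖ₑ ^ 2 ∂ν) := by
        refine lintegral_mono fun x => ?_
        have e : ballAverage ε f x - f x = ∫ y, (f (x + y) - f x) ∂ν := by
          rw [integral_sub (integrable_shift_cond_ball hε f x) (integrable_const _)]
          simp [ballAverage]
        rw [e]
        refine le_trans ?_ (sq_lintegral_le ν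
          (hm.comp_measurable measurable_prodMk_left).aestronglyMeasurable)
        gcongr
        exact enorm_integral_le_lintegral_enorm _
    _ = ∫⁻ y, (∫⁻ x, ‖f (x + y) - f x‖ₑ ^ 2) ∂ν :=
        lintegral_lintegral_swap ((hm.enorm.pow_const 2).aemeasurable)
    _ ≤ ∫⁻ _, η ^ 2 ∂ν := by
        refine lintegral_mono_ae ?_
        have : ∀ᵐ y ∂ν, y ∈ Metric.ball (0 : Space d) ε :=
          ProbabilityTheory.ae_cond_mem measurableSet_ball
        filter_upwards [this] with y hy
        have e : (shift y f - f : L2 d) =ᵐ[volume] fun x => f (x + y) - f x := by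
          filter_upwards [Lp.coeFn_sub (shift y f) f, coeFn_shift y f] with x h1 h2
          rw [h1, Pi.sub_apply, h2]
        rw [← enorm_sq_eq_of_ae_eq _ e]
        gcongr
        exact h y (by simpa using hy)
    _ = η ^ 2 := by simp

/-- Being a pairing with an indicator function, the average turns weak convergence into convergence
at every point. -/
theorem ballAverage_eq_inner {d : ℕ} (ε : ℝ) (f : L2 d) (x : Space d) :
    ballAverage ε f x = (volume (Metric.ball (0 : Space d) ε))⁻¹.toReal *
      inner ℝ f (indicatorConstLp 2 (measurableSet_ball (x := x) (ε := ε))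
        measure_ball_lt_top.ne (1 : ℝ)) := by
  rw [real_inner_comm, L2.inner_indicatorConstLp_one, ballAverage, ProbabilityTheory.cond,
    integral_smul_measure, smul_eq_mul]
  congr 1
  rw [← (measurePreserving_add_left volume x).setIntegral_preimage_emb
    (measurableEmbedding_addLeft x) f (Metric.ball x ε)]
  congr 2
  ext y
  simp

theorem abs_ballAverage_le {d : ℕ} {ε : ℝ} (hε : 0 < ε) {f w : L2 d}
    (h : ∀ᵐ x, |f x| ≤ w x) (x : Space d) : |ballAverage ε f x| ≤ ballAverage ε w x := by
  have hac : ProbabilityTheory.cond (volume : Measure (Space d)) (Metric.ball 0 ε) ≪ volume :=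
    ProbabilityTheory.cond_absolutelyContinuous
  rw [← Real.norm_eq_abs]
  refine norm_integral_le_of_norm_le (f := fun y => f (x + y))
    (integrable_shift_cond_ball hε w x) (hac.ae_le ?_)
  exact (measurePreserving_add_left volume x).quasiMeasurePreserving.ae h

/-- A weakly convergent, dominated and equicontinuous sequence in `L²` converges strongly. -/
theorem tendsto_of_weak_of_equicontinuous {d : ℕ} {f : ℕ → L2 d} {g w : L2 d}
    (hweak : ∀ z, Tendsto (fun n => inner ℝ (f n) z) atTop (𝓝 (inner ℝ g z)))
    (hdom : ∀ n, ∀ᵐ x, |f n x| ≤ w x)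
    (heq : ∀ η : ℝ, 0 < η → ∃ ε > 0, ∀ n, ∀ y : Space d, ‖y‖ < ε → ‖shift y (f n) - f n‖ ≤ η) :
    Tendsto f atTop (𝓝 g) := by
  have hcont : ∀ (g : L2 d) (η : ℝ), 0 < η →
      ∃ ε > 0, ∀ y : Space d, ‖y‖ < ε → ‖shift y g - g‖ ≤ η := by
    intro g η hη
    obtain ⟨ε, hε, H⟩ := Metric.continuous_iff.1 (continuous_shift g) 0 η hη
    refine ⟨ε, hε, fun y hy => ?_⟩
    have := H y (by simpa using hy)
    rw [dist_eq_norm, shift_zero] at this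
    exact this.le
  rw [Metric.tendsto_atTop]
  intro η hη
  obtain ⟨ε₁, hε₁, H₁⟩ := heq (η / 4) (by positivity)
  obtain ⟨ε₂, hε₂, H₂⟩ := hcont g (η / 4) (by positivity)
  -- For `w` any finite bound would do: it only serves to put the average of `w` in `L²`.
  obtain ⟨ε₃, hε₃, H₃⟩ := hcont w 1 (by positivity)
  set ε := min ε₁ (min ε₂ ε₃) with hεdef
  have hε : 0 < ε := by positivity
  have hav : ∀ (F : L2 d) (c : ℝ), (∀ y : Space d, ‖y‖ < ε → ‖shift y F - F‖ ≤ c) →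
      ∃ hm : MemLp (ballAverage ε F) 2 volume, 0 ≤ c → ‖hm.toLp _ - F‖ ≤ c := by
    intro F c hc
    have h0 : 0 ≤ c := (norm_nonneg _).trans (hc 0 (by simpa using hε))
    have h1 := lintegral_ballAverage_sub_le hε F (η := ENNReal.ofReal c) fun y hy => by
      rw [← ofReal_norm]
      exact ENNReal.ofReal_le_ofReal (hc y hy)
    have hm1 : MemLp (fun x => ballAverage ε F x - F x) 2 volume :=
      (memLp_two_iff_lintegral ((stronglyMeasurable_ballAverage ε F).sub
        (Lp.stronglyMeasurable F)).aestronglyMeasurable).2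
        (ne_top_of_le_ne_top (by simp) h1)
    have hm : MemLp (ballAverage ε F) 2 volume := by
      have := hm1.add (Lp.memLp F)
      convert! this using 1
      ext x
      simp
    refine ⟨hm, fun _ => ?_⟩
    have e : (hm.toLp _ - F : L2 d) =ᵐ[volume] fun x => ballAverage ε F x - F x := by
      filter_upwards [Lp.coeFn_sub (hm.toLp _) F, hm.coeFn_toLp] with x h1 h2
      rw [h1, Pi.sub_apply, h2]
    rw [← enorm_sq_eq_of_ae_eq _ e] at h1
    have h2 : ‖hm.toLp _ - F‖ₑ ≤ ENNReal.ofReal c := by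
      rwa [ENNReal.pow_le_pow_left_iff (by norm_num)] at h1
    rw [← ofReal_norm] at h2
    exact (ENNReal.ofReal_le_ofReal_iff h0).1 h2
  have hf := fun n => hav (f n) (η / 4) fun y hy => H₁ n y (hy.trans_le (min_le_left _ _))
  obtain ⟨hg, hg'⟩ := hav g (η / 4) fun y hy =>
    H₂ y (hy.trans_le ((min_le_right _ _).trans (min_le_left _ _)))
  obtain ⟨hw, -⟩ := hav w 1 fun y hy =>
    H₃ y (hy.trans_le ((min_le_right _ _).trans (min_le_right _ _)))
  choose hfm hf' using hf
  have hpt : ∀ x, Tendsto (fun n => ballAverage ε (f n) x) atTop (𝓝 (ballAverage ε g x)) := by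
    intro x
    simp only [ballAverage_eq_inner]
    exact (hweak _).const_mul _
  have hle : ∀ n x, |ballAverage ε (f n) x| ≤ ballAverage ε w x := fun n x =>
    abs_ballAverage_le hε (hdom n) x
  have hle' : ∀ x, |ballAverage ε g x| ≤ ballAverage ε w x := fun x =>
    le_of_tendsto (hpt x).abs (Eventually.of_forall fun n => hle n x)
  have hsm := stronglyMeasurable_ballAverage (d := d) ε
  -- The averages of `w` dominate on the whole space, so the averages converge strongly without any
  -- restriction to a bounded region.
  have hdct : Tendsto (fun n => ∫⁻ x, ‖ballAverage ε (f n) x - ballAverage ε g x‖ₑ ^ 2) atTop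
      (𝓝 0) := by
    have : Tendsto (fun n => ∫⁻ x, ‖ballAverage ε (f n) x - ballAverage ε g x‖ₑ ^ 2) atTop
        (𝓝 (∫⁻ x : Space d, 0)) := by
      refine tendsto_lintegral_of_dominated_convergence
        (fun x => ‖2 * ballAverage ε w x‖ₑ ^ 2)
        (fun n => ((hsm (f n)).sub (hsm g)).enorm.pow_const 2) (fun n => ?_) ?_ ?_
      · refine Eventually.of_forall fun x => ?_
        dsimp only
        gcongr
        rw [enorm_le_iff_norm_le, Real.norm_eq_abs, Real.norm_eq_abs]
        refine (abs_sub _ _).trans ?_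
        refine le_trans ?_ (le_abs_self _)
        linarith [hle n x, hle' x]
      · exact (memLp_two_iff_lintegral (hw.const_mul 2).1).1 (hw.const_mul 2)
      · refine Eventually.of_forall fun x => ?_
        have h1 := (hpt x).sub_const (ballAverage ε g x)
        have h2 := ENNReal.Tendsto.pow (n := 2) ((continuous_enorm.tendsto _).comp h1)
        simpa using h2
    simpa using this
  have hev := (ENNReal.tendsto_nhds_zero.1 hdct) (ENNReal.ofReal (η / 4) ^ 2) (by positivity)
  obtain ⟨n₀, hn₀⟩ := eventually_atTop.1 hev
  refine ⟨n₀, fun n hn => ?_⟩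
  have hmid : ‖(hfm n).toLp _ - hg.toLp _‖ ≤ η / 4 := by
    have h1 := hn₀ n hn
    have e : ((hfm n).toLp _ - hg.toLp _ : L2 d) =ᵐ[volume]
        fun x => ballAverage ε (f n) x - ballAverage ε g x := by
      filter_upwards [Lp.coeFn_sub ((hfm n).toLp _) (hg.toLp _), (hfm n).coeFn_toLp,
        hg.coeFn_toLp] with x h1 h2 h3
      rw [h1, Pi.sub_apply, h2, h3]
    rw [← enorm_sq_eq_of_ae_eq _ e, ENNReal.pow_le_pow_left_iff (by norm_num), ← ofReal_norm]
      at h1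
    exact (ENNReal.ofReal_le_ofReal_iff (by positivity)).1 h1
  have h1 := hf' n (by positivity)
  have h2 := hg' (by positivity)
  have e : f n - g = -((hfm n).toLp _ - f n) + ((hfm n).toLp _ - hg.toLp _)
      + (hg.toLp _ - g) := by abel
  rw [dist_eq_norm, e]
  refine (norm_add₃_le).trans_lt ?_
  rw [norm_neg]
  linarith

theorem exists_common_subseq {ι : Type*} [Finite ι] (P : ι → (ℕ → ℕ) → Prop)
    (hsub : ∀ i (φ ψ : ℕ → ℕ), StrictMono ψ → P i φ → P i (φ ∘ ψ))
    (hex : ∀ i (φ : ℕ → ℕ), StrictMono φ → ∃ ψ : ℕ → ℕ, StrictMono ψ ∧ P i (φ ∘ ψ)) :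
    ∃ φ : ℕ → ℕ, StrictMono φ ∧ ∀ i, P i φ := by
  classical
  cases nonempty_fintype ι
  suffices h : ∀ s : Finset ι, ∃ φ : ℕ → ℕ, StrictMono φ ∧ ∀ i ∈ s, P i φ by
    obtain ⟨φ, hφ, h⟩ := h Finset.univ
    exact ⟨φ, hφ, fun i => h i (Finset.mem_univ i)⟩
  intro s
  induction s using Finset.induction_on with
  | empty => exact ⟨id, strictMono_id, by simp⟩
  | insert i s _ ih =>
    obtain ⟨φ, hφ, h⟩ := ih
    obtain ⟨ψ, hψ, h'⟩ := hex i φ hφ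
    refine ⟨φ ∘ ψ, hφ.comp hψ, fun j hj => ?_⟩
    rcases Finset.mem_insert.1 hj with rfl | hj
    · exact h'
    · exact hsub j φ ψ hψ (h j hj)

/-- A dominated sequence with bounded Dirichlet energies has a subsequence that converges in `L²`
and almost everywhere. -/
theorem exists_subseq_tendsto {d : ℕ} {u : Space d → ℝ} (hu : MemLp u 2) {f : ℕ → Space d → ℝ}
    (hf : ∀ n, MemLp (f n) 2 volume) (hdom : ∀ n, ∀ᵐ x, |f n x| ≤ |u x|) {B : ℝ≥0∞} (hB : B ≠ ⊤)
    (hE : ∀ n, dirichletEnergy (f n) ≤ B) :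
    ∃ (g : L2 d) (φ : ℕ → ℕ), StrictMono φ ∧
      Tendsto (fun n => (hf (φ n)).toLp (f (φ n))) atTop (𝓝 g) ∧
      ∀ᵐ x, Tendsto (fun n => f (φ n) x) atTop (𝓝 (g x)) := by
  have huabs : MemLp (fun x => |u x|) 2 volume := hu.abs
  obtain ⟨g, φ, hφ, hweak⟩ := exists_subseq_tendsto_inner (fun n => (hf n).toLp (f n))
    (C := ‖huabs.toLp _‖) (fun n => by
      refine Lp.norm_le_norm_of_ae_le ?_
      filter_upwards [(hf n).coeFn_toLp, huabs.coeFn_toLp, hdom n] with x h1 h2 h3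
      rw [h1, h2]
      simpa using h3)
  have hstrong := tendsto_of_weak_of_equicontinuous (w := huabs.toLp _) hweak (fun n => by
      filter_upwards [(hf (φ n)).coeFn_toLp, huabs.coeFn_toLp, hdom (φ n)] with x h1 h2 h3
      rw [h1, h2]
      exact h3) (fun η hη => by
      refine ⟨η / (√B.toReal + 1), by positivity, fun n y hy => ?_⟩
      have h1 := (lintegral_shift_sub_le (hf (φ n)) y).trans
        (mul_le_mul_right (hE (φ n)) (‖y‖ₑ ^ 2))
      rw [← ENNReal.toReal_le_toReal (by simp) (ENNReal.mul_ne_top (by simp) hB),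
        ENNReal.toReal_mul, ENNReal.toReal_pow, ENNReal.toReal_pow, toReal_enorm, toReal_enorm]
        at h1
      have h2 := Real.le_sqrt_of_sq_le h1
      rw [Real.sqrt_mul (by positivity), Real.sqrt_sq (norm_nonneg _)] at h2
      rw [lt_div_iff₀ (by positivity)] at hy
      nlinarith [norm_nonneg y])
  obtain ⟨ψ, hψ, hae⟩ := (tendstoInMeasure_of_tendsto_Lp hstrong).exists_seq_tendsto_ae
  refine ⟨g, φ ∘ ψ, hφ.comp hψ, hstrong.comp hψ.tendsto_atTop, ?_⟩
  filter_upwards [hae, ae_all_iff.2 fun n => (hf n).coeFn_toLp] with x h1 h2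
  exact h1.congr fun n => h2 _

/-- Compactness: a dominated sequence of families with bounded kinetic energy has a subsequence
that converges in `L²` and almost everywhere, and the kinetic energy is lower semicontinuous. -/
theorem exists_limit_family {d N : ℕ} {u : Space d → ℝ} (hu : MemLp u 2)
    {Φ : ℕ → Fin N → Space d → ℝ} (hdom : ∀ n k, ∀ᵐ x, |Φ n k x| ≤ |u x|) {A : ℝ≥0∞} (hA : A ≠ ⊤)
    (hE : ∀ n : ℕ, kineticEnergy (Φ n) ≤ A + (n + 1 : ℝ≥0∞)⁻¹) :
    ∃ (Ψ : Fin N → Space d → ℝ) (φ : ℕ → ℕ), StrictMono φ ∧ (∀ k, MemH1 (Ψ k)) ∧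
      kineticEnergy Ψ ≤ A ∧
      (∀ k, Tendsto (fun n => eLpNorm (Φ (φ n) k - Ψ k) 2 volume) atTop (𝓝 0)) ∧
      ∀ᵐ x, ∀ k, Tendsto (fun n => Φ (φ n) k x) atTop (𝓝 (Ψ k x)) := by
  have hB : A + 1 ≠ ⊤ := by simpa using hA
  have hE1 : ∀ n, kineticEnergy (Φ n) ≤ A + 1 := fun n => (hE n).trans (by
    gcongr
    simp)
  have hΦ : ∀ n k, MemLp (Φ n k) 2 volume := fun n k =>
    hu.mono (aestronglyMeasurable_of_kineticEnergy_ne_top (ne_top_of_le_ne_top hB (hE1 n)) k)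
      (hdom n k)
  have hEk : ∀ n k, dirichletEnergy (Φ n k) ≤ A + 1 := fun n k =>
    (Finset.single_le_sum (f := fun k => dirichletEnergy (Φ n k)) (fun _ _ => zero_le)
      (Finset.mem_univ k)).trans (hE1 n)
  obtain ⟨φ, hφ, hP⟩ := exists_common_subseq (ι := Fin N)
    (fun k φ => ∃ g : L2 d, Tendsto (fun n => (hΦ (φ n) k).toLp (Φ (φ n) k)) atTop (𝓝 g) ∧
      ∀ᵐ x, Tendsto (fun n => Φ (φ n) k x) atTop (𝓝 (g x)))
    (fun k φ ψ hψ ⟨g, h1, h2⟩ => ⟨g, h1.comp hψ.tendsto_atTop, by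
      filter_upwards [h2] with x hx
      exact hx.comp hψ.tendsto_atTop⟩)
    (fun k φ hφ => by
      obtain ⟨g, ψ, hψ, h1, h2⟩ := exists_subseq_tendsto hu (fun n => hΦ (φ n) k)
        (fun n => hdom (φ n) k) hB fun n => hEk (φ n) k
      exact ⟨ψ, hψ, g, h1, h2⟩)
  choose g hg1 hg2 using hP
  -- Lower semicontinuity: at a fixed step the difference energy passes to the strong limit, and the
  -- step is sent to `0` only afterwards.
  have hdiff : ∀ s : ℝ, s ≠ 0 → ∑ k, diffEnergy s (g k) ≤ A := by
    intro s hs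
    have hlim : Tendsto (fun n => ∑ k, diffEnergy s (Φ (φ n) k)) atTop
        (𝓝 (∑ k, diffEnergy s (g k))) := by
      refine tendsto_finsetSum _ fun k _ => ?_
      rw [diffEnergy_eq_sum_enorm (Lp.memLp (g k))]
      simp only [diffEnergy_eq_sum_enorm (hΦ _ k), Lp.toLp_coeFn]
      refine tendsto_finsetSum _ fun i _ => ?_
      refine ENNReal.Tendsto.pow ((continuous_enorm.tendsto _).comp ?_)
      exact ((((shift _).continuous.tendsto _).comp (hg1 k)).sub (hg1 k)).const_smul _
    have hA' : Tendsto (fun n : ℕ => A + ((φ n : ℝ≥0∞) + 1)⁻¹) atTop (𝓝 (A + 0)) := by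
      refine tendsto_const_nhds.add ?_
      have h0 : Tendsto (fun n : ℕ => ((n : ℝ≥0∞) + 1)⁻¹) atTop (𝓝 0) := by
        have := (tendsto_add_atTop_iff_nat 1).2 ENNReal.tendsto_inv_nat_nhds_zero
        simpa using this
      exact h0.comp hφ.tendsto_atTop
    rw [add_zero] at hA'
    exact le_of_tendsto_of_tendsto' hlim hA' fun n =>
      (sum_diffEnergy_le (hΦ (φ n)) hs).trans (hE (φ n))
  obtain ⟨h1, h2⟩ := kineticEnergy_le_of_sum_diffEnergy_le (fun k => Lp.memLp (g k)) hA hdiff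
  refine ⟨fun k => g k, φ, hφ, h1, h2, fun k => ?_, ae_all_iff.2 hg2⟩
  have := Lp.tendsto_Lp_iff_tendsto_eLpNorm' (fun n => (hΦ (φ n) k).toLp (Φ (φ n) k)) (g k) |>.1
    (hg1 k)
  refine this.congr fun n => eLpNorm_congr_ae ?_
  filter_upwards [(hΦ (φ n) k).coeFn_toLp] with x hx
  simp [hx]

/-! ### Stability of the constraints and existence of a minimizer. -/

theorem l2Inner_eq_inner {d : ℕ} {f g : Space d → ℝ} (hf : MemLp f 2 volume)
    (hg : MemLp g 2 volume) : l2Inner f g = inner ℝ (hf.toLp f) (hg.toLp g) :=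
  (inner_eq_of_ae_eq _ _ hf.coeFn_toLp hg.coeFn_toLp).symm

theorem lpNorm_eq_norm_toLp {d : ℕ} {f : Space d → ℝ} (hf : MemLp f 2 volume) :
    lpNorm f 2 volume = ‖hf.toLp f‖ := by
  rw [Lp.norm_toLp, toReal_eLpNorm hf.1]

theorem lpNorm_sq_eq {d : ℕ} {f : Space d → ℝ} (hf : MemLp f 2 volume) :
    lpNorm f 2 volume ^ 2 = ∫ x, f x ^ 2 := by
  rw [lpNorm_eq_norm_toLp hf, ← real_inner_self_eq_norm_sq, ← l2Inner_eq_inner hf hf]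
  simp [l2Inner, sq]

theorem tendsto_toLp {d : ℕ} {f : ℕ → Space d → ℝ} {g : Space d → ℝ}
    (hf : ∀ n, MemLp (f n) 2 volume) (hg : MemLp g 2 volume)
    (h : Tendsto (fun n => eLpNorm (f n - g) 2 volume) atTop (𝓝 0)) :
    Tendsto (fun n => (hf n).toLp (f n)) atTop (𝓝 (hg.toLp g)) := by
  rw [Lp.tendsto_Lp_iff_tendsto_eLpNorm']
  refine h.congr fun n => eLpNorm_congr_ae ?_
  filter_upwards [(hf n).coeFn_toLp, hg.coeFn_toLp] with x h1 h2
  simp [h1, h2]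

theorem tendsto_l2Inner {d : ℕ} {f f' : ℕ → Space d → ℝ} {g g' : Space d → ℝ}
    (hf : ∀ n, MemLp (f n) 2 volume) (hg : MemLp g 2 volume)
    (hf' : ∀ n, MemLp (f' n) 2 volume) (hg' : MemLp g' 2 volume)
    (h : Tendsto (fun n => eLpNorm (f n - g) 2 volume) atTop (𝓝 0))
    (h' : Tendsto (fun n => eLpNorm (f' n - g') 2 volume) atTop (𝓝 0)) :
    Tendsto (fun n => l2Inner (f n) (f' n)) atTop (𝓝 (l2Inner g g')) := by
  rw [l2Inner_eq_inner hg hg']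
  simp only [l2Inner_eq_inner (hf _) (hf' _)]
  exact (tendsto_toLp hf hg h).inner (tendsto_toLp hf' hg' h')

theorem tendsto_lpNorm {d : ℕ} {f : ℕ → Space d → ℝ} {g : Space d → ℝ}
    (hf : ∀ n, MemLp (f n) 2 volume) (hg : MemLp g 2 volume)
    (h : Tendsto (fun n => eLpNorm (f n - g) 2 volume) atTop (𝓝 0)) :
    Tendsto (fun n => lpNorm (f n) 2 volume) atTop (𝓝 (lpNorm g 2 volume)) := by
  rw [lpNorm_eq_norm_toLp hg]
  simp only [lpNorm_eq_norm_toLp (hf _)]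
  exact (tendsto_toLp hf hg h).norm

theorem abs_le_of_sum_sq {N : ℕ} {a : Fin N → ℝ} {b : ℝ} (h : 2 * ∑ k, a k ^ 2 = b ^ 2)
    (k : Fin N) : |a k| ≤ |b| := by
  rw [← sq_le_sq]
  have := Finset.single_le_sum (f := fun k => a k ^ 2) (fun _ _ => sq_nonneg _)
    (Finset.mem_univ k)
  have h0 := sq_nonneg (a k)
  linarith

/-- Inner products and norms pass to the limit by strong convergence; the sum of squares and the
sign, by almost everywhere convergence. Orthonormality is asked only asymptotically, so that
minimizing sequences and almost orthonormal angle fields are both covered. -/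
theorem exists_mem_orbitalSetPlus_of_seq {d : ℕ} {u : Space d → ℝ} (hu : MemLp u 2)
    {Φ : ℕ → Fin (numOrbitals u) → Space d → ℝ}
    (hsum : ∀ n, ∀ᵐ x, 2 * ∑ k, Φ n k x ^ 2 = u x ^ 2)
    (hpos : ∀ n, ∀ k : Fin (numOrbitals u), (k : ℕ) + 1 = numOrbitals u → ∀ᵐ x, 0 ≤ Φ n k x)
    (horth : ∀ i j, i ≠ j → Tendsto (fun n => l2Inner (Φ n i) (Φ n j)) atTop (𝓝 0))
    (hnorm : ∀ k : Fin (numOrbitals u), (k : ℕ) + 1 < numOrbitals u →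
      Tendsto (fun n => lpNorm (Φ n k) 2 volume) atTop (𝓝 1))
    {A : ℝ≥0∞} (hA : A ≠ ⊤) (hE : ∀ n : ℕ, kineticEnergy (Φ n) ≤ A + (n + 1 : ℝ≥0∞)⁻¹) :
    ∃ Ψ ∈ orbitalSetPlus u, kineticEnergy Ψ ≤ A := by
  have hdom : ∀ n k, ∀ᵐ x, |Φ n k x| ≤ |u x| := fun n k => by
    filter_upwards [hsum n] with x hx
    exact abs_le_of_sum_sq hx k
  have hΦ : ∀ n k, MemLp (Φ n k) 2 volume := fun n k =>
    hu.mono (aestronglyMeasurable_of_kineticEnergy_ne_top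
      (ne_top_of_le_ne_top (by simpa using hA) (hE n)) k) (hdom n k)
  obtain ⟨Ψ, φ, hφ, hH1, hEΨ, hL2, hae⟩ := exists_limit_family hu hdom hA hE
  refine ⟨Ψ, ⟨⟨hH1, fun i j hij => ?_, fun k hk => ?_, ?_⟩, fun k hk => ?_⟩, hEΨ⟩
  · exact tendsto_nhds_unique (tendsto_l2Inner (fun n => hΦ (φ n) i) (hH1 i).1
      (fun n => hΦ (φ n) j) (hH1 j).1 (hL2 i) (hL2 j))
      ((horth i j hij).comp hφ.tendsto_atTop)
  · exact tendsto_nhds_unique (tendsto_lpNorm (fun n => hΦ (φ n) k) (hH1 k).1 (hL2 k))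
      ((hnorm k hk).comp hφ.tendsto_atTop)
  · filter_upwards [hae, ae_all_iff.2 hsum] with x h1 h2
    have h3 : Tendsto (fun n => 2 * ∑ k, Φ (φ n) k x ^ 2) atTop (𝓝 (2 * ∑ k, Ψ k x ^ 2)) :=
      (tendsto_finsetSum _ fun k _ => (h1 k).pow 2).const_mul 2
    simp only [h2] at h3
    exact tendsto_nhds_unique h3 tendsto_const_nhds
  · filter_upwards [hae, ae_all_iff.2 fun n => hpos n k hk] with x h1 h2
    exact ge_of_tendsto' (h1 k) fun n => h2 _

theorem TPlus_ne_top {d : ℕ} {u : Space d → ℝ} (h : (orbitalSetPlus u).Nonempty) :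
    TPlus u ≠ ⊤ := by
  obtain ⟨Φ, hΦ⟩ := h
  refine ne_top_of_le_ne_top ?_ (iInf₂_le Φ hΦ)
  exact (ENNReal.sum_lt_top.2 fun k _ => (hΦ.1.1 k).dirichletEnergy_ne_top.lt_top).ne

theorem exists_minimizer {d : ℕ} {u : Space d → ℝ} (hu : MemLp u 2)
    (h : (orbitalSetPlus u).Nonempty) :
    ∃ Φ ∈ orbitalSetPlus u, kineticEnergy Φ = TPlus u := by
  have hT := TPlus_ne_top h
  have hseq : ∀ n : ℕ, ∃ Φ ∈ orbitalSetPlus u, kineticEnergy Φ ≤ TPlus u + (n + 1 : ℝ≥0∞)⁻¹ := by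
    intro n
    have hlt : TPlus u < TPlus u + (n + 1 : ℝ≥0∞)⁻¹ :=
      ENNReal.lt_add_right hT (by simp)
    obtain ⟨Φ, hΦ, hlt'⟩ := (show ∃ Φ, ∃ _ : Φ ∈ orbitalSetPlus u,
      kineticEnergy Φ < TPlus u + (n + 1 : ℝ≥0∞)⁻¹ by simpa [TPlus, iInf_lt_iff] using hlt)
    exact ⟨Φ, hΦ, hlt'.le⟩
  choose Φ hΦ hE using hseq
  obtain ⟨Ψ, hΨ, hEΨ⟩ := exists_mem_orbitalSetPlus_of_seq hu (Φ := Φ) (fun n => (hΦ n).1.2.2.2)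
    (fun n => (hΦ n).2) (fun i j hij => by simp [(hΦ _).1.2.1 i j hij])
    (fun k hk => by simp [(hΦ _).1.2.2.1 k hk]) hT hE
  exact ⟨Ψ, hΨ, le_antisymm hEΨ (iInf₂_le Ψ hΨ)⟩

/-! ### Algebra of the angle parametrization and the lower bound. -/

theorem amplitude_succ {d M : ℕ} (u : Space d → ℝ) (Θ : Fin M → Space d → ℝ) {k : ℕ} (hk : k < M)
    (x : Space d) :
    amplitude u Θ (k + 1) x = amplitude u Θ k x * Real.cos (Θ ⟨k, hk⟩ x) := by
  have : Finset.univ.filter (fun i : Fin M => (i : ℕ) < k + 1)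
      = insert ⟨k, hk⟩ (Finset.univ.filter fun i : Fin M => (i : ℕ) < k) := by
    ext i
    simp only [Finset.mem_filter, Finset.mem_univ, true_and, Finset.mem_insert, Fin.ext_iff]
    omega
  rw [amplitude, this, Finset.prod_insert (by simp), amplitude]
  ring

theorem amplitude_zero {d M : ℕ} (u : Space d → ℝ) (Θ : Fin M → Space d → ℝ) (x : Space d) :
    amplitude u Θ 0 x = |u x| / √2 := by
  simp [amplitude]

theorem two_mul_sum_angleOrbital_sq {d N : ℕ} (hN : 1 ≤ N) (u : Space d → ℝ)
    (Θ : Fin (N - 1) → Space d → ℝ) (x : Space d) :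
    2 * ∑ k : Fin N, angleOrbital u Θ k x ^ 2 = u x ^ 2 := by
  obtain ⟨M, rfl⟩ : ∃ M, N = M + 1 := ⟨N - 1, by omega⟩
  -- Invariant: the squared amplitude is what remains of `u² / 2` after the first `j` orbitals; each
  -- step splits it by `sin² + cos² = 1`.
  have key : ∀ j : ℕ, j ≤ M → ∑ k ∈ Finset.univ.filter (fun k : Fin (M + 1) => (k : ℕ) < j),
        angleOrbital u Θ k x ^ 2
      + amplitude u Θ j x ^ 2 = u x ^ 2 / 2 := by
    intro j
    induction j with
    | zero =>
      intro _
      simp [amplitude_zero, div_pow]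
    | succ j ih =>
      intro hj
      have hjM : j < M + 1 - 1 := by omega
      have hset : Finset.univ.filter (fun k : Fin (M + 1) => (k : ℕ) < j + 1)
          = insert ⟨j, by omega⟩ (Finset.univ.filter fun k : Fin (M + 1) => (k : ℕ) < j) := by
        ext i
        simp only [Finset.mem_filter, Finset.mem_univ, true_and, Finset.mem_insert, Fin.ext_iff]
        omega
      rw [hset, Finset.sum_insert (by simp), amplitude_succ u Θ hjM, ← ih (by omega)]
      simp only [angleOrbital, hjM, dite_true]
      have := Real.sin_sq_add_cos_sq (Θ ⟨j, hjM⟩ x)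
      linear_combination amplitude u Θ j x ^ 2 * this
  have h1 := key M le_rfl
  have hset : Finset.univ = insert (Fin.last M)
      (Finset.univ.filter fun k : Fin (M + 1) => (k : ℕ) < M) := by
    ext i
    simp only [Finset.mem_filter, Finset.mem_univ, true_and, Finset.mem_insert, Fin.ext_iff,
      Fin.val_last, true_iff]
    omega
  rw [hset, Finset.sum_insert (by simp)]
  have h2 : angleOrbital u Θ (Fin.last M) x = amplitude u Θ M x := by
    simp [angleOrbital]
  rw [h2]
  linarith

theorem amplitude_nonneg {d M : ℕ} (u : Space d → ℝ) (Θ : Fin M → Space d → ℝ) (k : ℕ)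
    {x : Space d} (h : ∀ i, |Θ i x| ≤ Real.pi / 2) : 0 ≤ amplitude u Θ k x :=
  mul_nonneg (by positivity) (Finset.prod_nonneg fun i _ =>
    Real.cos_nonneg_of_neg_pi_div_two_le_of_le (abs_le.1 (h i)).1 (abs_le.1 (h i)).2)

theorem abs_amplitude_le {d M : ℕ} (u : Space d → ℝ) (Θ : Fin M → Space d → ℝ) (k : ℕ)
    (x : Space d) : |amplitude u Θ k x| ≤ |u x| / √2 := by
  rw [amplitude, abs_mul, abs_div, abs_abs, abs_of_nonneg (Real.sqrt_nonneg 2), Finset.abs_prod]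
  exact mul_le_of_le_one_right (by positivity)
    (Finset.prod_le_one (fun _ _ => abs_nonneg _) fun _ _ => Real.abs_cos_le_one _)

theorem one_le_numOrbitals {d : ℕ} {u : Space d → ℝ} (hu : MemLp u 2)
    (hu0 : ∀ᵐ x, u x ≠ 0) : 1 ≤ numOrbitals u := by
  rw [Nat.one_le_iff_ne_zero, ← Nat.pos_iff_ne_zero, numOrbitals, Nat.ceil_pos,
    integral_pos_iff_support_of_nonneg (fun x => by positivity) (hu.integrable_sq.div_const 2)]
  have : (Function.support fun x => u x ^ 2 / 2) =ᵐ[volume] (Set.univ : Set (Space d)) := by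
    rw [ae_eq_univ]
    refine measure_mono_null (fun x hx => ?_) (ae_iff.1 hu0)
    simpa using hx
  rw [measure_congr this]
  exact isOpen_univ.measure_pos _ Set.univ_nonempty

/-- With `δ = 1 / (n + 1)` the limit of the orbitals is exactly orthonormal. Angles in `[-π/2, π/2]`
have nonnegative cosines, hence a nonnegative last orbital. -/
theorem TPlus_le_of_angle {d : ℕ} {u : Space d → ℝ} (hu : MemLp u 2) (hu0 : ∀ᵐ x, u x ≠ 0)
    {c : ℝ≥0∞} (hc : c ≠ ⊤)
    (h : ∀ δ : ℝ, 0 < δ → ∃ Θ ∈ angleSetPlus u ∩ almostOrthonormal u δ, angleEnergy u Θ ≤ c) :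
    TPlus u ≤ c := by
  have hN := one_le_numOrbitals hu hu0
  choose Θ hΘ hE using fun n : ℕ => h (1 / ((n : ℝ) + 1)) (by positivity)
  have hlim := tendsto_one_div_add_atTop_nhds_zero_nat (𝕜 := ℝ)
  obtain ⟨Ψ, hΨ, hEΨ⟩ := exists_mem_orbitalSetPlus_of_seq hu
    (Φ := fun n => angleOrbital u (Θ n))
    (fun n => Eventually.of_forall fun x => two_mul_sum_angleOrbital_sq hN u (Θ n) x)
    (fun n k hk => by
      filter_upwards [ae_all_iff.2 (hΘ n).1.2] with x hx
      rw [angleOrbital, dif_neg (by omega)]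
      exact amplitude_nonneg u (Θ n) k hx)
    (fun i j hij => by
      refine squeeze_zero_norm (fun n => ?_) hlim
      rcases lt_or_gt_of_ne hij with h1 | h1
      · exact (hΘ n).2.2.1 i j h1
      · have := (hΘ n).2.2.1 j i h1
        simpa [l2Inner, mul_comm] using this)
    (fun k hk => tendsto_iff_norm_sub_tendsto_zero.2
      (squeeze_zero (fun _ => norm_nonneg _) (fun n => (hΘ n).2.2.2 k hk) hlim)) hc
    (fun n => (hE n).trans le_self_add)
  exact (iInf₂_le Ψ hΨ).trans hEΨ

/-! ### Construction of one admissible family of orbitals. -/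

theorem abs_clip_sub_clip_le (a b x y : ℝ) :
    |max a (min b x) - max a (min b y)| ≤ |x - y| := by
  refine (abs_max_sub_max_le_max _ _ _ _).trans ?_
  rw [sub_self, abs_zero, max_eq_right (abs_nonneg _)]
  refine (abs_min_sub_min_le_max _ _ _ _).trans ?_
  rw [sub_self, abs_zero, max_eq_right (abs_nonneg _)]

/-- Clip `c sin(2πt/ℓ)` to `[-π/2, π/2]`. The integral of `sin²` depends continuously on `c`,
vanishes at `c = 0` and tends to `ℓ > 1`, so it equals `1` for some `c`. Oddness about `ℓ / 2`
annihilates the integral of `sin · cos`. -/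
theorem exists_odd_profile {ℓ : ℝ} (hℓ : 1 < ℓ) :
    ∃ (β : ℝ → ℝ) (L : ℝ), (∀ t, |β t| ≤ Real.pi / 2) ∧ (∀ s t, |β s - β t| ≤ L * |s - t|) ∧
      (∀ t, t ∉ Set.Ioo 0 ℓ → β t = 0) ∧ ∫ t, Real.sin (β t) ^ 2 = 1 ∧
      ∫ t, Real.sin (β t) * Real.cos (β t) = 0 := by
  have hℓ0 : 0 < ℓ := by linarith
  have hpi := Real.pi_pos
  set w : ℝ → ℝ := fun t => Real.sin (2 * Real.pi / ℓ * max 0 (min t ℓ)) with hw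
  have hwc : Continuous w := by fun_prop
  have hw0 : ∀ t, t ∉ Set.Ioo 0 ℓ → w t = 0 := by
    intro t ht
    rw [Set.mem_Ioo, not_and_or, not_lt, not_lt] at ht
    rcases ht with ht | ht
    · simp [hw, max_eq_left ((min_le_left t ℓ).trans ht)]
    · have e : 2 * Real.pi / ℓ * ℓ = 2 * Real.pi := by field_simp
      simp [hw, min_eq_right ht, max_eq_right hℓ0.le, e]
  have hwodd : ∀ t, w (ℓ - t) = -w t := by
    intro t
    have e : max 0 (min (ℓ - t) ℓ) = ℓ - max 0 (min t ℓ) := by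
      rcases le_total t 0 with h1 | h1
      · rw [min_eq_right (by linarith), min_eq_left (by linarith), max_eq_left h1,
          max_eq_right hℓ0.le, sub_zero]
      · rcases le_total t ℓ with h2 | h2
        · rw [min_eq_left (by linarith), min_eq_left h2, max_eq_right h1, max_eq_right (by linarith)]
        · rw [min_eq_left (by linarith), min_eq_right h2, max_eq_right hℓ0.le,
            max_eq_left (by linarith), sub_self]
    have e2 : 2 * Real.pi / ℓ * (ℓ - max 0 (min t ℓ))
        = 2 * Real.pi - 2 * Real.pi / ℓ * max 0 (min t ℓ) := by field_simp
    simp only [hw, e, e2, Real.sin_two_pi_sub]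
  set b : ℝ → ℝ → ℝ := fun c t => max (-(Real.pi / 2)) (min (Real.pi / 2) (c * w t)) with hb
  have hbc : Continuous fun p : ℝ × ℝ => b p.1 p.2 := by fun_prop
  have hJ : Continuous fun c : ℝ => ∫ t in (0)..ℓ, Real.sin (b c t) ^ 2 :=
    intervalIntegral.continuous_parametric_intervalIntegral_of_continuous'
      (f := fun c t => Real.sin (b c t) ^ 2) (by
        show Continuous fun p : ℝ × ℝ => Real.sin (b p.1 p.2) ^ 2
        fun_prop) 0 ℓ
  have hlim : Tendsto (fun c : ℝ => ∫ t in (0)..ℓ, Real.sin (b c t) ^ 2) atTop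
      (𝓝 (∫ _ in (0)..ℓ, (1 : ℝ))) := by
    refine intervalIntegral.tendsto_integral_filter_of_dominated_convergence (fun _ => 1)
      (Eventually.of_forall fun c => ?_) (Eventually.of_forall fun c => ?_) (by simp) ?_
    · have : Continuous fun t => b c t := hbc.comp (by fun_prop : Continuous fun t : ℝ => (c, t))
      exact (by fun_prop : Continuous fun t => Real.sin (b c t) ^ 2).aestronglyMeasurable
    · refine Eventually.of_forall fun t _ => ?_
      rw [Real.norm_eq_abs, abs_of_nonneg (sq_nonneg _)]
      exact Real.sin_sq_le_one _
    -- Away from the zeros of the sine, the clipped value is eventually `±π/2`, where `sin² = 1`.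
    · have hne : ∀ᵐ t : ℝ, t ≠ ℓ / 2 ∧ t ≠ ℓ := by
        refine (Measure.ae_ne volume _).and (Measure.ae_ne volume _)
      filter_upwards [hne] with t ht hmem
      rw [Set.uIoc_of_le hℓ0.le] at hmem
      have h1 : t < ℓ := lt_of_le_of_ne hmem.2 ht.2
      have harg : w t = Real.sin (2 * Real.pi / ℓ * t) := by
        simp only [hw]
        rw [min_eq_left h1.le, max_eq_right hmem.1.le]
      have hpos : 0 < 2 * Real.pi / ℓ * t := by have := hmem.1; positivity
      refine tendsto_const_nhds.congr' ?_
      rcases lt_or_gt_of_ne ht.1 with h2 | h2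
      · have hwp : 0 < w t := by
          rw [harg]
          refine Real.sin_pos_of_pos_of_lt_pi hpos ?_
          rw [div_mul_eq_mul_div, div_lt_iff₀ hℓ0]
          nlinarith
        filter_upwards [eventually_ge_atTop (Real.pi / 2 / w t)] with c hc
        rw [div_le_iff₀ hwp] at hc
        simp only [hb]
        rw [min_eq_left hc, max_eq_right (by linarith)]
        simp
      · have hwn : w t < 0 := by
          rw [harg]
          rw [← Real.sin_sub_two_pi]
          refine Real.sin_neg_of_neg_of_neg_pi_lt ?_ ?_
          · rw [sub_neg, div_mul_eq_mul_div, div_lt_iff₀ hℓ0]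
            nlinarith
          · have : Real.pi < 2 * Real.pi / ℓ * t := by
              rw [div_mul_eq_mul_div, lt_div_iff₀ hℓ0]
              nlinarith
            linarith
        filter_upwards [eventually_ge_atTop (Real.pi / 2 / (-w t))] with c hc
        rw [div_le_iff₀ (by linarith)] at hc
        simp only [hb]
        rw [min_eq_right (by linarith), max_eq_left (by linarith)]
        simp
  have hsome : ∃ c, 1 ≤ ∫ t in (0)..ℓ, Real.sin (b c t) ^ 2 := by
    have := hlim.eventually (lt_mem_nhds (a := 1) (by simpa using hℓ))
    obtain ⟨c, hc⟩ := this.exists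
    exact ⟨c, hc.le⟩
  obtain ⟨c, hc⟩ := mem_range_of_exists_le_of_exists_ge hJ ⟨0, by
    have : -(Real.pi / 2) ≤ 0 := by linarith
    simp [hb, this, (by positivity : 0 ≤ Real.pi / 2)]⟩ hsome
  have hbodd : ∀ t, b c (ℓ - t) = -b c t := by
    intro t
    simp only [hb, hwodd, mul_neg]
    generalize c * w t = a
    rcases le_total a (-(Real.pi / 2)) with h1 | h1
    · rw [min_eq_left (by linarith), min_eq_right (by linarith), max_eq_right (by linarith),
        max_eq_left h1, neg_neg]
    · rcases le_total (Real.pi / 2) a with h2 | h2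
      · rw [min_eq_right (by linarith), min_eq_left (by linarith), max_eq_left (by linarith),
          max_eq_right (by linarith)]
      · rw [min_eq_right (by linarith), min_eq_right (by linarith), max_eq_right (by linarith),
          max_eq_right (by linarith)]
  have hb0 : ∀ t, t ∉ Set.Ioo 0 ℓ → b c t = 0 := by
    intro t ht
    have : -(Real.pi / 2) ≤ 0 := by linarith
    simp [hb, hw0 t ht, (by positivity : 0 ≤ Real.pi / 2), this]
  refine ⟨b c, |c| * (2 * Real.pi / ℓ), fun t => ?_, fun s t => ?_, hb0, ?_, ?_⟩
  · exact abs_le.2 ⟨le_max_left _ _, max_le (by linarith) (min_le_left _ _)⟩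
  · have h1 : |b c s - b c t| ≤ |c * w s - c * w t| := by
      simp only [hb]
      exact abs_clip_sub_clip_le _ _ _ _
    have h2 : |w s - w t| ≤ 2 * Real.pi / ℓ * |s - t| := by
      simp only [hw]
      refine (Real.abs_sin_sub_sin_le _ _).trans ?_
      rw [← mul_sub, abs_mul, abs_of_nonneg (by positivity : 0 ≤ 2 * Real.pi / ℓ), min_comm s,
        min_comm t]
      exact mul_le_mul_of_nonneg_left (abs_clip_sub_clip_le _ _ _ _) (by positivity)
    rw [← mul_sub, abs_mul] at h1
    calc _ ≤ _ := h1
      _ ≤ |c| * (2 * Real.pi / ℓ * |s - t|) := by gcongr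
      _ = _ := by ring
  · rw [← hc]
    dsimp only
    rw [intervalIntegral.integral_of_le hℓ0.le,
      setIntegral_eq_integral_of_forall_compl_eq_zero]
    intro t ht
    rw [hb0 t fun h => ht ⟨h.1, h.2.le⟩]
    simp
  · have h1 := integral_sub_left_eq_self (fun t => Real.sin (b c t) * Real.cos (b c t)) volume ℓ
    simp only [hbodd, Real.sin_neg, Real.cos_neg, neg_mul, integral_neg] at h1
    linarith

/-- A finite measure on the line with a continuous strictly increasing distribution function is
pushed forward to Lebesgue measure by it. -/
theorem map_distribution_eq (ν : Measure ℝ) [IsFiniteMeasure ν]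
    (hc : Continuous fun a => ν.real (Set.Iic a)) (hs : StrictMono fun a => ν.real (Set.Iic a)) :
    ν.map (fun a => ν.real (Set.Iic a)) = volume.restrict (Set.Icc 0 (ν.real Set.univ)) := by
  set G : ℝ → ℝ := fun a => ν.real (Set.Iic a) with hG
  have : IsFiniteMeasure (ν.map G) := Measure.isFiniteMeasure_map ν G
  refine Measure.ext_of_Iic _ _ fun s => ?_
  rw [Measure.map_apply hc.measurable measurableSet_Iic,
    Measure.restrict_apply measurableSet_Iic]
  have hpos : ∀ a, 0 < G a := fun a =>
    lt_of_le_of_lt measureReal_nonneg (hs (sub_one_lt a))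
  have hlt : ∀ a, G a < ν.real Set.univ := fun a =>
    lt_of_lt_of_le (hs (lt_add_one a)) (measureReal_mono (Set.subset_univ _))
  rcases le_or_gt s 0 with h0 | h0
  · have e1 : G ⁻¹' Set.Iic s = ∅ := by
      ext a
      simpa using h0.trans_lt (hpos a)
    have e2 : Set.Iic s ∩ Set.Icc 0 (ν.real Set.univ) ⊆ {0} := fun x hx =>
      le_antisymm (hx.1.trans h0) hx.2.1
    rw [e1, measure_empty, measure_mono_null e2 (by simp)]
  rcases le_or_gt (ν.real Set.univ) s with h1 | h1
  · have e1 : G ⁻¹' Set.Iic s = Set.univ := by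
      ext a
      simpa using ((hlt a).trans_le h1).le
    have e2 : Set.Iic s ∩ Set.Icc 0 (ν.real Set.univ) = Set.Icc 0 (ν.real Set.univ) :=
      Set.inter_eq_right.2 fun x hx => hx.2.trans h1
    rw [e1, e2, Real.volume_Icc, sub_zero, ofReal_measureReal]
  have htop : ∃ a, s ≤ G a := by
    have h := (ENNReal.tendsto_toReal (measure_ne_top ν _)).comp (tendsto_measure_Iic_atTop ν)
    obtain ⟨a, ha⟩ := (h.eventually (lt_mem_nhds h1)).exists
    exact ⟨a, ha.le⟩
  have hbot : ∃ a, G a ≤ s := by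
    have h := tendsto_measure_iInter_atTop (μ := ν) (s := fun n : ℕ => Set.Iic (-(n : ℝ)))
      (fun n => measurableSet_Iic.nullMeasurableSet)
      (fun m n hmn => Set.Iic_subset_Iic.2 (by simpa using hmn)) ⟨0, measure_ne_top _ _⟩
    have e : ⋂ n : ℕ, Set.Iic (-(n : ℝ)) = ∅ := by
      ext x
      obtain ⟨n, hn⟩ := exists_nat_gt (-x)
      simp only [Set.mem_iInter, Set.mem_Iic, Set.mem_empty_iff_false, iff_false, not_forall]
      exact ⟨n, by linarith⟩
    rw [e, measure_empty] at h
    have h' := (ENNReal.tendsto_toReal (by simp)).comp h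
    obtain ⟨n, hn⟩ := (h'.eventually (gt_mem_nhds (by simpa using h0))).exists
    exact ⟨-(n : ℝ), hn.le⟩
  -- For `s = G a`, strict monotonicity makes the preimage of `Iic s` equal to `Iic a`, whose mass
  -- is `G a = s`.
  obtain ⟨a, ha⟩ := mem_range_of_exists_le_of_exists_ge hc hbot htop
  have e1 : G ⁻¹' Set.Iic s = Set.Iic a := by
    ext b
    simp only [Set.mem_preimage, Set.mem_Iic]
    rw [← ha]
    exact hs.le_iff_le
  have e2 : Set.Iic s ∩ Set.Icc 0 (ν.real Set.univ) = Set.Icc 0 s := by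
    ext x
    constructor
    · exact fun hx => ⟨hx.2.1, hx.1⟩
    · exact fun hx => ⟨hx.2, hx.1, hx.2.trans h1.le⟩
  rw [e1, e2, Real.volume_Icc, sub_zero, ← ha]
  exact (ofReal_measureReal).symm

theorem integral_abs_mul_abs_le {d : ℕ} {f g : Space d → ℝ} (hf : MemLp f 2 volume)
    (hg : MemLp g 2 volume) :
    ∫ x, |f x| * |g x| ≤ ‖hf.toLp f‖ * ‖hg.toLp g‖ := by
  have h := l2Inner_eq_inner hf.abs hg.abs
  have e : ∫ x, |f x| * |g x| = l2Inner |f| |g| := rfl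
  rw [e, h, ← lpNorm_eq_norm_toLp, ← lpNorm_eq_norm_toLp, ← lpNorm_abs hf.1, ← lpNorm_abs hg.1,
    lpNorm_eq_norm_toLp hf.abs, lpNorm_eq_norm_toLp hg.abs]
  exact real_inner_le_norm _ _

theorem norm_shift_sub_le {d : ℕ} {f : Space d → ℝ} (hf : MemLp f 2 volume) {B : ℝ≥0∞}
    (hB : B ≠ ⊤) (h : dirichletEnergy f ≤ B) (v : Space d) :
    ‖shift v (hf.toLp f) - hf.toLp f‖ ≤ ‖v‖ * √B.toReal := by
  have h1 := (lintegral_shift_sub_le hf v).trans (mul_le_mul_right h (‖v‖ₑ ^ 2))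
  rw [← ENNReal.toReal_le_toReal (by simp) (ENNReal.mul_ne_top (by simp) hB),
    ENNReal.toReal_mul, ENNReal.toReal_pow, ENNReal.toReal_pow, toReal_enorm, toReal_enorm]
    at h1
  have h2 := Real.le_sqrt_of_sq_le h1
  rwa [Real.sqrt_mul (by positivity), Real.sqrt_sq (norm_nonneg _)] at h2

/-- The half-space `x i ≤ a`. -/
def halfSpace {d : ℕ} (i : Fin d) (a : ℝ) : Set (Space d) := {x | x i ≤ a}

/-- The mass of `u²` to the left of a hyperplane is a Lipschitz function of its position. -/
theorem exists_setIntegral_sq_sub_le {d : ℕ} {u : Space d → ℝ} (hu : MemH1 u) (i : Fin d) :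
    ∃ L : ℝ, ∀ a b : ℝ, a ≤ b →
      (∫ x in halfSpace i b, u x ^ 2) - ∫ x in halfSpace i a, u x ^ 2
        ≤ L * (b - a) := by
  have hu2 := hu.1
  refine ⟨√(dirichletEnergy u).toReal * (2 * ‖hu2.toLp u‖), fun a b hab => ?_⟩
  set v : Space d := (b - a) • EuclideanSpace.single i (1 : ℝ) with hv
  have hnv : ‖v‖ = b - a := by
    rw [hv, norm_smul]
    simp [abs_of_nonneg (sub_nonneg.2 hab)]
  have hus : MemLp (fun x => u (x + v)) 2 volume :=
    hu2.comp_measurePreserving (measurePreserving_add_right volume v)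
  have hshift : shift v (hu2.toLp u) = hus.toLp _ := by
    apply Lp.ext
    filter_upwards [coeFn_shift v (hu2.toLp u), hus.coeFn_toLp,
      (measurePreserving_add_right volume v).quasiMeasurePreserving.ae hu2.coeFn_toLp]
      with x h1 h2 h3
    rw [h1, h2, h3]
  -- Translation by `v` carries one half-space to the other, so the increment of mass is an integral
  -- of `u(x + v)² - u(x)²`; factoring this and applying Cauchy–Schwarz leaves one factor of order
  -- `b - a`.
  have e1 : ∫ x in halfSpace i b, u x ^ 2
      = ∫ x in halfSpace i a, u (x + v) ^ 2 := by
    rw [← (measurePreserving_add_right volume v).setIntegral_preimage_emb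
      (measurableEmbedding_addRight v) (fun x => u x ^ 2) (halfSpace i b)]
    congr 2
    ext x
    simp only [halfSpace, hv, Set.mem_preimage, Set.mem_ofPred_eq, PiLp.add_apply, PiLp.smul_apply,
      PiLp.single_apply, if_true, smul_eq_mul, mul_one]
    constructor <;> intro h <;> linarith
  rw [e1, ← integral_sub hus.integrable_sq.integrableOn hu2.integrable_sq.integrableOn]
  have hsub : MemLp (fun x => u (x + v) - u x) 2 volume := hus.sub hu2
  have hadd : MemLp (fun x => u (x + v) + u x) 2 volume := hus.add hu2
  have hint : Integrable (fun x => |u (x + v) - u x| * |u (x + v) + u x|) :=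
    hsub.abs.integrable_mul hadd.abs
  calc ∫ x in halfSpace i a, (u (x + v) ^ 2 - u x ^ 2)
      ≤ ∫ x in halfSpace i a, |u (x + v) - u x| * |u (x + v) + u x| := by
        refine integral_mono (hus.integrable_sq.sub hu2.integrable_sq).integrableOn
          hint.integrableOn fun x => ?_
        dsimp only
        rw [← abs_mul]
        refine le_trans (le_of_eq ?_) (le_abs_self _)
        ring
    _ ≤ ∫ x, |u (x + v) - u x| * |u (x + v) + u x| :=
        setIntegral_le_integral hint (Eventually.of_forall fun x => by positivity)
    _ ≤ ‖hsub.toLp _‖ * ‖hadd.toLp _‖ := integral_abs_mul_abs_le hsub hadd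
    _ ≤ ((b - a) * √(dirichletEnergy u).toReal) * (2 * ‖hu2.toLp u‖) := by
        have h1 := norm_shift_sub_le hu2 hu.dirichletEnergy_ne_top le_rfl v
        rw [hshift, hnv] at h1
        have h2 : ‖hus.toLp _‖ = ‖hu2.toLp u‖ := by
          rw [← hshift]
          exact (shift v).norm_map _
        refine mul_le_mul h1 ?_ (norm_nonneg _) ((norm_nonneg _).trans h1)
        calc _ = ‖hus.toLp _ + hu2.toLp u‖ := rfl
          _ ≤ _ := norm_add_le _ _
          _ = _ := by rw [h2]; ring
    _ = _ := by ring

/-- There is a Lipschitz function under which the measure `u² / 2` is pushed forward to Lebesgue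
measure on an interval. -/
theorem exists_lipschitz_flattening {d : ℕ} (hd : 1 ≤ d) {u : Space d → ℝ} (hu : MemH1 u)
    (hu0 : ∀ᵐ x, u x ≠ 0) :
    ∃ (F : Space d → ℝ) (L : ℝ), (∀ x y, |F x - F y| ≤ L * ‖x - y‖) ∧
      ∀ H : ℝ → ℝ, Continuous H → ∫ x, u x ^ 2 / 2 * H (F x)
        = ∫ t in Set.Icc 0 (∫ x, u x ^ 2 / 2), H t := by
  set i : Fin d := ⟨0, hd⟩
  have hint : Integrable fun x => u x ^ 2 / 2 := hu.1.integrable_sq.div_const 2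
  set ρ : Space d → ℝ≥0∞ := fun x => ENNReal.ofReal (u x ^ 2 / 2) with hρ
  have hρm : AEMeasurable ρ := hint.1.aemeasurable.ennreal_ofReal
  set μ : Measure (Space d) := volume.withDensity ρ with hμ
  have : IsFiniteMeasure μ := by
    refine isFiniteMeasure_withDensity ?_
    rw [← ofReal_integral_eq_lintegral_ofReal hint (Eventually.of_forall fun x => by positivity)]
    simp
  have hμr : ∀ s, MeasurableSet s → μ.real s = ∫ x in s, u x ^ 2 / 2 := by
    intro s hs
    rw [Measure.real, hμ, withDensity_apply _ hs, ← ofReal_integral_eq_lintegral_ofReal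
      hint.integrableOn (Eventually.of_forall fun x => by positivity),
      ENNReal.toReal_ofReal (integral_nonneg fun x => by positivity)]
  have hcoord : Measurable fun x : Space d => x i := by fun_prop
  set ν : Measure ℝ := μ.map fun x => x i with hν
  have hνr : ∀ a, ν.real (Set.Iic a) = ∫ x in halfSpace i a, u x ^ 2 / 2 := by
    intro a
    rw [hν, map_measureReal_apply hcoord measurableSet_Iic, hμr _ (hcoord measurableSet_Iic)]
    rfl
  have hνu : ν.real Set.univ = ∫ x, u x ^ 2 / 2 := by
    rw [hν, map_measureReal_apply hcoord MeasurableSet.univ, Set.preimage_univ,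
      hμr _ MeasurableSet.univ, setIntegral_univ]
  have hfν : IsFiniteMeasure ν := Measure.isFiniteMeasure_map μ _
  obtain ⟨L, hL⟩ := exists_setIntegral_sq_sub_le hu i
  have hmono : Monotone fun a => ν.real (Set.Iic a) := fun a b hab =>
    measureReal_mono (Set.Iic_subset_Iic.2 hab)
  have hLip1 : ∀ a b, a ≤ b → ν.real (Set.Iic b) - ν.real (Set.Iic a) ≤ L / 2 * (b - a) := by
    intro a b hab
    rw [hνr, hνr, integral_div, integral_div]
    have := hL a b hab
    linarith
  have hLip : ∀ a b, |ν.real (Set.Iic a) - ν.real (Set.Iic b)| ≤ L / 2 * |a - b| := by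
    intro a b
    rcases le_total a b with h | h
    · rw [abs_sub_comm, abs_sub_comm a b, abs_of_nonneg (sub_nonneg.2 (hmono h)),
        abs_of_nonneg (sub_nonneg.2 h)]
      exact hLip1 a b h
    · rw [abs_of_nonneg (sub_nonneg.2 (hmono h)), abs_of_nonneg (sub_nonneg.2 h)]
      exact hLip1 b a h
  have hcont : Continuous fun a => ν.real (Set.Iic a) :=
    (LipschitzWith.of_dist_le' fun a b => hLip a b).continuous
  -- Since `u` vanishes almost nowhere, every open slab has positive mass.
  have hstrict : StrictMono fun a => ν.real (Set.Iic a) := by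
    intro a b hab
    have hpos : 0 < ν (Set.Ioo a b) := by
      rw [hν, Measure.map_apply hcoord measurableSet_Ioo]
      rw [pos_iff_ne_zero, hμ]
      intro h0
      rw [withDensity_apply_eq_zero' hρm] at h0
      have h1 : volume ((fun x : Space d => x i) ⁻¹' Set.Ioo a b) = 0 := by
        refine measure_mono_null (t := ({x | ρ x ≠ 0} ∩ (fun x : Space d => x i) ⁻¹' Set.Ioo a b)
          ∪ {x | ¬ u x ≠ 0}) (fun x hx => ?_) (measure_union_null h0 (ae_iff.1 hu0))
        by_cases hux : u x = 0
        · exact Or.inr (by simpa using hux)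
        · refine Or.inl ⟨?_, hx⟩
          simp only [hρ, Set.mem_ofPred_eq, ne_eq, ENNReal.ofReal_eq_zero, not_le]
          positivity
      have h2 : IsOpen ((fun x : Space d => x i) ⁻¹' Set.Ioo a b) :=
        isOpen_Ioo.preimage (by fun_prop)
      refine (h2.measure_pos volume ⟨EuclideanSpace.single i ((a + b) / 2), ?_⟩).ne' h1
      simp only [Set.mem_preimage, PiLp.single_apply, if_true, Set.mem_Ioo]
      constructor <;> linarith
    have hlt : ν.real (Set.Iic a) + ν.real (Set.Ioo a b) ≤ ν.real (Set.Iic b) := by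
      rw [← measureReal_union (μ := ν) (s₁ := Set.Iic a) (s₂ := Set.Ioo a b) (Set.disjoint_left.2 fun x h1 h2 =>
        absurd h2.1 (not_lt.2 h1)) measurableSet_Ioo]
      refine measureReal_mono ?_
      rintro x (h1 | h1)
      · exact le_trans h1 hab.le
      · exact h1.2.le
    have : 0 < ν.real (Set.Ioo a b) := ENNReal.toReal_pos hpos.ne' (measure_ne_top _ _)
    dsimp only
    linarith
  have hL0 : 0 ≤ L / 2 := by
    have := (abs_nonneg _).trans (hLip 1 0)
    simpa using this
  -- The flattening map sends `x` to the mass of `u² / 2` in the half-space to the left of `x`.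
  refine ⟨fun x => ν.real (Set.Iic (x i)), L / 2, fun x y => ?_, fun H hH => ?_⟩
  · refine (hLip _ _).trans ?_
    gcongr
    simpa using PiLp.norm_apply_le (x - y) i
  · have hmap := map_distribution_eq ν hcont hstrict
    rw [hνu] at hmap
    rw [← hmap, integral_map hcont.measurable.aemeasurable hH.aestronglyMeasurable]
    have e := integral_map (μ := μ) hcoord.aemeasurable (hH.comp hcont).aestronglyMeasurable
    simp only [Function.comp_def] at e
    rw [e, hμ, integral_withDensity_eq_integral_toReal_smul₀ hρm (by simp [hρ])]
    refine integral_congr_ae (Eventually.of_forall fun x => ?_)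
    simp only [hρ, smul_eq_mul]
    rw [ENNReal.toReal_ofReal (by positivity)]

/-- `b` is a Lipschitz function with values in `[-1, 1]`. -/
def IsUnitLipschitz {d : ℕ} (b : Space d → ℝ) : Prop :=
  (∀ x, |b x| ≤ 1) ∧ ∃ L : ℝ, ∀ x y, |b x - b y| ≤ L * ‖x - y‖

theorem IsUnitLipschitz.continuous {d : ℕ} {b : Space d → ℝ} (hb : IsUnitLipschitz b) :
    Continuous b := by
  obtain ⟨-, L, hL⟩ := hb
  exact (LipschitzWith.of_dist_le' (K := L) fun x y => by
    rw [Real.dist_eq, dist_eq_norm]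
    exact hL x y).continuous

theorem isUnitLipschitz_const {d : ℕ} {c : ℝ} (hc : |c| ≤ 1) :
    IsUnitLipschitz fun _ : Space d => c :=
  ⟨fun _ => hc, 0, fun x y => by simp⟩

theorem IsUnitLipschitz.mul {d : ℕ} {a b : Space d → ℝ} (ha : IsUnitLipschitz a)
    (hb : IsUnitLipschitz b) : IsUnitLipschitz fun x => a x * b x := by
  obtain ⟨ha1, L, hL⟩ := ha
  obtain ⟨hb1, K, hK⟩ := hb
  refine ⟨fun x => ?_, L + K, fun x y => ?_⟩
  · rw [abs_mul]
    exact mul_le_one₀ (ha1 x) (abs_nonneg _) (hb1 x)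
  · have e : a x * b x - a y * b y = (a x - a y) * b x + a y * (b x - b y) := by ring
    rw [e]
    refine (abs_add_le _ _).trans ?_
    rw [abs_mul, abs_mul, add_mul]
    exact add_le_add
      ((mul_le_of_le_one_right (abs_nonneg _) (hb1 x)).trans (hL x y))
      ((mul_le_of_le_one_left (abs_nonneg _) (ha1 y)).trans (hK x y))

theorem isUnitLipschitz_prod {d : ℕ} {ι : Type*} {b : ι → Space d → ℝ}
    (hb : ∀ i, IsUnitLipschitz (b i)) (s : Finset ι) :
    IsUnitLipschitz fun x => ∏ i ∈ s, b i x := by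
  classical
  induction s using Finset.induction_on with
  | empty => simpa using isUnitLipschitz_const (d := d) (c := 1) (by simp)
  | insert i s hi ih =>
    simp only [Finset.prod_insert hi]
    exact (hb i).mul ih

theorem enorm_sq_le_of_abs_le {a b c : ℝ} (h : |a| ≤ |b| + |c|) :
    ‖a‖ₑ ^ 2 ≤ 2 * ‖b‖ₑ ^ 2 + 2 * ‖c‖ₑ ^ 2 := by
  have h1 : a ^ 2 ≤ 2 * b ^ 2 + 2 * c ^ 2 := by
    have h2 : |a| ^ 2 ≤ (|b| + |c|) ^ 2 := by gcongr
    rw [sq_abs] at h2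
    nlinarith [sq_nonneg (|b| - |c|), sq_abs b, sq_abs c]
  have e : ∀ t : ℝ, ‖t‖ₑ ^ 2 = ENNReal.ofReal (t ^ 2) := fun t => by
    rw [← ofReal_norm, ← ENNReal.ofReal_pow (norm_nonneg _), Real.norm_eq_abs, sq_abs]
  have e2 : (2 : ℝ≥0∞) = ENNReal.ofReal 2 := by simp
  rw [e, e, e, e2, ← ENNReal.ofReal_mul (by norm_num), ← ENNReal.ofReal_mul (by norm_num),
    ← ENNReal.ofReal_add (by positivity) (by positivity)]
  exact ENNReal.ofReal_le_ofReal h1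

/-- Product rule for difference quotients: one term is controlled by the quotient of `u`, the other
by the Lipschitz constant of `b` times `u`. -/
theorem MemH1.abs_mul {d : ℕ} {u b : Space d → ℝ} (hu : MemH1 u) (hb : IsUnitLipschitz b) :
    MemH1 fun x => |u x| * b x := by
  have hbm : AEStronglyMeasurable b := hb.continuous.aestronglyMeasurable
  obtain ⟨hb1, L, hL⟩ := hb
  have hL2 : MemLp (fun x => |u x| * b x) 2 volume := by
    refine hu.1.mono (hu.1.abs.1.mul hbm) (Eventually.of_forall fun x => ?_)
    rw [norm_mul, Real.norm_eq_abs, abs_abs]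
    exact mul_le_of_le_one_right (abs_nonneg _) (hb1 x)
  set C : ℝ≥0∞ := 2 * ∫⁻ x, ‖L * u x‖ₑ ^ 2 with hC
  have hCtop : C ≠ ⊤ :=
    ENNReal.mul_ne_top (by simp) ((memLp_two_iff_lintegral (hu.1.const_mul L).1).1
      (hu.1.const_mul L))
  refine memH1_of_diffEnergy_le hL2 (C := ∑ _i : Fin d, (2 * dirichletEnergy u + C))
    (ENNReal.sum_ne_top.2 fun _ _ => ENNReal.add_ne_top.2
      ⟨ENNReal.mul_ne_top (by simp) hu.dirichletEnergy_ne_top, hCtop⟩) fun s hs => ?_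
  refine Finset.sum_le_sum fun i _ => ?_
  set v : Space d := s • EuclideanSpace.single i (1 : ℝ) with hv
  have hnv : ‖v‖ = |s| := by simp [hv, norm_smul]
  have hq : AEMeasurable (fun x => 2 * ‖s⁻¹ * (u (x + v) - u x)‖ₑ ^ 2) :=
    ((((hu.1.1.comp_measurePreserving (measurePreserving_add_right volume v)).sub
      hu.1.1).const_mul _).enorm.pow_const 2).const_mul _
  calc ∫⁻ x, ‖s⁻¹ * (|u (x + v)| * b (x + v) - |u x| * b x)‖ₑ ^ 2
      ≤ ∫⁻ x, (2 * ‖s⁻¹ * (u (x + v) - u x)‖ₑ ^ 2 + 2 * ‖L * u x‖ₑ ^ 2) := by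
        refine lintegral_mono fun x => enorm_sq_le_of_abs_le ?_
        have e : s⁻¹ * (|u (x + v)| * b (x + v) - |u x| * b x)
            = s⁻¹ * (|u (x + v)| - |u x|) * b (x + v) + s⁻¹ * (|u x| * (b (x + v) - b x)) := by
          ring
        rw [e]
        refine (abs_add_le _ _).trans (add_le_add ?_ ?_)
        · rw [_root_.abs_mul]
          refine (mul_le_of_le_one_right (abs_nonneg _) (hb1 _)).trans ?_
          rw [_root_.abs_mul, _root_.abs_mul]
          exact mul_le_mul_of_nonneg_left (abs_abs_sub_abs_le _ _) (abs_nonneg _)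
        · have h1 : |b (x + v) - b x| ≤ |L| * |s| := by
            have := hL (x + v) x
            rw [add_sub_cancel_left, hnv] at this
            exact this.trans (by gcongr; exact le_abs_self L)
          have hs' : |s| ≠ 0 := abs_ne_zero.2 hs
          rw [_root_.abs_mul, _root_.abs_mul, _root_.abs_mul, abs_inv, abs_abs]
          calc |s|⁻¹ * (|u x| * |b (x + v) - b x|) ≤ |s|⁻¹ * (|u x| * (|L| * |s|)) := by gcongr
            _ = |L| * |u x| := by field_simp
    _ = 2 * (∫⁻ x, ‖s⁻¹ * (u (x + v) - u x)‖ₑ ^ 2) + C := by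
        rw [lintegral_add_left' hq, lintegral_const_mul' _ _ (by simp),
          lintegral_const_mul' _ _ (by simp)]
    _ ≤ _ := by
        gcongr
        refine le_trans ?_ (diffEnergy_le_dirichletEnergy hu.1 hs)
        exact Finset.single_le_sum (f := fun i : Fin d =>
          ∫⁻ x, ‖s⁻¹ * (u (x + s • EuclideanSpace.single i 1) - u x)‖ₑ ^ 2)
          (fun _ _ => zero_le) (Finset.mem_univ i)

theorem isUnitLipschitz_sin_cos {d : ℕ} {θ : Space d → ℝ} {L : ℝ}
    (h : ∀ x y, |θ x - θ y| ≤ L * ‖x - y‖) :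
    IsUnitLipschitz (fun x => Real.sin (θ x)) ∧ IsUnitLipschitz fun x => Real.cos (θ x) :=
  ⟨⟨fun _ => Real.abs_sin_le_one _, L, fun x y => (Real.abs_sin_sub_sin_le _ _).trans (h x y)⟩,
    fun _ => Real.abs_cos_le_one _, L, fun x y => (Real.abs_cos_sub_cos_le _ _).trans (h x y)⟩

theorem memH1_angleOrbital {d N : ℕ} {u : Space d → ℝ} (hu : MemH1 u)
    {Θ : Fin (N - 1) → Space d → ℝ} {L : ℝ} (h : ∀ k x y, |Θ k x - Θ k y| ≤ L * ‖x - y‖)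
    (k : Fin N) : MemH1 (angleOrbital u Θ k) := by
  have hs2 : |(√2)⁻¹| ≤ 1 := by
    rw [abs_of_nonneg (by positivity)]
    exact inv_le_one_of_one_le₀ (Real.one_le_sqrt.2 (by norm_num))
  have hamp : IsUnitLipschitz fun x => (√2)⁻¹ *
      ∏ i ∈ Finset.univ.filter (fun i : Fin (N - 1) => (i : ℕ) < k), Real.cos (Θ i x) :=
    (isUnitLipschitz_const hs2).mul
      (isUnitLipschitz_prod (fun i => (isUnitLipschitz_sin_cos (h i)).2) _)
  by_cases hk : (k : ℕ) < N - 1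
  · convert! hu.abs_mul (hamp.mul (isUnitLipschitz_sin_cos (h ⟨k, hk⟩)).1) using 1
    ext x
    simp only [angleOrbital, hk, dite_true, amplitude]
    ring
  · convert! hu.abs_mul hamp using 1
    ext x
    simp only [angleOrbital, hk, dite_false, amplitude]
    ring

theorem amplitude_mul_sin_of_disjoint {d M : ℕ} (u : Space d → ℝ) {Θ : Fin M → Space d → ℝ}
    {x : Space d} {k : Fin M} (h : ∀ i, i ≠ k → Θ i x = 0 ∨ Θ k x = 0) :
    amplitude u Θ k x * Real.sin (Θ k x) = |u x| / √2 * Real.sin (Θ k x) := by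
  by_cases h0 : Θ k x = 0
  · simp [h0]
  congr 1
  rw [amplitude, Finset.prod_eq_one, mul_one]
  intro i hi
  have hne : i ≠ k := by
    rintro rfl
    simp at hi
  rw [(h i hne).resolve_right h0, Real.cos_zero]

/-- Angles with disjoint supports turn every orbital but the last into `|u| / √2 · sin θₖ`. These
are mutually orthogonal by disjointness, and orthogonal to the last one because the profile is odd.
-/
theorem orbitalSetPlus_nonempty {d : ℕ} (hd : 1 ≤ d) {u : Space d → ℝ} (hu : MemH1 u)
    (hu0 : ∀ᵐ x, u x ≠ 0) : (orbitalSetPlus u).Nonempty := by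
  have hN := one_le_numOrbitals hu.1 hu0
  set m : ℝ := ∫ x, u x ^ 2 / 2 with hm
  have hm0 : 0 ≤ m := integral_nonneg fun x => by positivity
  have hNm : ((numOrbitals u - 1 : ℕ) : ℝ) < m := by
    have := Nat.ceil_lt_add_one hm0
    rw [Nat.cast_sub hN]
    push_cast
    have e : (numOrbitals u : ℝ) = (⌈m⌉₊ : ℝ) := rfl
    linarith
  -- Rounding up gives `N - 1 < m`, hence `ℓ = m / (N - 1)` exceeds `1`; for `N = 1` there is no
  -- interval to place and any `ℓ > 1` serves.
  obtain ⟨ℓ, hℓ, hMℓ⟩ : ∃ ℓ : ℝ, 1 < ℓ ∧ ((numOrbitals u - 1 : ℕ) : ℝ) * ℓ ≤ m := by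
    rcases Nat.eq_zero_or_pos (numOrbitals u - 1) with h | h
    · exact ⟨2, by norm_num, by simpa [h] using hm0⟩
    · have h' : (0 : ℝ) < ((numOrbitals u - 1 : ℕ) : ℝ) := by exact_mod_cast h
      exact ⟨m / ((numOrbitals u - 1 : ℕ) : ℝ), by rwa [one_lt_div h'],
        by rw [mul_div_cancel₀ _ h'.ne']⟩
  obtain ⟨β, L, hβ, hβL, hβ0, hβ1, hβ2⟩ := exists_odd_profile hℓ
  obtain ⟨F, K, hF, hFint⟩ := exists_lipschitz_flattening hd hu hu0
  have hL0 : 0 ≤ L := by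
    have := (abs_nonneg _).trans (hβL 1 0)
    simpa using this
  have hβc : Continuous β := (LipschitzWith.of_dist_le' fun a b => hβL a b).continuous
  set Θ : Fin (numOrbitals u - 1) → Space d → ℝ := fun k x => β (F x - k * ℓ) with hΘ
  have hΘL : ∀ k x y, |Θ k x - Θ k y| ≤ L * K * ‖x - y‖ := by
    intro k x y
    refine (hβL _ _).trans ?_
    rw [sub_sub_sub_cancel_right, mul_assoc]
    gcongr
    exact hF x y
  have hmem : ∀ (k : Fin (numOrbitals u - 1)) (t : ℝ), β (t - k * ℓ) ≠ 0 →
      (k : ℝ) * ℓ < t ∧ t < ((k : ℝ) + 1) * ℓ := by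
    intro k t h
    have : t - k * ℓ ∈ Set.Ioo 0 ℓ := by
      by_contra hn
      exact h (hβ0 _ hn)
    constructor <;> nlinarith [this.1, this.2]
  have hdisj : ∀ x, ∀ i k : Fin (numOrbitals u - 1), i ≠ k → Θ i x = 0 ∨ Θ k x = 0 := by
    intro x i k hik
    by_contra! hn
    have h1 := hmem i _ hn.1
    have h2 := hmem k _ hn.2
    have hℓ0 : 0 < ℓ := by linarith
    have h3 : (i : ℝ) < k + 1 := lt_of_mul_lt_mul_right (h1.1.trans h2.2) hℓ0.le
    have h4 : (k : ℝ) < i + 1 := lt_of_mul_lt_mul_right (h2.1.trans h1.2) hℓ0.le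
    refine hik (Fin.ext ?_)
    have h5 : (i : ℕ) < k + 1 := by exact_mod_cast h3
    have h6 : (k : ℕ) < i + 1 := by exact_mod_cast h4
    omega
  have hset : ∀ (k : Fin (numOrbitals u - 1)) (h : ℝ → ℝ), Continuous h → h 0 = 0 →
      ∫ x, u x ^ 2 / 2 * h (Θ k x) = ∫ t, h (β t) := by
    intro k h hc h0
    have e := hFint (fun t => h (β (t - k * ℓ))) (by fun_prop)
    rw [← integral_sub_right_eq_self (fun t => h (β t)) ((k : ℝ) * ℓ)]
    rw [setIntegral_eq_integral_of_forall_compl_eq_zero] at e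
    · exact e
    · intro t ht
      have : β (t - k * ℓ) = 0 := by
        by_contra hn
        have h1 := hmem k t hn
        refine ht ⟨le_trans (by positivity) h1.1.le, h1.2.le.trans ?_⟩
        have h2 : ((k : ℝ) + 1) ≤ ((numOrbitals u - 1 : ℕ) : ℝ) := by exact_mod_cast k.2
        exact (by gcongr : ((k : ℝ) + 1) * ℓ ≤ ((numOrbitals u - 1 : ℕ) : ℝ) * ℓ).trans hMℓ
      rw [this, h0]
  have hsq : ∀ x, |u x| / √2 * (|u x| / √2) = u x ^ 2 / 2 := fun x => by
    rw [div_mul_div_comm, Real.mul_self_sqrt (by norm_num), abs_mul_abs_self, sq]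
  set Φ := angleOrbital (N := numOrbitals u) u Θ with hΦ
  have hΦk : ∀ (k : Fin (numOrbitals u)) (hk : (k : ℕ) < numOrbitals u - 1) (x : Space d),
      Φ k x = |u x| / √2 * Real.sin (Θ ⟨k, hk⟩ x) := by
    intro k hk x
    simp only [hΦ, angleOrbital, hk, dite_true]
    exact amplitude_mul_sin_of_disjoint u (k := ⟨k, hk⟩) fun i hi => hdisj x i _ hi
  have hΦlast : ∀ (k j : Fin (numOrbitals u)) (hk : (k : ℕ) < numOrbitals u - 1),
      ¬ (j : ℕ) < numOrbitals u - 1 → l2Inner (Φ k) (Φ j) = 0 := by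
    intro k j hk hj
    rw [← hβ2, ← hset ⟨k, hk⟩ (fun t => Real.sin t * Real.cos t) (by fun_prop) (by simp)]
    refine integral_congr_ae (Eventually.of_forall fun x => ?_)
    dsimp only
    rw [hΦk k hk]
    simp only [hΦ, angleOrbital, hj, dite_false, amplitude]
    rw [← hsq]
    by_cases h0 : Θ ⟨k, hk⟩ x = 0
    · simp [h0]
    -- Where `θₖ ≠ 0` all other angles vanish, so the last orbital is `|u| / √2 · cos θₖ` there.
    rw [Finset.prod_eq_single (⟨k, hk⟩ : Fin (numOrbitals u - 1))]
    · ring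
    · intro i _ hi
      rw [(hdisj x i _ hi).resolve_right h0, Real.cos_zero]
    · intro hn
      have h2 := j.2
      simp only [Finset.mem_filter, Finset.mem_univ, true_and, not_lt] at hn
      omega
  have hH1 : ∀ k, MemH1 (Φ k) := memH1_angleOrbital hu hΘL
  refine ⟨Φ, ⟨hH1, fun i j hij => ?_, fun k hk => ?_,
    Eventually.of_forall fun x => two_mul_sum_angleOrbital_sq hN u Θ x⟩, fun k hk => ?_⟩
  · by_cases hi : (i : ℕ) < numOrbitals u - 1
    · by_cases hj : (j : ℕ) < numOrbitals u - 1
      · refine integral_eq_zero_of_ae (Eventually.of_forall fun x => ?_)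
        dsimp only [Pi.zero_apply]
        rw [hΦk i hi, hΦk j hj]
        rcases hdisj x ⟨i, hi⟩ ⟨j, hj⟩ (by simpa [Fin.ext_iff] using hij) with h | h <;> simp [h]
      · exact hΦlast i j hi hj
    · by_cases hj : (j : ℕ) < numOrbitals u - 1
      · rw [← hΦlast j i hj hi]
        simp [l2Inner, mul_comm]
      · exact absurd (Fin.ext (by omega)) hij
  · have hk' : (k : ℕ) < numOrbitals u - 1 := by omega
    have h1 := lpNorm_sq_eq (hH1 k).1
    have h2 : ∫ x, Φ k x ^ 2 = 1 := by
      rw [← hβ1, ← hset ⟨k, hk'⟩ (fun t => Real.sin t ^ 2) (by fun_prop) (by simp)]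
      refine integral_congr_ae (Eventually.of_forall fun x => ?_)
      dsimp only
      rw [hΦk k hk', ← hsq]
      ring
    rw [h2] at h1
    exact (pow_eq_one_iff_of_nonneg lpNorm_nonneg (by norm_num)).1 h1
  · refine Eventually.of_forall fun x => ?_
    simp only [hΦ, angleOrbital]
    rw [dif_neg (by omega)]
    exact amplitude_nonneg u Θ k fun i => hβ _

/-! ### The logarithmic cutoff. -/

/-- The geometric mean is at most the logarithmic mean: with `a = b exp(2t)` this is `t ≤ sinh t`.
-/
theorem sqrt_mul_mul_abs_log_sub_log_le {a b : ℝ} (ha : 0 < a) (hb : 0 < b) :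
    √(a * b) * |Real.log a - Real.log b| ≤ |a - b| := by
  wlog hab : b ≤ a generalizing a b
  · have := this hb ha (le_of_not_ge hab)
    rwa [mul_comm b a, abs_sub_comm, abs_sub_comm b a] at this
  set t := (Real.log a - Real.log b) / 2 with ht
  have hlog : Real.log b ≤ Real.log a := Real.log_le_log hb hab
  have ht0 : 0 ≤ t := by rw [ht]; linarith
  have h1 : a = b * (Real.exp t * Real.exp t) := by
    rw [← Real.exp_add, show t + t = Real.log a - Real.log b by rw [ht]; ring, Real.exp_sub,
      Real.exp_log ha, Real.exp_log hb]
    field_simp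
  have hs : √(a * b) = b * Real.exp t := by
    rw [h1, show b * (Real.exp t * Real.exp t) * b = (b * Real.exp t) ^ 2 by ring,
      Real.sqrt_sq (by positivity)]
  have h2 : 2 * t ≤ Real.exp t - Real.exp (-t) := by
    have := Real.self_le_sinh_iff.2 ht0
    rw [Real.sinh_eq] at this
    linarith
  rw [abs_of_nonneg (sub_nonneg.2 hlog), abs_of_nonneg (sub_nonneg.2 hab), hs]
  have h3 : Real.log a - Real.log b = 2 * t := by rw [ht]; ring
  rw [h3]
  calc b * Real.exp t * (2 * t) ≤ b * Real.exp t * (Real.exp t - Real.exp (-t)) := by gcongr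
    _ = b * (Real.exp t * Real.exp t) - b * (Real.exp t * Real.exp (-t)) := by ring
    _ = a - b := by rw [← Real.exp_add t (-t), ← h1]; simp

/-- A logarithmic cutoff: `0` near the origin and `κ⁻¹` away from it. -/
noncomputable def logCutoff (κ r : ℝ) : ℝ :=
  max 0 (min κ⁻¹ (κ * Real.log (r / Real.exp (-(2 * κ⁻¹ ^ 2)))))

theorem logCutoff_nonneg (κ r : ℝ) : 0 ≤ logCutoff κ r := le_max_left _ _

theorem logCutoff_le {κ : ℝ} (hκ : 0 < κ) (r : ℝ) : logCutoff κ r ≤ κ⁻¹ :=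
  max_le (by positivity) (min_le_left _ _)

/-- This rests on the convention `Real.log 0 = 0`; it agrees with the value `0` taken at small
positive radii. -/
theorem logCutoff_zero {κ : ℝ} (hκ : 0 < κ) : logCutoff κ 0 = 0 := by
  simp [logCutoff, hκ.le]

/-- The logarithm starts at radius `exp(-2κ⁻²)` and needs the factor `exp(κ⁻²)` to climb to `κ⁻¹` at
slope `κ`. Both radii tend to `0` with `κ`. -/
theorem logCutoff_eq {κ r : ℝ} (hκ : 0 < κ) (hr : Real.exp (-κ⁻¹ ^ 2) ≤ r) :
    logCutoff κ r = κ⁻¹ := by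
  have hr0 : 0 < r := (Real.exp_pos _).trans_le hr
  have h1 : κ⁻¹ ^ 2 ≤ Real.log (r / Real.exp (-(2 * κ⁻¹ ^ 2))) := by
    rw [Real.log_div hr0.ne' (Real.exp_pos _).ne', Real.log_exp]
    have := (Real.le_log_iff_exp_le hr0).2 hr
    linarith
  have h2 : κ⁻¹ ≤ κ * Real.log (r / Real.exp (-(2 * κ⁻¹ ^ 2))) := by
    calc κ⁻¹ = κ * κ⁻¹ ^ 2 := by field_simp
      _ ≤ _ := by gcongr
  rw [logCutoff, min_eq_left h2, max_eq_right (by positivity)]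

/-- The discrete form of `r |τ'(r)| ≤ κ`: the cutoff varies slowly on the logarithmic scale, which
is what keeps the cost of tilting small. -/
theorem sqrt_mul_mul_abs_logCutoff_sub_le {κ r s : ℝ} (hκ : 0 < κ) (hr : 0 < r) (hs : 0 < s) :
    √(r * s) * |logCutoff κ r - logCutoff κ s| ≤ κ * |r - s| := by
  have h1 : |logCutoff κ r - logCutoff κ s| ≤ κ * |Real.log r - Real.log s| := by
    refine (abs_clip_sub_clip_le _ _ _ _).trans (le_of_eq ?_)
    rw [← mul_sub, abs_mul, abs_of_pos hκ, Real.log_div hr.ne' (Real.exp_pos _).ne',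
      Real.log_div hs.ne' (Real.exp_pos _).ne', sub_sub_sub_cancel_right]
  calc _ ≤ √(r * s) * (κ * |Real.log r - Real.log s|) := by gcongr
    _ = κ * (√(r * s) * |Real.log r - Real.log s|) := by ring
    _ ≤ _ := by gcongr; exact sqrt_mul_mul_abs_log_sub_log_le hr hs

/-- Below the inner radius the cutoff is constant, so radii may be raised to it, where the logarithm
is Lipschitz. -/
theorem logCutoff_max {κ r : ℝ} (hκ : 0 < κ) (hr : 0 ≤ r) :
    logCutoff κ (max r (Real.exp (-(2 * κ⁻¹ ^ 2)))) = logCutoff κ r := by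
  set r₀ := Real.exp (-(2 * κ⁻¹ ^ 2)) with hr₀
  have h0 : 0 < r₀ := Real.exp_pos _
  rcases le_total r r₀ with h | h
  · rw [max_eq_right h, logCutoff, logCutoff, ← hr₀, div_self h0.ne', Real.log_one, mul_zero]
    have hlog : κ * Real.log (r / r₀) ≤ 0 :=
      mul_nonpos_of_nonneg_of_nonpos hκ.le
        (Real.log_nonpos (by positivity) ((div_le_one h0).2 h))
    rw [max_eq_left (min_le_right _ _), max_eq_left ((min_le_right _ _).trans hlog)]
  · rw [max_eq_left h]

theorem abs_logCutoff_sub_le {κ r s : ℝ} (hκ : 0 < κ) (hr : 0 ≤ r) (hs : 0 ≤ s) :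
    |logCutoff κ r - logCutoff κ s| ≤ κ / Real.exp (-(2 * κ⁻¹ ^ 2)) * |r - s| := by
  rw [← logCutoff_max hκ hr, ← logCutoff_max hκ hs]
  set r₀ := Real.exp (-(2 * κ⁻¹ ^ 2))
  have h0 : 0 < r₀ := Real.exp_pos _
  have h1 := sqrt_mul_mul_abs_logCutoff_sub_le hκ (h0.trans_le (le_max_right r r₀))
    (h0.trans_le (le_max_right s r₀))
  have h2 : r₀ ≤ √(max r r₀ * max s r₀) :=
    Real.le_sqrt_of_sq_le (by
      rw [sq]
      exact mul_le_mul (le_max_right _ _) (le_max_right _ _) h0.le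
        (h0.le.trans (le_max_right _ _)))
  have h3 : |max r r₀ - max s r₀| ≤ |r - s| := abs_max_sub_max_le_abs _ _ _
  rw [div_mul_eq_mul_div, le_div_iff₀ h0, mul_comm]
  calc _ ≤ √(max r r₀ * max s r₀) * |logCutoff κ (max r r₀) - logCutoff κ (max s r₀)| := by
        gcongr
    _ ≤ _ := h1
    _ ≤ _ := by gcongr

/-! ### Tilting vectors of a half-space towards its axis. -/

section Direction

variable {E : Type*} [NormedAddCommGroup E] [InnerProductSpace ℝ E]

/-- Separates a squared distance into radial and angular parts, so that changing only directions
affects only the second term. -/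
theorem norm_sub_sq_eq_polar {a b : E} (ha : ‖a‖ = 1) (hb : ‖b‖ = 1) (r s : ℝ) :
    ‖r • a - s • b‖ ^ 2 = (r - s) ^ 2 + r * s * ‖a - b‖ ^ 2 := by
  rw [norm_sub_sq_real, norm_sub_sq_real, norm_smul, norm_smul, ha, hb, inner_smul_left,
    inner_smul_right]
  simp only [Real.norm_eq_abs, mul_one, sq_abs, conj_trivial]
  ring

theorem norm_inv_norm_smul {x : E} (hx : x ≠ 0) : ‖‖x‖⁻¹ • x‖ = 1 := by
  rw [norm_smul, norm_inv, norm_norm, inv_mul_cancel₀ (norm_ne_zero_iff.2 hx)]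

theorem norm_smul_inv_norm_smul (x : E) : ‖x‖ • (‖x‖⁻¹ • x) = x := by
  rcases eq_or_ne x 0 with rfl | hx
  · simp
  · rw [smul_smul, mul_inv_cancel₀ (norm_ne_zero_iff.2 hx), one_smul]

theorem mul_norm_normalize_sub_le {x y : E} {R : ℝ} (hR : 0 < R) (hx : R ≤ ‖x‖) (hy : R ≤ ‖y‖) :
    R * ‖‖x‖⁻¹ • x - ‖y‖⁻¹ • y‖ ≤ ‖x - y‖ := by
  have hx0 : x ≠ 0 := norm_pos_iff.1 (hR.trans_le hx)
  have hy0 : y ≠ 0 := norm_pos_iff.1 (hR.trans_le hy)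
  have h := norm_sub_sq_eq_polar (norm_inv_norm_smul hx0) (norm_inv_norm_smul hy0) ‖x‖ ‖y‖
  rw [norm_smul_inv_norm_smul, norm_smul_inv_norm_smul] at h
  refine abs_le_of_sq_le_sq' ?_ (norm_nonneg _) |>.2
  rw [h, mul_pow, sq R]
  have : R * R ≤ ‖x‖ * ‖y‖ := mul_le_mul hx hy hR.le (norm_nonneg _)
  nlinarith [sq_nonneg (‖x‖ - ‖y‖), sq_nonneg ‖‖x‖⁻¹ • x - ‖y‖⁻¹ • y‖]

/-- Adding `e` to a vector of its half-space shortens neither of the two. This is where the sign of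
the last orbital enters. -/
theorem norm_le_norm_add_and_one_le {w e : E} (he : ‖e‖ = 1) (hw : 0 ≤ inner ℝ w e) :
    ‖w‖ ≤ ‖w + e‖ ∧ 1 ≤ ‖w + e‖ := by
  have h := norm_add_sq_real w e
  rw [he] at h
  constructor
  · exact abs_le_of_sq_le_sq' (by nlinarith) (norm_nonneg _) |>.2
  · exact abs_le_of_sq_le_sq' (by nlinarith [sq_nonneg ‖w‖]) (norm_nonneg _) |>.2

/-- The vector `p`, rescaled to length `logCutoff κ ‖p‖` and shifted by `e`. -/
noncomputable def tilt (κ : ℝ) (e p : E) : E := (logCutoff κ ‖p‖ / ‖p‖) • p + e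

/-- The vector of length `‖p‖` in the direction of `tilt κ e p`. -/
noncomputable def tiltMap (κ : ℝ) (e p : E) : E := ‖p‖ • (‖tilt κ e p‖⁻¹ • tilt κ e p)

theorem tilt_eq (κ : ℝ) (e p : E) : tilt κ e p = logCutoff κ ‖p‖ • (‖p‖⁻¹ • p) + e := by
  rw [tilt, smul_smul, div_eq_mul_inv]

theorem inner_normalize_nonneg {e p : E} (hp : 0 ≤ inner ℝ p e) {t : ℝ} (ht : 0 ≤ t) :
    0 ≤ inner ℝ (t • (‖p‖⁻¹ • p)) e := by
  rw [inner_smul_left, inner_smul_left]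
  simp only [conj_trivial]
  positivity

theorem one_le_norm_tilt (κ : ℝ) {e p : E} (he : ‖e‖ = 1) (hp : 0 ≤ inner ℝ p e) :
    1 ≤ ‖tilt κ e p‖ := by
  rw [tilt_eq]
  exact (norm_le_norm_add_and_one_le he (inner_normalize_nonneg hp (logCutoff_nonneg _ _))).2

theorem norm_tilt_le {κ : ℝ} (hκ : 0 < κ) {e : E} (he : ‖e‖ = 1) (p : E) :
    ‖tilt κ e p‖ ≤ κ⁻¹ + 1 := by
  rw [tilt_eq]
  refine (norm_add_le _ _).trans ?_
  rw [he, norm_smul, Real.norm_eq_abs, abs_of_nonneg (logCutoff_nonneg _ _)]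
  gcongr
  refine (mul_le_of_le_one_right (logCutoff_nonneg _ _) ?_).trans (logCutoff_le hκ _)
  rcases eq_or_ne p 0 with rfl | hp
  · simp
  · exact (norm_inv_norm_smul hp).le

theorem norm_tiltMap (κ : ℝ) {e p : E} (he : ‖e‖ = 1) (hp : 0 ≤ inner ℝ p e) :
    ‖tiltMap κ e p‖ = ‖p‖ := by
  have h := one_le_norm_tilt κ he hp
  rw [tiltMap, norm_smul, norm_inv_norm_smul (norm_pos_iff.1 (by linarith)), norm_norm, mul_one]

/-- Radii are unchanged, so only directions matter. Normalization outside a ball of radius `R` is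
`1/R`-Lipschitz. As `|τP + e| ≥ max(τ, 1)`, changing `P` moves the new direction by at most `|P -
Q|`, and changing `τ` by at most the change of `τ`; the logarithmic cutoff bounds the latter,
weighted by `√(|p||q|)`, by `κ` times the radial difference. -/
theorem norm_tiltMap_sub_le {κ : ℝ} (hκ : 0 < κ) {e p q : E} (he : ‖e‖ = 1)
    (hp : 0 ≤ inner ℝ p e) (hq : 0 ≤ inner ℝ q e) :
    ‖tiltMap κ e p - tiltMap κ e q‖ ≤ (1 + κ) * ‖p - q‖ := by
  rcases eq_or_ne p 0 with rfl | hp0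
  · have : tiltMap κ e 0 = 0 := by simp [tiltMap]
    rw [this, zero_sub, zero_sub, norm_neg, norm_neg, norm_tiltMap κ he hq]
    nlinarith [norm_nonneg q]
  rcases eq_or_ne q 0 with rfl | hq0
  · have : tiltMap κ e 0 = 0 := by simp [tiltMap]
    rw [this, sub_zero, sub_zero, norm_tiltMap κ he hp]
    nlinarith [norm_nonneg p]
  have hpn := norm_pos_iff.2 hp0
  have hqn := norm_pos_iff.2 hq0
  have htp := one_le_norm_tilt κ he hp
  have htq := one_le_norm_tilt κ he hq
  have hP := norm_inv_norm_smul hp0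
  have hQ := norm_inv_norm_smul hq0
  have h1 := norm_sub_sq_eq_polar hP hQ ‖p‖ ‖q‖
  rw [norm_smul_inv_norm_smul, norm_smul_inv_norm_smul] at h1
  have h2 := norm_sub_sq_eq_polar (norm_inv_norm_smul (norm_pos_iff.1 (by linarith)))
    (norm_inv_norm_smul (norm_pos_iff.1 (by linarith)) : ‖‖tilt κ e q‖⁻¹ • tilt κ e q‖ = 1) ‖p‖ ‖q‖
    (a := ‖tilt κ e p‖⁻¹ • tilt κ e p)
  set P := ‖p‖⁻¹ • p
  set Q := ‖q‖⁻¹ • q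
  set a := logCutoff κ ‖p‖ with ha
  set b := logCutoff κ ‖q‖ with hb
  have ha0 : 0 ≤ a := logCutoff_nonneg _ _
  have hb0 : 0 ≤ b := logCutoff_nonneg _ _
  have hdir : ‖‖tilt κ e p‖⁻¹ • tilt κ e p - ‖tilt κ e q‖⁻¹ • tilt κ e q‖ ≤ ‖P - Q‖ + |a - b| := by
    -- Intermediate point: the cutoff value of `p` with the direction of `q`.
    set z := a • Q + e with hz
    have hz1 := norm_le_norm_add_and_one_le he (inner_normalize_nonneg hq ha0)
    have hp1 := norm_le_norm_add_and_one_le he (inner_normalize_nonneg hp ha0)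
    have e1 : ‖‖tilt κ e p‖⁻¹ • tilt κ e p - ‖z‖⁻¹ • z‖ ≤ ‖P - Q‖ := by
      rcases eq_or_lt_of_le ha0 with h0 | h0
      · have : tilt κ e p = z := by rw [tilt_eq, hz, ← ha, ← h0]; simp
        rw [this, sub_self, norm_zero]
        positivity
      · have := mul_norm_normalize_sub_le (x := tilt κ e p) (y := z) h0
          (by
            rw [tilt_eq]
            refine le_trans (le_of_eq ?_) hp1.1
            rw [norm_smul, hP, Real.norm_eq_abs, abs_of_pos h0, mul_one])
          (by
            refine le_trans (le_of_eq ?_) hz1.1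
            rw [norm_smul, hQ, Real.norm_eq_abs, abs_of_pos h0, mul_one])
        have e : tilt κ e p - z = a • (P - Q) := by
          rw [tilt_eq, hz, smul_sub]
          abel
        rw [e, norm_smul, Real.norm_eq_abs, abs_of_pos h0] at this
        exact le_of_mul_le_mul_left this h0
    have e2 : ‖‖z‖⁻¹ • z - ‖tilt κ e q‖⁻¹ • tilt κ e q‖ ≤ |a - b| := by
      have := mul_norm_normalize_sub_le one_pos hz1.2 htq
      have e : a • Q + e - tilt κ e q = (a - b) • Q := by
        rw [tilt_eq, sub_smul]
        abel
      rwa [one_mul, e, norm_smul, hQ, mul_one, Real.norm_eq_abs] at this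
    calc _ = ‖(‖tilt κ e p‖⁻¹ • tilt κ e p - ‖z‖⁻¹ • z)
          + (‖z‖⁻¹ • z - ‖tilt κ e q‖⁻¹ • tilt κ e q)‖ := by rw [sub_add_sub_cancel]
      _ ≤ _ := (norm_add_le _ _).trans (add_le_add e1 e2)
  have hcut := sqrt_mul_mul_abs_logCutoff_sub_le hκ hpn hqn
  rw [← ha, ← hb] at hcut
  set w := √(‖p‖ * ‖q‖) with hw
  have hw2 : w ^ 2 = ‖p‖ * ‖q‖ := Real.sq_sqrt (by positivity)
  have hw0 : 0 ≤ w := Real.sqrt_nonneg _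
  set D := ‖‖tilt κ e p‖⁻¹ • tilt κ e p - ‖tilt κ e q‖⁻¹ • tilt κ e q‖
  have hD : 0 ≤ D := norm_nonneg _
  have hwD : w * D ≤ w * ‖P - Q‖ + κ * |‖p‖ - ‖q‖| := by
    calc w * D ≤ w * (‖P - Q‖ + |a - b|) := by gcongr
      _ ≤ _ := by rw [mul_add]; gcongr
  have hsq : (w * D) ^ 2 ≤ (w * ‖P - Q‖ + κ * |‖p‖ - ‖q‖|) ^ 2 := by gcongr
  refine abs_le_of_sq_le_sq' ?_ (by positivity) |>.2
  have hA : ‖tiltMap κ e p - tiltMap κ e q‖ ^ 2 = (‖p‖ - ‖q‖) ^ 2 + (w * D) ^ 2 := by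
    rw [tiltMap, tiltMap, h2, mul_pow, hw2]
  have hB : ‖p - q‖ ^ 2 = (‖p‖ - ‖q‖) ^ 2 + (w * ‖P - Q‖) ^ 2 := by
    rw [h1, mul_pow, hw2]
  rw [mul_pow, hA, hB]
  have hx := sq_abs (‖p‖ - ‖q‖)
  set x := |‖p‖ - ‖q‖|
  set y := w * ‖P - Q‖
  rw [← hx]
  -- This is `x² + (y + κx)² ≤ (1 + κ)² (x² + y²)`.
  nlinarith [mul_nonneg hκ.le (sq_nonneg (x - y)), mul_nonneg (sq_nonneg κ) (sq_nonneg y)]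

/-- Once the cutoff has reached `κ⁻¹`, adding the unit vector `e` to `κ⁻¹ P` turns the direction by
at most `κ`. -/
theorem norm_tiltMap_sub_self_le {κ : ℝ} (hκ : 0 < κ) {e p : E} (he : ‖e‖ = 1)
    (hp : 0 ≤ inner ℝ p e) (hpκ : Real.exp (-κ⁻¹ ^ 2) ≤ ‖p‖) :
    ‖tiltMap κ e p - p‖ ≤ κ * ‖p‖ := by
  have hp0 : p ≠ 0 := norm_pos_iff.1 ((Real.exp_pos _).trans_le hpκ)
  have hP := norm_inv_norm_smul hp0
  set P := ‖p‖⁻¹ • p with hPdef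
  have ht : tilt κ e p = κ⁻¹ • P + e := by rw [tilt_eq, logCutoff_eq hκ hpκ]
  have hκ' : 0 < κ⁻¹ := by positivity
  have hn : ‖κ⁻¹ • P‖ = κ⁻¹ := by
    rw [norm_smul, hP, mul_one, Real.norm_eq_abs, abs_of_pos hκ']
  have h1 := (norm_le_norm_add_and_one_le he (inner_normalize_nonneg hp hκ'.le)).1
  rw [← hPdef, hn, ← ht] at h1
  have h2 := mul_norm_normalize_sub_le (y := κ⁻¹ • P) hκ' h1 hn.ge
  rw [hn, inv_inv, smul_smul, mul_inv_cancel₀ hκ.ne', one_smul] at h2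
  have h3 : tilt κ e p - κ⁻¹ • P = e := by rw [ht]; abel
  rw [h3, he, inv_mul_le_iff₀ hκ, mul_one] at h2
  have h4 : tiltMap κ e p - p = ‖p‖ • (‖tilt κ e p‖⁻¹ • tilt κ e p - P) := by
    rw [smul_sub, hPdef, norm_smul_inv_norm_smul, tiltMap]
  rw [h4, norm_smul, norm_norm, mul_comm]
  gcongr

theorem norm_mul_norm_normalize_sub_le (p : E) {q : E} (hq : q ≠ 0) :
    ‖p‖ * ‖‖p‖⁻¹ • p - ‖q‖⁻¹ • q‖ ≤ 2 * ‖p - q‖ := by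
  have e : ‖p‖ • (‖p‖⁻¹ • p - ‖q‖⁻¹ • q) = (p - q) + (‖q‖ - ‖p‖) • (‖q‖⁻¹ • q) := by
    rw [smul_sub, norm_smul_inv_norm_smul, sub_smul, norm_smul_inv_norm_smul]
    abel
  have h := congrArg norm e
  rw [norm_smul, norm_norm] at h
  rw [h]
  refine (norm_add_le _ _).trans ?_
  rw [norm_smul, norm_inv_norm_smul hq, mul_one, Real.norm_eq_abs, norm_sub_rev p q]
  have := abs_norm_sub_norm_le q p
  linarith

theorem tilt_zero (κ : ℝ) (e : E) : tilt κ e 0 = e := by simp [tilt]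

/-- The first bound controls the gradients of the angles, the second the gradients weighted by
`|u|`, which may be unbounded. Near the origin the linear bound on the cutoff helps, far away its
boundedness. -/
theorem exists_norm_tilt_sub_le {κ : ℝ} (hκ : 0 < κ) (e : E) :
    ∃ C : ℝ, ∀ p q : E, ‖tilt κ e p - tilt κ e q‖ ≤ C * ‖p - q‖ ∧
      ‖p‖ * ‖tilt κ e p - tilt κ e q‖ ≤ C * ‖p - q‖ := by
  set K := κ / Real.exp (-(2 * κ⁻¹ ^ 2)) with hK
  have hK0 : 0 < K := by positivity
  have hτK : ∀ p : E, logCutoff κ ‖p‖ ≤ K * ‖p‖ := fun p => by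
    have := abs_logCutoff_sub_le hκ (norm_nonneg p) le_rfl
    rw [logCutoff_zero hκ, sub_zero, sub_zero, abs_norm] at this
    exact (le_abs_self _).trans this
  have hzero : ∀ p : E, ‖tilt κ e p - tilt κ e 0‖ ≤ logCutoff κ ‖p‖ := fun p => by
    rw [tilt_zero, tilt_eq, add_sub_cancel_right, norm_smul, Real.norm_eq_abs,
      abs_of_nonneg (logCutoff_nonneg _ _)]
    refine mul_le_of_le_one_right (logCutoff_nonneg _ _) ?_
    rcases eq_or_ne p 0 with rfl | hp
    · simp
    · exact (norm_inv_norm_smul hp).le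
  have hκi : 0 < κ⁻¹ := by positivity
  -- The summand `3K` pays for the first bound, the rest for the second.
  refine ⟨3 * K + (4 * κ⁻¹ + 2 * κ), fun p q => ?_⟩
  rcases eq_or_ne q 0 with rfl | hq
  · have h1 := hzero p
    rw [sub_zero]
    refine ⟨(h1.trans (hτK p)).trans ?_, ?_⟩
    · gcongr
      linarith
    · rw [mul_comm]
      gcongr
      refine (h1.trans (logCutoff_le hκ _)).trans ?_
      linarith
  rcases eq_or_ne p 0 with rfl | hp
  · have h1 := hzero q
    rw [zero_sub, norm_neg, norm_zero, zero_mul, norm_sub_rev]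
    refine ⟨(h1.trans (hτK q)).trans ?_, by positivity⟩
    gcongr
    linarith
  have hpn := norm_pos_iff.2 hp
  have hqn := norm_pos_iff.2 hq
  have hpq := norm_mul_norm_normalize_sub_le p hq
  have hnn := abs_norm_sub_norm_le p q
  have htri : ‖tilt κ e p - tilt κ e q‖ ≤ logCutoff κ ‖p‖ * ‖‖p‖⁻¹ • p - ‖q‖⁻¹ • q‖
      + |logCutoff κ ‖p‖ - logCutoff κ ‖q‖| := by
    have e1 : tilt κ e p - tilt κ e q = logCutoff κ ‖p‖ • (‖p‖⁻¹ • p - ‖q‖⁻¹ • q)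
        + (logCutoff κ ‖p‖ - logCutoff κ ‖q‖) • (‖q‖⁻¹ • q) := by
      rw [tilt_eq, tilt_eq, smul_sub, sub_smul]
      abel
    rw [e1]
    refine (norm_add_le _ _).trans (le_of_eq ?_)
    rw [norm_smul, norm_smul, norm_inv_norm_smul hq, mul_one, Real.norm_eq_abs, Real.norm_eq_abs,
      abs_of_nonneg (logCutoff_nonneg _ _)]
  set n := ‖‖p‖⁻¹ • p - ‖q‖⁻¹ • q‖
  have hn0 : 0 ≤ n := norm_nonneg _
  have hD := norm_nonneg (p - q)
  constructor
  · have h1 : logCutoff κ ‖p‖ * n ≤ K * (2 * ‖p - q‖) := by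
      calc _ ≤ K * ‖p‖ * n := by gcongr; exact hτK p
        _ = K * (‖p‖ * n) := by ring
        _ ≤ _ := by gcongr
    have h2 : |logCutoff κ ‖p‖ - logCutoff κ ‖q‖| ≤ K * ‖p - q‖ :=
      (abs_logCutoff_sub_le hκ (norm_nonneg p) (norm_nonneg q)).trans (by gcongr)
    have h3 : 0 ≤ (4 * κ⁻¹ + 2 * κ) * ‖p - q‖ := by positivity
    calc _ ≤ _ := htri
      _ ≤ K * (2 * ‖p - q‖) + K * ‖p - q‖ := add_le_add h1 h2
      _ ≤ _ := by linarith
  · have h1 : ‖p‖ * (logCutoff κ ‖p‖ * n) ≤ κ⁻¹ * (2 * ‖p - q‖) := by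
      calc _ = logCutoff κ ‖p‖ * (‖p‖ * n) := by ring
        _ ≤ κ⁻¹ * (2 * ‖p - q‖) := mul_le_mul (logCutoff_le hκ _) hpq (by positivity) hκi.le
    have h2 : ‖p‖ * |logCutoff κ ‖p‖ - logCutoff κ ‖q‖| ≤ (2 * κ⁻¹ + 2 * κ) * ‖p - q‖ := by
      -- For comparable radii `‖p‖ ≤ 2√(‖p‖‖q‖)` and the logarithmic estimate applies; otherwise
      -- `‖p‖ ≤ 2‖p - q‖` and boundedness of the cutoff suffices.
      rcases le_total ‖p‖ (4 * ‖q‖) with h | h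
      · have h4 : ‖p‖ ≤ 2 * √(‖p‖ * ‖q‖) := by
          have : ‖p‖ / 2 ≤ √(‖p‖ * ‖q‖) := Real.le_sqrt_of_sq_le (by nlinarith)
          linarith
        have h5 := sqrt_mul_mul_abs_logCutoff_sub_le hκ hpn hqn
        calc _ ≤ 2 * √(‖p‖ * ‖q‖) * |logCutoff κ ‖p‖ - logCutoff κ ‖q‖| := by gcongr
          _ = 2 * (√(‖p‖ * ‖q‖) * |logCutoff κ ‖p‖ - logCutoff κ ‖q‖|) := by ring
          _ ≤ 2 * (κ * ‖p - q‖) := by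
            exact mul_le_mul_of_nonneg_left
              (h5.trans (mul_le_mul_of_nonneg_left hnn hκ.le)) (by norm_num)
          _ ≤ _ := by nlinarith [mul_nonneg hκi.le hD]
      · have h4 : |logCutoff κ ‖p‖ - logCutoff κ ‖q‖| ≤ κ⁻¹ := by
          rw [abs_le]
          constructor
          · linarith [logCutoff_nonneg κ ‖p‖, logCutoff_le hκ ‖q‖]
          · linarith [logCutoff_nonneg κ ‖q‖, logCutoff_le hκ ‖p‖]
        have h5 : ‖p‖ ≤ 2 * ‖p - q‖ := by
          have := norm_sub_norm_le p q
          linarith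
        calc _ ≤ (2 * ‖p - q‖) * κ⁻¹ := mul_le_mul h5 h4 (abs_nonneg _) (by positivity)
          _ ≤ _ := by nlinarith [mul_nonneg hκ.le hD]
    have h3 : 0 ≤ 3 * K * ‖p - q‖ := by positivity
    calc _ ≤ ‖p‖ * (logCutoff κ ‖p‖ * n + |logCutoff κ ‖p‖ - logCutoff κ ‖q‖|) := by gcongr
      _ ≤ κ⁻¹ * (2 * ‖p - q‖) + (2 * κ⁻¹ + 2 * κ) * ‖p - q‖ := by
        rw [mul_add]
        exact add_le_add h1 h2
      _ ≤ _ := by linarith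

end Direction

/-! ### Spherical angles. -/

theorem abs_arctan_sub_le (x y : ℝ) : |Real.arctan x - Real.arctan y| ≤ |x - y| := by
  have h := convex_univ.norm_image_sub_le_of_norm_deriv_le (f := Real.arctan) (C := 1)
    (fun z _ => Real.differentiableAt_arctan z) (fun z _ => by
      rw [Real.deriv_arctan, Real.norm_eq_abs, abs_of_nonneg (by positivity)]
      rw [div_le_one (by positivity)]
      nlinarith [sq_nonneg z]) (Set.mem_univ y) (Set.mem_univ x)
  simpa using h

/-- The vector `v` with its first `k` coordinates replaced by `0`. -/
noncomputable def tail {N : ℕ} (k : ℕ) (v : EuclideanSpace ℝ (Fin N)) : EuclideanSpace ℝ (Fin N) :=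
  WithLp.toLp 2 fun j => if k ≤ j then v j else 0

theorem norm_tail_sq {N : ℕ} (k : ℕ) (v : EuclideanSpace ℝ (Fin N)) :
    ‖tail k v‖ ^ 2 = ∑ j : Fin N, if k ≤ (j : ℕ) then v j ^ 2 else 0 := by
  rw [EuclideanSpace.real_norm_sq_eq]
  refine Finset.sum_congr rfl fun j _ => ?_
  simp only [tail]
  split_ifs <;> simp

theorem tail_zero {N : ℕ} (v : EuclideanSpace ℝ (Fin N)) : tail 0 v = v := by
  ext j
  simp [tail]

theorem norm_tail_sq_eq {N : ℕ} (k : Fin N) (v : EuclideanSpace ℝ (Fin N)) :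
    ‖tail k v‖ ^ 2 = v k ^ 2 + ‖tail (k + 1) v‖ ^ 2 := by
  rw [norm_tail_sq, norm_tail_sq, ← Finset.sum_erase_add _ _ (Finset.mem_univ k),
    ← Finset.sum_erase_add (a := k) _ (fun j : Fin N => if (k : ℕ) + 1 ≤ j then v j ^ 2 else 0)
      (Finset.mem_univ k)]
  have : ∑ x ∈ Finset.univ.erase k, (if (k : ℕ) ≤ x then v x ^ 2 else 0)
      = ∑ x ∈ Finset.univ.erase k, if (k : ℕ) + 1 ≤ x then v x ^ 2 else 0 := by
    refine Finset.sum_congr rfl fun j hj => ?_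
    have hne : (j : ℕ) ≠ k := fun h => Finset.ne_of_mem_erase hj (Fin.ext h)
    have : (k : ℕ) ≤ j ↔ (k : ℕ) + 1 ≤ j := by omega
    simp only [this]
  rw [this]
  simp
  ring

theorem abs_norm_tail_sub_le {N : ℕ} (k : ℕ) (v w : EuclideanSpace ℝ (Fin N)) :
    |‖tail k v‖ - ‖tail k w‖| ≤ ‖v - w‖ := by
  have e : tail k v - tail k w = tail k (v - w) := by
    ext j
    simp only [tail, PiLp.sub_apply]
    split_ifs <;> simp
  refine (abs_norm_sub_norm_le _ _).trans ?_
  rw [e]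
  refine abs_le_of_sq_le_sq' ?_ (norm_nonneg _) |>.2
  rw [norm_tail_sq, EuclideanSpace.real_norm_sq_eq]
  refine Finset.sum_le_sum fun j _ => ?_
  split_ifs
  · exact le_rfl
  · exact sq_nonneg _

theorem one_le_norm_tail {N k : ℕ} {v : EuclideanSpace ℝ (Fin N)} {l : Fin N} (hl : 1 ≤ v l)
    (hk : k ≤ l) : 1 ≤ ‖tail k v‖ := by
  have h : v l ^ 2 ≤ ‖tail k v‖ ^ 2 := by
    rw [norm_tail_sq]
    refine le_trans (le_of_eq ?_) (Finset.single_le_sum (f := fun j : Fin N =>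
      if k ≤ (j : ℕ) then v j ^ 2 else 0) (fun j _ => ?_) (Finset.mem_univ l))
    · simp [hk]
    · dsimp only
      split_ifs
      · exact sq_nonneg _
      · exact le_rfl
  exact hl.trans (abs_le_of_sq_le_sq' h (norm_nonneg _)).2

/-- The `k`-th spherical angle of `v`. -/
noncomputable def polarAngle {N : ℕ} (k : Fin N) (v : EuclideanSpace ℝ (Fin N)) : ℝ :=
  Real.arctan (v k / ‖tail (k + 1) v‖)

theorem measurable_polarAngle {N : ℕ} (k : Fin N) : Measurable (polarAngle k) := by
  have h1 : Continuous fun v : EuclideanSpace ℝ (Fin N) => ‖tail ((k : ℕ) + 1) v‖ := by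
    refine (LipschitzWith.of_dist_le' (K := 1) fun v w => ?_).continuous
    rw [Real.dist_eq, dist_eq_norm, one_mul]
    exact abs_norm_tail_sub_le _ v w
  have h2 : Measurable fun v : EuclideanSpace ℝ (Fin N) => v k := by fun_prop
  exact Real.continuous_arctan.measurable.comp (h2.div h1.measurable)

theorem abs_polarAngle_le {N : ℕ} (k : Fin N) (v : EuclideanSpace ℝ (Fin N)) :
    |polarAngle k v| ≤ Real.pi / 2 :=
  abs_le.2 ⟨(Real.neg_pi_div_two_lt_arctan _).le, (Real.arctan_lt_pi_div_two _).le⟩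

theorem cos_polarAngle {N : ℕ} {k : Fin N} {v : EuclideanSpace ℝ (Fin N)}
    (h : 1 ≤ ‖tail (k + 1) v‖) :
    Real.cos (polarAngle k v) = ‖tail (k + 1) v‖ / ‖tail k v‖ ∧
      Real.sin (polarAngle k v) = v k / ‖tail k v‖ := by
  set t := ‖tail (k + 1) v‖ with ht
  have ht0 : 0 < t := by linarith
  have hsq := norm_tail_sq_eq k v
  rw [← ht] at hsq
  have h1 : √(1 + (v k / t) ^ 2) = ‖tail k v‖ / t := by
    rw [Real.sqrt_eq_iff_mul_self_eq (by positivity) (by positivity)]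
    field_simp
    linarith
  have hpos : 0 < ‖tail k v‖ := by
    have : 0 < ‖tail k v‖ ^ 2 := by rw [hsq]; positivity
    exact lt_of_le_of_ne (norm_nonneg _) fun h0 => by simp [← h0] at this
  rw [polarAngle, ← ht, Real.cos_arctan, Real.sin_arctan, h1]
  constructor <;> field_simp

/-- Tails of length at least `1` keep the denominators away from zero, so the ratio inside the
arctangent is Lipschitz on bounded sets. -/
theorem abs_polarAngle_sub_le {N : ℕ} {k : Fin N} {v w : EuclideanSpace ℝ (Fin N)}
    (hv : 1 ≤ ‖tail (k + 1) v‖) (hw : 1 ≤ ‖tail (k + 1) w‖) :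
    |polarAngle k v - polarAngle k w| ≤ (1 + ‖w‖) * ‖v - w‖ := by
  refine (abs_arctan_sub_le _ _).trans ?_
  have ht := abs_norm_tail_sub_le ((k : ℕ) + 1) v w
  set s := ‖tail ((k : ℕ) + 1) v‖ with hs
  set t := ‖tail ((k : ℕ) + 1) w‖ with ht'
  have hs0 : 0 < s := by linarith
  have ht0 : 0 < t := by linarith
  have h1 : |v k - w k| ≤ ‖v - w‖ := by simpa using PiLp.norm_apply_le (v - w) k
  have h2 : |w k| ≤ ‖w‖ := by simpa using PiLp.norm_apply_le w k
  have e : v k / s - w k / t = (v k - w k) / s - (w k / t) * ((s - t) / s) := by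
    field_simp
    ring
  rw [e]
  refine (abs_sub _ _).trans ?_
  rw [abs_mul, abs_div, abs_div, abs_div, abs_of_pos hs0, abs_of_pos ht0, add_mul, one_mul]
  refine add_le_add ((div_le_self (abs_nonneg _) hv).trans h1) ?_
  exact mul_le_mul ((div_le_self (abs_nonneg _) hw).trans h2)
    ((div_le_self (abs_nonneg _) hv).trans ht) (by positivity) (norm_nonneg _)

/-- At `p = 0` the tilted vector is `e`, so the angles vanish there and are bounded by a multiple of
`|p|`, which puts them in `L²`. -/
theorem polarAngle_single {N : ℕ} {k l : Fin N} (h : k ≠ l) :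
    polarAngle k (EuclideanSpace.single l (1 : ℝ)) = 0 := by
  simp [polarAngle, h]

/-- The orbitals built from the spherical angles of a vector field `v` are the components of the
field of length `|u| / √2` in direction `v`. -/
theorem angleOrbital_polarAngle {d N : ℕ} (u : Space d → ℝ) (v : Space d → EuclideanSpace ℝ (Fin N))
    {l : Fin N} (hl : (l : ℕ) + 1 = N) {x : Space d} (hv : 1 ≤ v x l) (k : Fin N) :
    angleOrbital u (fun (j : Fin (N - 1)) y => polarAngle (⟨j, by omega⟩ : Fin N) (v y)) k x
      = |u x| / √2 * (v x k / ‖v x‖) := by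
  set Θ : Fin (N - 1) → Space d → ℝ := fun j y => polarAngle (⟨j, by omega⟩ : Fin N) (v y) with hΘ
  have htail : ∀ j : ℕ, j ≤ l → 1 ≤ ‖tail j (v x)‖ := fun j hj => one_le_norm_tail hv hj
  -- Each cosine is a ratio of consecutive tail lengths, so the product telescopes.
  have hamp : ∀ j : ℕ, j ≤ l → amplitude u Θ j x = |u x| / √2 * (‖tail j (v x)‖ / ‖v x‖) := by
    intro j
    induction j with
    | zero =>
      intro _
      have := htail 0 (by omega)
      rw [tail_zero] at this
      rw [amplitude_zero, tail_zero, div_self (by linarith : ‖v x‖ ≠ 0), mul_one]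
    | succ j ih =>
      intro hj
      have hjN : j < N - 1 := by omega
      have h1 := htail j (by omega)
      rw [amplitude_succ u Θ hjN, ih (by omega)]
      have h2 : Real.cos (Θ ⟨j, hjN⟩ x) = ‖tail (j + 1) (v x)‖ / ‖tail j (v x)‖ :=
        (cos_polarAngle (k := ⟨j, by omega⟩) (htail (j + 1) hj)).1
      rw [h2]
      have : ‖tail j (v x)‖ ≠ 0 := by linarith
      field_simp
  by_cases hk : (k : ℕ) < N - 1
  · simp only [angleOrbital, hk, dite_true]
    have h1 := htail k (by omega)
    have h2 : Real.sin (Θ ⟨k, hk⟩ x) = v x k / ‖tail k (v x)‖ :=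
      (cos_polarAngle (k := k) (htail (k + 1) (by omega))).2
    rw [h2, hamp k (by omega)]
    have : ‖tail k (v x)‖ ≠ 0 := by linarith
    field_simp
  · simp only [angleOrbital, hk, dite_false]
    have hkl : k = l := Fin.ext (by omega)
    subst hkl
    have h0 : tail ((k : ℕ) + 1) (v x) = 0 := by
      ext j
      simp only [tail, PiLp.zero_apply]
      rw [if_neg (by omega)]
    have h1 := norm_tail_sq_eq k (v x)
    rw [h0, norm_zero, zero_pow (by norm_num), add_zero] at h1
    have h2 : ‖tail k (v x)‖ = v x k :=
      (pow_left_inj₀ (norm_nonneg _) (by linarith) (by norm_num)).1 h1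
    rw [hamp k le_rfl, h2]

/-! ### Angle fields of tilted orbitals: regularity and energy. -/

/-- The orbitals as one vector field. -/
noncomputable def orbitalVector {d N : ℕ} (Φ : Fin N → Space d → ℝ) (x : Space d) :
    EuclideanSpace ℝ (Fin N) :=
  WithLp.toLp 2 fun k => Φ k x

/-- The spherical angles of the tilted field of orbitals. -/
noncomputable def tiltAngle {d N : ℕ} (κ : ℝ) (l : Fin N) (Φ : Fin N → Space d → ℝ)
    (j : Fin (N - 1)) (x : Space d) : ℝ :=
  polarAngle (⟨j, by omega⟩ : Fin N) (tilt κ (EuclideanSpace.single l 1) (orbitalVector Φ x))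

theorem measurable_tilt {N : ℕ} (κ : ℝ) (e : EuclideanSpace ℝ (Fin N)) :
    Measurable (tilt κ e) := by
  have h : Measurable (logCutoff κ) := by
    unfold logCutoff
    exact measurable_const.max (measurable_const.min
      ((Real.measurable_log.comp (measurable_id.div_const _)).const_mul κ))
  exact (((h.comp measurable_norm).div measurable_norm).smul measurable_id).add_const e

theorem aemeasurable_orbitalVector {d N : ℕ} {Φ : Fin N → Space d → ℝ}
    (h : ∀ k, AEStronglyMeasurable (Φ k)) : AEMeasurable (orbitalVector Φ) :=
  (WithLp.measurable_toLp 2 _).comp_aemeasurable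
    (aemeasurable_pi_lambda _ fun k => (h k).aemeasurable)

theorem aemeasurable_tiltAngle {d N : ℕ} (κ : ℝ) (l : Fin N) {Φ : Fin N → Space d → ℝ}
    (h : ∀ k, AEStronglyMeasurable (Φ k)) (j : Fin (N - 1)) : AEMeasurable (tiltAngle κ l Φ j) :=
  ((measurable_polarAngle _).comp (measurable_tilt κ _)).comp_aemeasurable
    (aemeasurable_orbitalVector h)

theorem sum_enorm_sq_diff_eq {d N : ℕ} (Φ : Fin N → Space d → ℝ) (s : ℝ) (x y : Space d) :
    ∑ k, ‖s⁻¹ * (Φ k y - Φ k x)‖ₑ ^ 2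
      = ‖s⁻¹ • (orbitalVector Φ y - orbitalVector Φ x)‖ₑ ^ 2 := by
  rw [enorm_sq_eq_sum]
  rfl

/-- Integrates a pointwise bound by differences of the orbital vector into a bound by the difference
energies of all orbitals. -/
theorem sum_lintegral_le {d N : ℕ} {Φ : Fin N → Space d → ℝ}
    (hΦ : ∀ k, AEStronglyMeasurable (Φ k)) {s : ℝ} {G : Fin d → Space d → ℝ≥0∞} {c : ℝ≥0∞}
    (hc : c ≠ ⊤)
    (h : ∀ i, ∀ᵐ x, G i x ≤ c * ‖s⁻¹ •
      (orbitalVector Φ (x + s • EuclideanSpace.single i 1) - orbitalVector Φ x)‖ₑ ^ 2) :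
    ∑ i, ∫⁻ x, G i x ≤ c * ∑ k, diffEnergy s (Φ k) := by
  simp only [diffEnergy]
  rw [Finset.sum_comm, Finset.mul_sum]
  refine Finset.sum_le_sum fun i _ => ?_
  have hm : ∀ k, AEMeasurable fun x =>
      ‖s⁻¹ * (Φ k (x + s • EuclideanSpace.single i 1) - Φ k x)‖ₑ ^ 2 := fun k =>
    ((((hΦ k).comp_measurePreserving (measurePreserving_add_right volume
      (s • EuclideanSpace.single i (1 : ℝ)))).sub (hΦ k)).const_mul s⁻¹).enorm.pow_const 2
  rw [← lintegral_finsetSum' _ fun k _ => hm k, ← lintegral_const_mul' _ _ hc]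
  refine lintegral_mono_ae ?_
  filter_upwards [h i] with x hx
  refine hx.trans (le_of_eq ?_)
  rw [← sum_enorm_sq_diff_eq]

theorem enorm_sq_smul_le {E F : Type*} [NormedAddCommGroup E] [NormedSpace ℝ E]
    [NormedAddCommGroup F] [NormedSpace ℝ F] {a : E} {b : F} {C : ℝ} (hC : 0 ≤ C)
    (h : ‖a‖ ≤ C * ‖b‖) (s : ℝ) : ‖s • a‖ₑ ^ 2 ≤ ENNReal.ofReal C ^ 2 * ‖s • b‖ₑ ^ 2 := by
  rw [← mul_pow]
  gcongr
  rw [enorm_smul, enorm_smul, ← ofReal_norm a, ← ofReal_norm b]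
  calc ‖s‖ₑ * ENNReal.ofReal ‖a‖ ≤ ‖s‖ₑ * ENNReal.ofReal (C * ‖b‖) := by gcongr
    _ = _ := by rw [ENNReal.ofReal_mul hC]; ring

section

variable {d : ℕ} {u : Space d → ℝ} {Φ : Fin (numOrbitals u) → Space d → ℝ}
  {l : Fin (numOrbitals u)}

theorem norm_orbitalVector {d N : ℕ} {Φ : Fin N → Space d → ℝ} {x : Space d} {a : ℝ}
    (h : 2 * ∑ k, Φ k x ^ 2 = a ^ 2) : ‖orbitalVector Φ x‖ = |a| / √2 := by
  rw [EuclideanSpace.norm_eq]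
  simp only [orbitalVector, Real.norm_eq_abs, sq_abs]
  have e : ∑ k, Φ k x ^ 2 = |a| ^ 2 / 2 := by rw [sq_abs]; linarith
  rw [e, Real.sqrt_div (sq_nonneg _), Real.sqrt_sq (abs_nonneg _)]

theorem inner_orbitalVector_single {d N : ℕ} (Φ : Fin N → Space d → ℝ) (l : Fin N)
    (x : Space d) : inner ℝ (orbitalVector Φ x) (EuclideanSpace.single l 1) = Φ l x := by
  simp [EuclideanSpace.inner_single_right, orbitalVector]

theorem one_le_tilt_apply {N : ℕ} (κ : ℝ) {l : Fin N} {p : EuclideanSpace ℝ (Fin N)}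
    (hp : 0 ≤ p l) : 1 ≤ tilt κ (EuclideanSpace.single l (1 : ℝ)) p l := by
  have : 0 ≤ logCutoff κ ‖p‖ / ‖p‖ * p l :=
    mul_nonneg (div_nonneg (logCutoff_nonneg _ _) (norm_nonneg _)) hp
  simpa [tilt] using this

theorem angleOrbital_tiltAngle {d N : ℕ} (κ : ℝ) {l : Fin N} (hl : (l : ℕ) + 1 = N)
    {u : Space d → ℝ} {Φ : Fin N → Space d → ℝ} {x : Space d} (hx : 0 ≤ Φ l x)
    (hs : 2 * ∑ k, Φ k x ^ 2 = u x ^ 2) (k : Fin N) :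
    angleOrbital u (tiltAngle κ l Φ) k x
      = tiltMap κ (EuclideanSpace.single l 1) (orbitalVector Φ x) k := by
  have h := angleOrbital_polarAngle u
    (fun y => tilt κ (EuclideanSpace.single l 1) (orbitalVector Φ y)) hl
    (one_le_tilt_apply κ (p := orbitalVector Φ x) hx) k
  refine h.trans ?_
  rw [← norm_orbitalVector hs, tiltMap]
  simp only [PiLp.smul_apply, smul_eq_mul]
  ring

theorem exists_tiltAngle_sub_le {d N : ℕ} {κ : ℝ} (hκ : 0 < κ) {l : Fin N}
    (hl : (l : ℕ) + 1 = N) (Φ : Fin N → Space d → ℝ) :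
    ∃ C : ℝ, 0 ≤ C ∧ (∀ j x, 0 ≤ Φ l x → |tiltAngle κ l Φ j x| ≤ C * ‖orbitalVector Φ x‖) ∧
      ∀ j x y, 0 ≤ Φ l x → 0 ≤ Φ l y →
        |tiltAngle κ l Φ j y - tiltAngle κ l Φ j x|
          ≤ C * ‖orbitalVector Φ y - orbitalVector Φ x‖ ∧
        ‖orbitalVector Φ x‖ * |tiltAngle κ l Φ j y - tiltAngle κ l Φ j x|
          ≤ C * ‖orbitalVector Φ y - orbitalVector Φ x‖ := by
  set e : EuclideanSpace ℝ (Fin N) := EuclideanSpace.single l 1 with he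
  have hen : ‖e‖ = 1 := by simp [he]
  obtain ⟨C, hC⟩ := exists_norm_tilt_sub_le hκ e
  have hC0 : 0 ≤ C := by
    have := (norm_nonneg _).trans (hC e 0).1
    rwa [sub_zero, hen, mul_one] at this
  have hκi : 0 < κ⁻¹ := by positivity
  have key : ∀ (j : Fin (N - 1)) (p q : EuclideanSpace ℝ (Fin N)), 0 ≤ p l → 0 ≤ q l →
      |polarAngle (⟨j, by omega⟩ : Fin N) (tilt κ e p)
        - polarAngle (⟨j, by omega⟩ : Fin N) (tilt κ e q)|
        ≤ (1 + (κ⁻¹ + 1)) * ‖tilt κ e p - tilt κ e q‖ := by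
    intro j p q hp hq
    refine (abs_polarAngle_sub_le
      (one_le_norm_tail (one_le_tilt_apply κ hp) (by dsimp only; omega))
      (one_le_norm_tail (one_le_tilt_apply κ hq) (by dsimp only; omega))).trans ?_
    gcongr
    exact norm_tilt_le hκ hen q
  refine ⟨(1 + (κ⁻¹ + 1)) * C, by positivity, fun j x hx => ?_, fun j x y hx hy => ⟨?_, ?_⟩⟩
  · have h1 := key j (orbitalVector Φ x) 0 hx (by simp)
    rw [tilt_zero, he, polarAngle_single (by intro h; simp [Fin.ext_iff] at h; omega), sub_zero,
      ← he] at h1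
    refine h1.trans ?_
    rw [mul_assoc]
    gcongr
    have h2 := (hC (orbitalVector Φ x) 0).1
    rwa [tilt_zero, sub_zero] at h2
  · refine (key j _ _ hy hx).trans ?_
    rw [mul_assoc]
    gcongr
    exact (hC _ _).1
  · have h1 := (hC (orbitalVector Φ x) (orbitalVector Φ y)).2
    rw [norm_sub_rev (orbitalVector Φ x), norm_sub_rev (tilt κ e (orbitalVector Φ x))] at h1
    calc _ ≤ ‖orbitalVector Φ x‖ * ((1 + (κ⁻¹ + 1)) *
          ‖tilt κ e (orbitalVector Φ y) - tilt κ e (orbitalVector Φ x)‖) := by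
          gcongr
          exact key j _ _ hy hx
      _ = (1 + (κ⁻¹ + 1)) * (‖orbitalVector Φ x‖ *
          ‖tilt κ e (orbitalVector Φ y) - tilt κ e (orbitalVector Φ x)‖) := by ring
      _ ≤ (1 + (κ⁻¹ + 1)) * (C * ‖orbitalVector Φ y - orbitalVector Φ x‖) := by gcongr
      _ = _ := by ring

theorem ae_and_shift {P : Space d → Prop} (h : ∀ᵐ x, P x) (v : Space d) :
    ∀ᵐ x, P x ∧ P (x + v) :=
  h.and ((measurePreserving_add_right volume v).quasiMeasurePreserving.ae h)

theorem kineticEnergy_ne_top_of_mem (hΦ : Φ ∈ orbitalSetPlus u) : kineticEnergy Φ ≠ ⊤ :=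
  (ENNReal.sum_lt_top.2 fun k _ => (hΦ.1.1 k).dirichletEnergy_ne_top.lt_top).ne

theorem memLp_tiltAngle (hu : MemLp u 2) {κ : ℝ} (hκ : 0 < κ) (hl : (l : ℕ) + 1 = numOrbitals u)
    (hΦ : Φ ∈ orbitalSetPlus u) (j : Fin (numOrbitals u - 1)) :
    MemLp (tiltAngle κ l Φ j) 2 volume := by
  obtain ⟨C, hC0, hC, -⟩ := exists_tiltAngle_sub_le hκ hl Φ
  refine MemLp.mono (hu.const_mul (C / √2))
    (aemeasurable_tiltAngle κ l (fun k => (hΦ.1.1 k).1.1) j).aestronglyMeasurable ?_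
  filter_upwards [hΦ.2 l hl, hΦ.1.2.2.2] with x h1 h2
  have h3 := hC j x h1
  rw [norm_orbitalVector h2] at h3
  rw [Real.norm_eq_abs, Real.norm_eq_abs, abs_mul, abs_of_nonneg (by positivity : 0 ≤ C / √2)]
  refine h3.trans (le_of_eq ?_)
  ring

theorem tiltAngle_mem_angleSetPlus (hu : MemLp u 2) {κ : ℝ} (hκ : 0 < κ)
    (hl : (l : ℕ) + 1 = numOrbitals u) (hΦ : Φ ∈ orbitalSetPlus u) :
    tiltAngle κ l Φ ∈ angleSetPlus u := by
  refine ⟨fun j => ?_, fun j => Eventually.of_forall fun x => abs_polarAngle_le _ _⟩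
  obtain ⟨C, hC0, -, hC⟩ := exists_tiltAngle_sub_le hκ hl Φ
  have hm := memLp_tiltAngle hu hκ hl hΦ j
  have hE := kineticEnergy_ne_top_of_mem hΦ
  have hmeas : ∀ k, AEStronglyMeasurable (Φ k) := fun k => (hΦ.1.1 k).1.1
  have hΦ2 : ∀ k, MemLp (Φ k) 2 volume := fun k => (hΦ.1.1 k).1
  have hCtop : ENNReal.ofReal C ^ 2 ≠ ⊤ := by simp
  have hBtop : ENNReal.ofReal C ^ 2 * kineticEnergy Φ ≠ ⊤ := ENNReal.mul_ne_top hCtop hE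
  have hH1 : MemH1 (tiltAngle κ l Φ j) := by
    refine memH1_of_diffEnergy_le hm hBtop fun s hs => ?_
    refine (sum_lintegral_le hmeas hCtop fun i => ?_).trans
      (by gcongr; exact sum_diffEnergy_le hΦ2 hs)
    filter_upwards [ae_and_shift (hΦ.2 l hl) (s • EuclideanSpace.single i (1 : ℝ))] with x hx
    exact enorm_sq_smul_le hC0 (hC j x _ hx.1 hx.2).1 s⁻¹
  obtain ⟨-, g, hg, hg2⟩ := hH1
  refine ⟨fun K _ => hm.restrict K, g, hg, fun K _ => hg2.restrict K, ?_⟩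
  -- The length of the orbital vector is `|u| / √2`, which dominates every amplitude, so this single
  -- weight suffices.
  have hw : MemLp (fun x => ‖orbitalVector Φ x‖ • g x) 2 volume := by
    refine hg.memLp_smul hm hg2 (aemeasurable_orbitalVector hmeas).norm.aestronglyMeasurable hBtop
      fun s i hs => ?_
    have hsum := sum_lintegral_le (s := s) hmeas hCtop (G := fun i x => ‖‖orbitalVector Φ x‖ *
      (s⁻¹ * (tiltAngle κ l Φ j (x + s • EuclideanSpace.single i 1)
        - tiltAngle κ l Φ j x))‖ₑ ^ 2) fun i => by
      filter_upwards [ae_and_shift (hΦ.2 l hl) (s • EuclideanSpace.single i (1 : ℝ))] with x hx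
      have h1 := (hC j x _ hx.1 hx.2).2
      have h2 := enorm_sq_smul_le (a := ‖orbitalVector Φ x‖ *
        (tiltAngle κ l Φ j (x + s • EuclideanSpace.single i 1) - tiltAngle κ l Φ j x))
        (b := orbitalVector Φ (x + s • EuclideanSpace.single i 1) - orbitalVector Φ x) hC0
        (by rwa [norm_mul, norm_norm, Real.norm_eq_abs]) s⁻¹
      refine le_trans (le_of_eq ?_) h2
      rw [smul_eq_mul]
      congr 2
      ring
    refine le_trans ?_ (hsum.trans (by gcongr; exact sum_diffEnergy_le hΦ2 hs))
    exact Finset.single_le_sum (f := fun i : Fin d => ∫⁻ x, ‖‖orbitalVector Φ x‖ *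
      (s⁻¹ * (tiltAngle κ l Φ j (x + s • EuclideanSpace.single i 1)
        - tiltAngle κ l Φ j x))‖ₑ ^ 2) (fun _ _ => zero_le) (Finset.mem_univ i)
  have hΘm : ∀ i, AEStronglyMeasurable (tiltAngle κ l Φ i) := fun i =>
    (aemeasurable_tiltAngle κ l hmeas i).aestronglyMeasurable
  have hamp : AEStronglyMeasurable (amplitude u (tiltAngle κ l Φ) j) := by
    refine (hu.1.aemeasurable.norm.div_const _).aestronglyMeasurable.mul ?_
    refine Finset.aestronglyMeasurable_fun_prod _ fun i _ => ?_
    exact Real.continuous_cos.comp_aestronglyMeasurable (hΘm i)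
  refine hw.mono (hamp.smul hg2.1) ?_
  filter_upwards [hΦ.1.2.2.2] with x hx
  rw [norm_smul, norm_smul, norm_norm, norm_orbitalVector hx]
  gcongr
  exact abs_amplitude_le _ _ _ _

/-- The new orbital vector is the image of the old one under a `(1 + κ)`-Lipschitz map, so squared
difference quotients grow by at most `(1 + κ)²`. -/
theorem angleEnergy_tiltAngle_le (hu : MemLp u 2) {κ : ℝ} (hκ : 0 < κ)
    (hl : (l : ℕ) + 1 = numOrbitals u) (hΦ : Φ ∈ orbitalSetPlus u) :
    (∀ k, MemH1 (angleOrbital u (tiltAngle κ l Φ) k)) ∧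
    angleEnergy u (tiltAngle κ l Φ) ≤ ENNReal.ofReal (1 + κ) ^ 2 * kineticEnergy Φ := by
  have hE := kineticEnergy_ne_top_of_mem hΦ
  have hmeas : ∀ k, AEStronglyMeasurable (Φ k) := fun k => (hΦ.1.1 k).1.1
  set e : EuclideanSpace ℝ (Fin (numOrbitals u)) := EuclideanSpace.single l 1 with he
  have hen : ‖e‖ = 1 := by simp [he]
  set Ψ := angleOrbital (N := numOrbitals u) u (tiltAngle κ l Φ) with hΨ
  have hΨae : ∀ᵐ x, 0 ≤ Φ l x ∧ orbitalVector Ψ x = tiltMap κ e (orbitalVector Φ x) := by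
    filter_upwards [hΦ.2 l hl, hΦ.1.2.2.2] with x h1 h2
    refine ⟨h1, ?_⟩
    ext k
    exact angleOrbital_tiltAngle κ hl h1 h2 k
  have hQm : AEMeasurable fun x => tiltMap κ e (orbitalVector Φ x) := by
    have h1 : Measurable (tiltMap κ e) :=
      measurable_norm.smul ((measurable_tilt κ e).norm.inv.smul (measurable_tilt κ e))
    exact h1.comp_aemeasurable (aemeasurable_orbitalVector hmeas)
  have hΨm : ∀ k, AEStronglyMeasurable (Ψ k) := fun k => by
    have h1 : AEMeasurable fun x => tiltMap κ e (orbitalVector Φ x) k :=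
      (by fun_prop : Measurable fun p : EuclideanSpace ℝ (Fin (numOrbitals u)) => p k)
        |>.comp_aemeasurable hQm
    refine (h1.congr ?_).aestronglyMeasurable
    filter_upwards [hΨae] with x hx
    rw [← hx.2]
    rfl
  have hΨ2 : ∀ k, MemLp (Ψ k) 2 volume := fun k =>
    hu.mono (hΨm k) (Eventually.of_forall fun x => abs_le_of_sum_sq
      (two_mul_sum_angleOrbital_sq (by omega) u (tiltAngle κ l Φ) x) k)
  have hctop : ENNReal.ofReal (1 + κ) ^ 2 ≠ ⊤ := by simp
  refine kineticEnergy_le_of_sum_diffEnergy_le hΨ2 (ENNReal.mul_ne_top hctop hE) fun s hs => ?_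
  have h1 : ∑ k, diffEnergy s (Ψ k) = ∑ i : Fin d, ∫⁻ x, ‖s⁻¹ •
      (orbitalVector Ψ (x + s • EuclideanSpace.single i 1) - orbitalVector Ψ x)‖ₑ ^ 2 := by
    simp only [diffEnergy]
    rw [Finset.sum_comm]
    refine Finset.sum_congr rfl fun i _ => ?_
    have hm : ∀ k, AEMeasurable fun x =>
        ‖s⁻¹ * (Ψ k (x + s • EuclideanSpace.single i 1) - Ψ k x)‖ₑ ^ 2 := fun k =>
      ((((hΨm k).comp_measurePreserving (measurePreserving_add_right volume
        (s • EuclideanSpace.single i (1 : ℝ)))).sub (hΨm k)).const_mul s⁻¹).enorm.pow_const 2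
    rw [← lintegral_finsetSum' _ fun k _ => hm k]
    simp only [← sum_enorm_sq_diff_eq]
  rw [h1]
  refine (sum_lintegral_le hmeas hctop fun i => ?_).trans
    (by gcongr; exact sum_diffEnergy_le (fun k => (hΦ.1.1 k).1) hs)
  filter_upwards [ae_and_shift hΨae (s • EuclideanSpace.single i (1 : ℝ))] with x hx
  rw [hx.1.2, hx.2.2]
  refine enorm_sq_smul_le (by positivity) ?_ _
  refine norm_tiltMap_sub_le hκ hen ?_ ?_
  · rw [he, inner_orbitalVector_single]
    exact hx.2.1
  · rw [he, inner_orbitalVector_single]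
    exact hx.1.1

end

/-! ### Removing the tilt: the upper bound and the limit. -/

/-- A fixed nonzero `p` eventually lies beyond the radius at which the cutoff reaches `κ⁻¹`; the
origin is fixed by every tilt. -/
theorem tendsto_tiltMap {E : Type*} [NormedAddCommGroup E] [InnerProductSpace ℝ E] {κ : ℕ → ℝ}
    (hκ : ∀ n, 0 < κ n) (hκ0 : Tendsto κ atTop (𝓝 0)) {e p : E} (he : ‖e‖ = 1)
    (hp : 0 ≤ inner ℝ p e) : Tendsto (fun n => tiltMap (κ n) e p) atTop (𝓝 p) := by
  rcases eq_or_ne p 0 with rfl | hp0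
  · have : ∀ n, tiltMap (κ n) e 0 = 0 := fun n => by simp [tiltMap]
    simp [this]
  have h1 : Tendsto (fun n => (κ n)⁻¹) atTop atTop :=
    (tendsto_nhdsWithin_iff.2 ⟨hκ0, Eventually.of_forall hκ⟩).inv_tendsto_nhdsGT_zero
  have h2 : Tendsto (fun n => Real.exp (-(κ n)⁻¹ ^ 2)) atTop (𝓝 0) :=
    Real.tendsto_exp_neg_atTop_nhds_zero.comp ((tendsto_pow_atTop two_ne_zero).comp h1)
  rw [tendsto_iff_norm_sub_tendsto_zero]
  have h3 : Tendsto (fun n => κ n * ‖p‖) atTop (𝓝 0) := by simpa using hκ0.mul_const ‖p‖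
  refine squeeze_zero' (Eventually.of_forall fun _ => norm_nonneg _) ?_ h3
  filter_upwards [h2.eventually_le_const (norm_pos_iff.2 hp0)] with n hn
  exact norm_tiltMap_sub_self_le (hκ n) he hp hn

theorem tendsto_eLpNorm_sub_of_dominated {d : ℕ} {f : ℕ → Space d → ℝ} {g b : Space d → ℝ}
    (hf : ∀ n, AEStronglyMeasurable (f n)) (hg : AEStronglyMeasurable g) (hb : MemLp b 2)
    (hfb : ∀ n, ∀ᵐ x, |f n x - g x| ≤ |b x|)
    (h : ∀ᵐ x, Tendsto (fun n => f n x) atTop (𝓝 (g x))) :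
    Tendsto (fun n => eLpNorm (f n - g) 2 volume) atTop (𝓝 0) := by
  have h1 : Tendsto (fun n => ∫⁻ x, ‖(f n - g) x‖ₑ ^ 2) atTop (𝓝 (∫⁻ _ : Space d, 0)) := by
    refine tendsto_lintegral_of_dominated_convergence' (fun x => ‖b x‖ₑ ^ 2)
      (fun n => ((hf n).sub hg).enorm.pow_const 2) (fun n => ?_)
      ((memLp_two_iff_lintegral hb.1).1 hb) ?_
    · filter_upwards [hfb n] with x hx
      gcongr
      exact enorm_le_iff_norm_le.2 hx
    · filter_upwards [h] with x hx
      have h2 := (ENNReal.continuous_pow 2).tendsto 0 |>.comp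
        (tendsto_iff_edist_tendsto_0.1 hx)
      simpa [Function.comp_def, edist_eq_enorm_sub] using h2
  simp only [lintegral_enorm_sq_eq, lintegral_zero] at h1
  have h2 := ((ENNReal.continuous_rpow_const (y := (1 / 2 : ℝ))).tendsto 0).comp h1
  rw [ENNReal.zero_rpow_of_pos (by norm_num)] at h2
  refine h2.congr fun n => ?_
  rw [Function.comp_apply, ← ENNReal.rpow_natCast, ← ENNReal.rpow_mul]
  norm_num

/-- Every admissible family of orbitals is approximated by the orbitals of angle fields, at no
additional cost. -/
theorem iInf_angleEnergy_le {d : ℕ} {u : Space d → ℝ} (hu : MemLp u 2) (hN : 1 ≤ numOrbitals u)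
    {Φ : Fin (numOrbitals u) → Space d → ℝ} (hΦ : Φ ∈ orbitalSetPlus u) {δ : ℝ} (hδ : 0 < δ) :
    ⨅ Θ ∈ angleSetPlus u ∩ almostOrthonormal u δ, angleEnergy u Θ ≤ kineticEnergy Φ := by
  let l : Fin (numOrbitals u) := ⟨numOrbitals u - 1, by omega⟩
  have hl : (l : ℕ) + 1 = numOrbitals u := by simp only [l]; omega
  let κ : ℕ → ℝ := fun n => 1 / ((n : ℝ) + 1)
  have hκ : ∀ n, 0 < κ n := fun n => Nat.one_div_pos_of_nat
  have hκ0 : Tendsto κ atTop (𝓝 0) := tendsto_one_div_add_atTop_nhds_zero_nat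
  have hen : ‖(EuclideanSpace.single l 1 : EuclideanSpace ℝ (Fin (numOrbitals u)))‖ = 1 := by
    simp
  have hM : ∀ k n, MemLp (angleOrbital u (tiltAngle (κ n) l Φ) k) 2 volume := fun k n =>
    ((angleEnergy_tiltAngle_le hu (hκ n) hl hΦ).1 k).1
  have hM' : ∀ k, MemLp (Φ k) 2 volume := fun k => (hΦ.1.1 k).1
  have hlim : ∀ k, Tendsto (fun n => eLpNorm (angleOrbital u (tiltAngle (κ n) l Φ) k - Φ k) 2
      volume) atTop (𝓝 0) := fun k => by
    refine tendsto_eLpNorm_sub_of_dominated (fun n => (hM k n).1) (hM' k).1 (hu.const_mul 2)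
      (fun n => ?_) ?_
    -- Old and new orbitals are both bounded by `|u|`, so `2u` dominates their difference.
    · filter_upwards [hΦ.1.2.2.2] with x hx
      have h1 := abs_le_of_sum_sq
        (two_mul_sum_angleOrbital_sq hN u (tiltAngle (κ n) l Φ) x) k
      have h2 := abs_le_of_sum_sq hx k
      rw [abs_mul, abs_two]
      linarith [abs_sub (angleOrbital u (tiltAngle (κ n) l Φ) k x) (Φ k x)]
    · filter_upwards [hΦ.2 l hl, hΦ.1.2.2.2] with x h1 h2
      simp only [angleOrbital_tiltAngle _ hl h1 h2]
      have h3 := tendsto_tiltMap hκ hκ0 hen (p := orbitalVector Φ x)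
        (by rwa [inner_orbitalVector_single])
      exact ((by fun_prop : Continuous fun p : EuclideanSpace ℝ (Fin (numOrbitals u)) =>
        p k).tendsto _).comp h3
  have horth : ∀ᶠ n in atTop, ∀ i j : Fin (numOrbitals u), i < j →
      |l2Inner (angleOrbital u (tiltAngle (κ n) l Φ) i)
        (angleOrbital u (tiltAngle (κ n) l Φ) j)| ≤ δ := by
    refine eventually_all.2 fun i => eventually_all.2 fun j => ?_
    by_cases hij : i < j
    · have h := (tendsto_l2Inner (hM i) (hM' i) (hM j) (hM' j) (hlim i) (hlim j)).abs
      rw [hΦ.1.2.1 i j hij.ne, abs_zero] at h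
      filter_upwards [h.eventually_le_const hδ] with n hn _ using hn
    · exact Eventually.of_forall fun n h => absurd h hij
  have hnorm : ∀ᶠ n in atTop, ∀ k : Fin (numOrbitals u), (k : ℕ) + 1 < numOrbitals u →
      |lpNorm (angleOrbital u (tiltAngle (κ n) l Φ) k) 2 volume - 1| ≤ δ := by
    refine eventually_all.2 fun k => ?_
    by_cases hk : (k : ℕ) + 1 < numOrbitals u
    · have h := ((tendsto_lpNorm (hM k) (hM' k) (hlim k)).sub_const 1).abs
      rw [hΦ.1.2.2.1 k hk, sub_self, abs_zero] at h
      filter_upwards [h.eventually_le_const hδ] with n hn _ using hn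
    · exact Eventually.of_forall fun n h => absurd h hk
  have hbound : Tendsto (fun n => ENNReal.ofReal (1 + κ n) ^ 2 * kineticEnergy Φ) atTop
      (𝓝 (kineticEnergy Φ)) := by
    have h1 : Tendsto (fun n => ENNReal.ofReal (1 + κ n)) atTop (𝓝 1) := by
      simpa using ENNReal.tendsto_ofReal (hκ0.const_add 1)
    have h2 := ENNReal.Tendsto.mul_const (b := kineticEnergy Φ)
      (((ENNReal.continuous_pow 2).tendsto 1).comp h1) (Or.inl (by simp))
    simpa using h2
  refine ge_of_tendsto hbound ?_
  filter_upwards [horth, hnorm] with n h1 h2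
  refine (iInf₂_le (tiltAngle (κ n) l Φ) ⟨tiltAngle_mem_angleSetPlus hu (hκ n) hl hΦ,
    fun j => ?_, h1, h2⟩).trans (angleEnergy_tiltAngle_le hu (hκ n) hl hΦ).2
  exact (memLp_tiltAngle hu (hκ n) hl hΦ j).locallyIntegrable (by norm_num)

theorem almostOrthonormal_mono {d : ℕ} (u : Space d → ℝ) {δ δ' : ℝ} (h : δ ≤ δ') :
    almostOrthonormal u δ ⊆ almostOrthonormal u δ' := fun _ hΘ =>
  ⟨hΘ.1, fun i j hij => (hΘ.2.1 i j hij).trans h, fun k hk => (hΘ.2.2 k hk).trans h⟩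

end AngleField

/-- For `d ≥ 1` and `u ∈ H¹(ℝ^d)` with `u ≠ 0` almost everywhere, the kinetic energy attains a
finite minimum `T⁺(u)` on `M_u⁺`, and `T⁺(u)` is the limit, as `δ ↓ 0`, of the infimum of the
angle-field energy over `S_u⁺ ∩ A_u^δ`. -/
theorem mainTheorem1 (d : ℕ) (hd : 1 ≤ d) (u : AngleField.Space d → ℝ)
    (hu : AngleField.MemH1 u) (hu0 : ∀ᵐ x, u x ≠ 0) :
    (∃ Φ ∈ AngleField.orbitalSetPlus u, AngleField.kineticEnergy Φ = AngleField.TPlus u) ∧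
    AngleField.TPlus u ≠ ⊤ ∧
    Tendsto
      (fun δ : ℝ => ⨅ Θ ∈ AngleField.angleSetPlus u ∩ AngleField.almostOrthonormal u δ,
        AngleField.angleEnergy u Θ)
      (𝓝[>] 0) (𝓝 (AngleField.TPlus u)) := by
  have hne := AngleField.orbitalSetPlus_nonempty hd hu hu0
  have hfin := AngleField.TPlus_ne_top hne
  obtain ⟨Φ, hΦ, hΦT⟩ := AngleField.exists_minimizer hu.1 hne
  refine ⟨⟨Φ, hΦ, hΦT⟩, hfin, tendsto_order.2 ⟨fun c hc => ?_, fun c hc => ?_⟩⟩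
  · obtain ⟨c', hcc', hc'⟩ := exists_between hc
    -- Otherwise the infimum is at most `c < c'` for arbitrarily small `δ`. Since the constraint
    -- sets shrink with `δ`, every tolerance then admits a field of energy at most `c'`,
    -- contradicting `c' < T⁺(u)`.
    by_contra hcon
    refine hc'.not_ge (AngleField.TPlus_le_of_angle hu.1 hu0 hc'.ne_top fun δ₀ hδ₀ => ?_)
    obtain ⟨δ, hδ, hδδ₀⟩ := ((not_eventually.1 hcon).and_eventually
      (Ioo_mem_nhdsGT hδ₀)).exists
    have h1 := (not_lt.1 hδ).trans_lt hcc'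
    simp only [iInf_lt_iff] at h1
    obtain ⟨Θ, hΘ, h2⟩ := h1
    exact ⟨Θ, ⟨hΘ.1, AngleField.almostOrthonormal_mono u hδδ₀.2.le hΘ.2⟩, h2.le⟩
  -- The upper bound, applied to the minimizer, holds for every `δ > 0` and not only in the limit.
  · filter_upwards [self_mem_nhdsWithin] with δ hδ
    refine (AngleField.iInf_angleEnergy_le hu.1 (AngleField.one_le_numOrbitals hu.1 hu0) hΦ
      hδ).trans_lt ?_
    rwa [hΦT]
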